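/- Let $X$ be a finite quandle, i.e. a finite set with a binary operation $*$ such that $a*a=a$, every map $x\mapsto x*b$ is a bijection, and $(a*b)*c=(a*c)*(b*c)$. Let $H$ be a group, not necessarily abelian, and let $\phi:X\times X\to H$ be a quandle 2-cocycle, i.e. $\phi(x,y)\,\phi(x*y,z)=\phi(x,z)\,\phi(x*z,y*z)$ and $\phi(x,x)=1$ for all $x,y,z\in X$. Assume that $\phi(y*z,z)=\phi(y,z)$ for all $y,z\in X$. Let $\widehat D$ be an oriented graph tangle diagram, i.e. the part of a diagram of an oriented spatial graph inside a square box whose boundary points are not vertices. Let $s\ge 0$ be an integer such that at each vertex of $\widehat D$ the number of incoming edges minus the number of outgoing edges is divisible by $s$, and assume that $h^s=1$ for all $h\in H$. A *coloring* of $\widehat D$ assigns an element of $X$ to each arc such that the following holds. (i) At each crossing with over-arc colored $y$ the under-arcs are colored $x$ and $x*y$, where the normal of the over-arc (the pair (tangent, normal) being positively oriented) points from the under-arc colored $x$ to the one colored $x*y$. (ii) For each vertex, if $a_1,\dots,a_k$ are the colors of its incident arcs in clockwise order, and $\epsilon_i=1$ if the $i$-th arc points to the vertex and $\epsilon_i=-1$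 otherwise, then every color $x$ of an arc of $\widehat D$ is fixed by applying successively, for $i=1,\dots,k$, the map $x\mapsto x*a_i$ if $\epsilon_i=1$ and its inverse if $\epsilon_i=-1$. A coloring is *vertex-constant* if all arcs incident to the same vertex have the same color. An *extended walk* from a boundary point $b$ to a boundary point $b'$ is a walk in the graph that starts along the edge at $b$, ends along the edge at $b'$, and may traverse edges in both directions and repeatedly (for a loop, the direction of the traversal is part of the walk). Its *length* is the number of whole edges in it, the edge parts ending at boundary points not being counted. For an extended walk $w$ and a coloring $\mathcal C$, let $\kappa_1,\dots,\kappa_r$ be the crossings that $w$ meets, in order and with repetitions, along the under-arc, and put $$\Psi_{(w,\phi,\mathcal C)}=\phi(x_{\kappa_1},y_{\kappa_1})^{\epsilon(\kappa_1)}\cdots\phi(x_{\kappa_r},y_{\kappa_r})^{\epsilon(\kappa_r)}.$$ Here $y_\kappa$ is the color of the over-arc, $x_\kappa$ is the color of the under-arc from which the normal of the over-arc points, and $\epsilon(\kappa)=\pm1$ is the sign of the crossing, where the over-arc has its orientation in $\widehat D$ and the under-arc is directed as the walk $w$. So $\epsilon(\kappa)$ is the sign of the crossing in $\widehat D$ when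 $w$ passes it along the orientation of the under-arc, and the opposite sign otherwise. For boundary points $b,b'$, an integer $n\ge 0$ and $q\in X$, let $\Psi_q(\widehat D)$ be the multiset of the elements $\Psi_{(w,\phi,\mathcal C)}\in H$, where $w$ runs over the extended walks from $b$ to $b'$ of length at most $n$, and $\mathcal C$ over the vertex-constant colorings for which the arc at $b$ has color $q$. Let $\Psi(\widehat D)$ be the multiset $\{\Psi_q(\widehat D)\}_{q\in X}$. **Theorem.** Let the diagram $\widehat D'$ be obtained from $\widehat D$ by a finite sequence of planar isotopies and graphical Reidemeister moves, inside the box and with fixed boundary points: R1 (adding or removing a curl), R2 (pushing a strand over another one, or back), R3 (pushing a strand past a crossing of two others), R4 (twisting two neighboring edges at a vertex around each other by a half-turn, or undoing this), R5 (moving a strand over or under a vertex), in all versions and with all orientations. Then, for all $b,b',n$ as above, $\Psi_q(\widehat D)=\Psi_q(\widehat D')$ for every $q\in X$, and $\Psi(\widehat D)=\Psi(\widehat D')$. -/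

import Mathlib

open scoped Quandles

namespace GraphTangle

/-! ### Diagrams

A diagram is recorded by its planar map.  The nodes of the map are the crossings, the vertices of the
graph, the boundary points, and (auxiliary) regular points in the interior of a strand, called joints.
A *dart* is the germ of a strand at a node.  The strands are cut by the nodes into segments; every
segment has two ends, and `link` exchanges the two darts at these ends. -/

/-- Darts: one at each boundary point, four at each crossing (numbered counterclockwise), two at each
joint, and the legs at the vertices. -/
inductive Dart (B C J L : Type) : Type
  | bd (b : B) : Dart B C J L
  | cr (c : C) (i : Fin 4) : Dart B C J L
  | jt (j : J) (i : Bool) : Dart B C J L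
  | leg (l : L) : Dart B C J L

/-- An oriented graph tangle diagram with set of boundary points `B`, as a map (no planarity yet).
`tail d = true` means that the orientation of the segment at `d` points away from the node of `d`. -/
structure Diagram (B : Type) where
  Crossing : Type
  Joint : Type
  Vertex : Type
  Leg : Type
  finite_crossing : Finite Crossing
  finite_joint : Finite Joint
  finite_vertex : Finite Vertex
  finite_leg : Finite Leg
  /-- the vertex at which a leg sits -/
  vtx : Leg → Vertex
  /-- the counterclockwise next leg at the same vertex -/
  next : Equiv.Perm Leg
  vtx_eq_iff : ∀ l l', vtx l = vtx l' ↔ next.SameCycle l l'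
  /-- which of the four darts at a crossing belong to the over-arc -/
  isOver : Crossing → Fin 4 → Bool
  isOver_succ : ∀ c i, isOver c (i + 1) = !isOver c i
  tail : Dart B Crossing Joint Leg → Bool
  tail_cr : ∀ c i, tail (.cr c (i + 2)) = !tail (.cr c i)
  tail_jt : ∀ j, tail (.jt j true) = !tail (.jt j false)
  link : Dart B Crossing Joint Leg → Dart B Crossing Joint Leg
  link_link : ∀ d, link (link d) = d
  tail_link : ∀ d, tail (link d) = !tail d

namespace Diagram

variable {B : Type}

/-- The darts of a diagram. -/
abbrev Darts (D : Diagram B) : Type := Dart B D.Crossing D.Joint D.Leg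

/-- The number of incoming edge ends at a vertex. -/
noncomputable def inDegree (D : Diagram B) (v : D.Vertex) : ℕ :=
  Nat.card {l : D.Leg // D.vtx l = v ∧ D.tail (.leg l) = false}

/-- The number of outgoing edge ends at a vertex. -/
noncomputable def outDegree (D : Diagram B) (v : D.Vertex) : ℕ :=
  Nat.card {l : D.Leg // D.vtx l = v ∧ D.tail (.leg l) = true}

/-! ### Planarity -/

/-- The involution `link` as a permutation. -/
def linkPerm (D : Diagram B) : Equiv.Perm D.Darts where
  toFun := D.link
  invFun := D.link
  left_inv := D.link_link
  right_inv := D.link_link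

/-- The counterclockwise rotation of the darts around their nodes.  All boundary points together form
one outer node, around which the rotation is `β`. -/
def rot (D : Diagram B) (β : Equiv.Perm B) : Equiv.Perm D.Darts where
  toFun
    | .bd b => .bd (β b)
    | .cr c i => .cr c (i + 1)
    | .jt j i => .jt j (!i)
    | .leg l => .leg (D.next l)
  invFun
    | .bd b => .bd (β.symm b)
    | .cr c i => .cr c (i - 1)
    | .jt j i => .jt j (!i)
    | .leg l => .leg (D.next.symm l)
  left_inv := by rintro (b | ⟨c, i⟩ | ⟨j, i⟩ | l) <;> simp
  right_inv := by rintro (b | ⟨c, i⟩ | ⟨j, i⟩ | l) <;> simp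

end Diagram

/-- The number of orbits of a permutation group. -/
noncomputable def numOrbits {α : Type} (G : Subgroup (Equiv.Perm α)) : ℕ :=
  Nat.card (MulAction.orbitRel.Quotient G α)

/-- Euler's formula `V - E + F = 2 c` for the map on the sphere obtained by collapsing the outside of
the box to one outer node: vertices, edges, faces and components are the orbits of the rotation, of
`link`, of their product, and of the group they generate.  The `m` boundary points are numbered
counterclockwise along the boundary of the box, hence clockwise around the outer node.  (Vertices
without edges have no darts and do not enter the count.) -/
def Diagram.Planar {m : ℕ} (D : Diagram (Fin m)) : Prop :=
  let ρ := D.rot (finRotate m)⁻¹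
  numOrbits (Subgroup.zpowers ρ) + numOrbits (Subgroup.zpowers (ρ * D.linkPerm)) =
    numOrbits (Subgroup.zpowers D.linkPerm) + 2 * numOrbits (Subgroup.closure {ρ, D.linkPerm})

/-- An oriented graph tangle diagram in a square box with `m` boundary points. -/
structure GraphTangleDiagram (m : ℕ) extends Diagram (Fin m) where
  planar : toDiagram.Planar

namespace Diagram

variable {B : Type}

/-! ### Isomorphism, subdivision and gluing of diagrams -/

/-- The map on darts induced by maps of crossings, joints and legs, where the crossing `c` is rotated
by `s c` quarter turns, and the two darts at `j` are exchanged if `t j` holds. -/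
def mapDart {C J L C' J' L' : Type} (fc : C → C') (s : C → Fin 4) (fj : J → J') (t : J → Bool)
    (fl : L → L') : Dart B C J L → Dart B C' J' L'
  | .bd b => .bd b
  | .cr c i => .cr (fc c) (i + s c)
  | .jt j i => .jt (fj j) (i ^^ t j)
  | .leg l => .leg (fl l)

/-- Two diagrams are the same up to renaming of their nodes (planar isotopy fixing the boundary). -/
structure Iso (D D' : Diagram B) where
  crossing : D.Crossing ≃ D'.Crossing
  turn : D.Crossing → Fin 4
  joint : D.Joint ≃ D'.Joint
  flip : D.Joint → Bool
  vertex : D.Vertex ≃ D'.Vertex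
  leg : D.Leg ≃ D'.Leg
  vtx_leg : ∀ l, D'.vtx (leg l) = vertex (D.vtx l)
  next_leg : ∀ l, D'.next (leg l) = leg (D.next l)
  isOver_eq : ∀ c i, D'.isOver (crossing c) (i + turn c) = D.isOver c i
  tail_eq : ∀ d, D'.tail (mapDart crossing turn joint flip leg d) = D.tail d
  link_eq : ∀ d, D'.link (mapDart crossing turn joint flip leg d) =
    mapDart crossing turn joint flip leg (D.link d)

/-- The darts of `D` as darts of a diagram with one additional joint. -/
def oldDart {C J L : Type} : Dart B C J L → Dart B C (Option J) L
  | .bd b => .bd b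
  | .cr c i => .cr c i
  | .jt j i => .jt (some j) i
  | .leg l => .leg l

/-- A dart of a diagram with one additional joint is either old or one of the two darts there. -/
def oldOrNew {C J L : Type} : Dart B C (Option J) L → Dart B C J L ⊕ Bool
  | .bd b => .inl (.bd b)
  | .cr c i => .inl (.cr c i)
  | .jt (some j) i => .inl (.jt j i)
  | .jt none i => .inr i
  | .leg l => .inl (.leg l)

theorem oldOrNew_oldDart {C J L : Type} (d : Dart B C J L) : oldOrNew (oldDart d) = .inl d := by
  cases d <;> rfl

theorem oldOrNew_cases {C J L : Type} (d : Dart B C (Option J) L) :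
    (∃ x, d = oldDart x) ∨ ∃ i, d = .jt none i := by
  rcases d with b | ⟨c, i⟩ | ⟨_ | j, i⟩ | l
  · exact .inl ⟨.bd b, rfl⟩
  · exact .inl ⟨.cr c i, rfl⟩
  · exact .inr ⟨i, rfl⟩
  · exact .inl ⟨.jt j i, rfl⟩
  · exact .inl ⟨.leg l, rfl⟩

theorem link_ne (D : Diagram B) (d : D.Darts) : D.link d ≠ d := by
  intro h
  have := D.tail_link d
  rw [h] at this
  cases hd : D.tail d <;> simp [hd] at this

open Classical in
/-- Put a new joint on the segment that has `d₀` and `link d₀` as its two ends. -/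
noncomputable def subdivide (D : Diagram B) (d₀ : D.Darts) : Diagram B where
  Crossing := D.Crossing
  Joint := Option D.Joint
  Vertex := D.Vertex
  Leg := D.Leg
  finite_crossing := D.finite_crossing
  finite_joint := by have := D.finite_joint; infer_instance
  finite_vertex := D.finite_vertex
  finite_leg := D.finite_leg
  vtx := D.vtx
  next := D.next
  vtx_eq_iff := D.vtx_eq_iff
  isOver := D.isOver
  isOver_succ := D.isOver_succ
  tail d := Sum.elim D.tail (fun i => D.tail d₀ ^^ !i) (oldOrNew d)
  tail_cr c i := D.tail_cr c i
  tail_jt := by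
    rintro (_ | j)
    · simp [oldOrNew]
    · exact D.tail_jt j
  link d := Sum.elim
    (fun x => if x = d₀ then .jt none false else if x = D.link d₀ then .jt none true
      else oldDart (D.link x))
    (fun i => if i then oldDart (D.link d₀) else oldDart d₀) (oldOrNew d)
  link_link d := by
    have hn : ∀ i, oldOrNew (.jt none i : Dart B D.Crossing (Option D.Joint) D.Leg) = .inr i :=
      fun _ => rfl
    obtain ⟨x, rfl⟩ | ⟨i, rfl⟩ := oldOrNew_cases d
    · by_cases h : x = d₀
      · simp [h, hn, oldOrNew_oldDart]
      · by_cases h' : x = D.link d₀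
        · simp [h', hn, oldOrNew_oldDart, D.link_ne d₀]
        · have h1 : D.link x ≠ d₀ := fun e => h' (by rw [← e, D.link_link])
          have h2 : D.link x ≠ D.link d₀ := fun e => h (by rw [← D.link_link x, e, D.link_link])
          simp [h, h', h1, h2, oldOrNew_oldDart, D.link_link]
    · cases i <;> simp [hn, oldOrNew_oldDart, D.link_ne d₀]
  tail_link d := by
    have hn : ∀ i, oldOrNew (.jt none i : Dart B D.Crossing (Option D.Joint) D.Leg) = .inr i :=
      fun _ => rfl
    obtain ⟨x, rfl⟩ | ⟨i, rfl⟩ := oldOrNew_cases d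
    · by_cases h : x = d₀
      · simp [h, hn, oldOrNew_oldDart]
      · by_cases h' : x = D.link d₀
        · simp [h', hn, oldOrNew_oldDart, D.link_ne d₀, D.tail_link]
        · simp [h, h', oldOrNew_oldDart, D.tail_link]
    · cases i <;> simp [hn, oldOrNew_oldDart, D.tail_link]

section Glue

variable {K C₁ J₁ L₁ C₂ J₂ L₂ : Type}

/-- A dart of the outer diagram, as a dart of the glued diagram. -/
def outerDart : Dart (B ⊕ K) C₁ J₁ L₁ → Dart B (C₁ ⊕ C₂) ((J₁ ⊕ J₂) ⊕ K) (L₁ ⊕ L₂)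
  | .bd (.inl b) => .bd b
  | .bd (.inr k) => .jt (.inr k) false
  | .cr c i => .cr (.inl c) i
  | .jt j i => .jt (.inl (.inl j)) i
  | .leg l => .leg (.inl l)

/-- A dart of the inner diagram, as a dart of the glued diagram. -/
def innerDart : Dart K C₂ J₂ L₂ → Dart B (C₁ ⊕ C₂) ((J₁ ⊕ J₂) ⊕ K) (L₁ ⊕ L₂)
  | .bd k => .jt (.inr k) true
  | .cr c i => .cr (.inr c) i
  | .jt j i => .jt (.inl (.inr j)) i
  | .leg l => .leg (.inr l)

/-- Every dart of the glued diagram is one of the outer or of the inner diagram. -/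
def glueSide : Dart B (C₁ ⊕ C₂) ((J₁ ⊕ J₂) ⊕ K) (L₁ ⊕ L₂) →
    Dart (B ⊕ K) C₁ J₁ L₁ ⊕ Dart K C₂ J₂ L₂
  | .bd b => .inl (.bd (.inl b))
  | .cr (.inl c) i => .inl (.cr c i)
  | .cr (.inr c) i => .inr (.cr c i)
  | .jt (.inl (.inl j)) i => .inl (.jt j i)
  | .jt (.inl (.inr j)) i => .inr (.jt j i)
  | .jt (.inr k) false => .inl (.bd (.inr k))
  | .jt (.inr k) true => .inr (.bd k)
  | .leg (.inl l) => .inl (.leg l)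
  | .leg (.inr l) => .inr (.leg l)

theorem glueSide_outerDart (d : Dart (B ⊕ K) C₁ J₁ L₁) :
    glueSide (outerDart d : Dart B (C₁ ⊕ C₂) ((J₁ ⊕ J₂) ⊕ K) (L₁ ⊕ L₂)) = .inl d := by
  rcases d with (b | k) | _ | _ | _ <;> rfl

theorem glueSide_innerDart (d : Dart K C₂ J₂ L₂) :
    glueSide (innerDart d : Dart B (C₁ ⊕ C₂) ((J₁ ⊕ J₂) ⊕ K) (L₁ ⊕ L₂)) = .inr d := by
  rcases d with _ | _ | _ | _ <;> rfl

theorem glueSide_cases (d : Dart B (C₁ ⊕ C₂) ((J₁ ⊕ J₂) ⊕ K) (L₁ ⊕ L₂)) :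
    (∃ x, d = outerDart x) ∨ ∃ x, d = innerDart x := by
  rcases d with b | ⟨c | c, i⟩ | ⟨(j | j) | k, i⟩ | (l | l)
  · exact .inl ⟨.bd (.inl b), rfl⟩
  · exact .inl ⟨.cr c i, rfl⟩
  · exact .inr ⟨.cr c i, rfl⟩
  · exact .inl ⟨.jt j i, rfl⟩
  · exact .inr ⟨.jt j i, rfl⟩
  · cases i
    · exact .inl ⟨.bd (.inr k), rfl⟩
    · exact .inr ⟨.bd k, rfl⟩
  · exact .inl ⟨.leg l, rfl⟩
  · exact .inr ⟨.leg l, rfl⟩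

theorem sameCycle_sumCongr_inl {α β : Type} (p : Equiv.Perm α) (q : Equiv.Perm β) (a b : α) :
    (Equiv.Perm.sumCongr p q).SameCycle (.inl a) (.inl b) ↔ p.SameCycle a b := by
  have h : ∀ n : ℤ, (Equiv.Perm.sumCongr p q) ^ n = Equiv.Perm.sumCongr (p ^ n) (q ^ n) := fun n =>
    (map_zpow (Equiv.Perm.sumCongrHom α β) (p, q) n).symm
  simp [Equiv.Perm.SameCycle, h]

theorem sameCycle_sumCongr_inr {α β : Type} (p : Equiv.Perm α) (q : Equiv.Perm β) (a b : β) :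
    (Equiv.Perm.sumCongr p q).SameCycle (.inr a) (.inr b) ↔ q.SameCycle a b := by
  have h : ∀ n : ℤ, (Equiv.Perm.sumCongr p q) ^ n = Equiv.Perm.sumCongr (p ^ n) (q ^ n) := fun n =>
    (map_zpow (Equiv.Perm.sumCongrHom α β) (p, q) n).symm
  simp [Equiv.Perm.SameCycle, h]

theorem not_sameCycle_sumCongr {α β : Type} (p : Equiv.Perm α) (q : Equiv.Perm β) (a : α) (b : β) :
    ¬ (Equiv.Perm.sumCongr p q).SameCycle (.inl a) (.inr b) := by
  have h : ∀ n : ℤ, (Equiv.Perm.sumCongr p q) ^ n = Equiv.Perm.sumCongr (p ^ n) (q ^ n) := fun n =>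
    (map_zpow (Equiv.Perm.sumCongrHom α β) (p, q) n).symm
  simp [Equiv.Perm.SameCycle, h]

/-- Fill a hole of the outer diagram `O`, whose boundary consists of the points `B` on the box and of
the points `K` around the hole, with the inner diagram `I` with boundary `K`.  Each point of `K`
becomes a joint.  The orientations have to match. -/
def glue [Finite K] (O : Diagram (B ⊕ K)) (I : Diagram K)
    (h : ∀ k, O.tail (.bd (.inr k)) = !I.tail (.bd k)) : Diagram B where
  Crossing := O.Crossing ⊕ I.Crossing
  Joint := (O.Joint ⊕ I.Joint) ⊕ K
  Vertex := O.Vertex ⊕ I.Vertex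
  Leg := O.Leg ⊕ I.Leg
  finite_crossing := by have := O.finite_crossing; have := I.finite_crossing; infer_instance
  finite_joint := by have := O.finite_joint; have := I.finite_joint; infer_instance
  finite_vertex := by have := O.finite_vertex; have := I.finite_vertex; infer_instance
  finite_leg := by have := O.finite_leg; have := I.finite_leg; infer_instance
  vtx := Sum.map O.vtx I.vtx
  next := Equiv.Perm.sumCongr O.next I.next
  vtx_eq_iff := by
    rintro (l | l) (l' | l')
    · simp [sameCycle_sumCongr_inl, O.vtx_eq_iff]
    · simp [not_sameCycle_sumCongr]
    · rw [Equiv.Perm.sameCycle_comm]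
      simp [not_sameCycle_sumCongr]
    · simp [sameCycle_sumCongr_inr, I.vtx_eq_iff]
  isOver := Sum.elim O.isOver I.isOver
  isOver_succ := by
    rintro (c | c) i
    · exact O.isOver_succ c i
    · exact I.isOver_succ c i
  tail d := Sum.elim O.tail I.tail (glueSide d)
  tail_cr := by
    rintro (c | c) i
    · exact O.tail_cr c i
    · exact I.tail_cr c i
  tail_jt := by
    rintro ((j | j) | k)
    · exact O.tail_jt j
    · exact I.tail_jt j
    · simp [glueSide, h]
  link d := Sum.elim (fun x => outerDart (O.link x)) (fun x => innerDart (I.link x)) (glueSide d)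
  link_link d := by
    obtain ⟨x, rfl⟩ | ⟨x, rfl⟩ := glueSide_cases d
    · simp [glueSide_outerDart, O.link_link]
    · simp [glueSide_innerDart, I.link_link]
  tail_link d := by
    obtain ⟨x, rfl⟩ | ⟨x, rfl⟩ := glueSide_cases d
    · simp [glueSide_outerDart, O.tail_link]
    · simp [glueSide_innerDart, I.tail_link]

end Glue

/-! ### The local pictures of the moves

In each picture the boundary points of the disc are named counterclockwise, and the four darts at
a crossing are numbered counterclockwise.  Booleans `f`, `g` give orientations of strands. -/

/-- A single strand, from the boundary point `false` to the boundary point `true` if `f = true`, and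
in the opposite direction otherwise. -/
def strand (f : Bool) : Diagram Bool where
  Crossing := Empty
  Joint := Empty
  Vertex := Empty
  Leg := Empty
  finite_crossing := inferInstance
  finite_joint := inferInstance
  finite_vertex := inferInstance
  finite_leg := inferInstance
  vtx := id
  next := 1
  vtx_eq_iff l := l.elim
  isOver c := c.elim
  isOver_succ c := c.elim
  tail
    | .bd b => f ^^ b
  tail_cr c := c.elim
  tail_jt j := j.elim
  link
    | .bd b => .bd (!b)
  link_link := by rintro (b | ⟨⟨⟩, _⟩ | ⟨⟨⟩, _⟩ | ⟨⟨⟩⟩); simp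
  tail_link := by rintro (b | ⟨⟨⟩, _⟩ | ⟨⟨⟩, _⟩ | ⟨⟨⟩⟩); simp

/-- A strand with a curl.  Coming from the boundary point `false` it enters the crossing at `0`, leaves
it at `2`, returns to it at `1` (if `left = true`) or `3` (if `left = false`), and ends at the boundary
point `true`.  The part from `0` to `2` is the over-arc if `o = true`. -/
def curl (f left o : Bool) : Diagram Bool where
  Crossing := Unit
  Joint := Empty
  Vertex := Empty
  Leg := Empty
  finite_crossing := inferInstance
  finite_joint := inferInstance
  finite_vertex := inferInstance
  finite_leg := inferInstance
  vtx := id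
  next := 1
  vtx_eq_iff l := l.elim
  isOver _ i := ![o, !o, o, !o] i
  isOver_succ _ i := by fin_cases i <;> simp
  tail
    | .bd b => f ^^ b
    | .cr _ i => ![!f, !(f ^^ !left), f, f ^^ !left] i
  tail_cr _ i := by fin_cases i <;> simp
  tail_jt j := j.elim
  link
    | .bd false => .cr () 0
    | .bd true => .cr () (if left then 3 else 1)
    | .cr _ 0 => .bd false
    | .cr _ 1 => if left then .cr () 2 else .bd true
    | .cr _ 2 => .cr () (if left then 1 else 3)
    | .cr _ 3 => if left then .bd true else .cr () 2
  link_link := by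
    rintro (b | ⟨⟨⟩, i⟩ | ⟨⟨⟩, _⟩ | ⟨⟨⟩⟩)
    · cases b <;> cases left <;> rfl
    · fin_cases i <;> cases left <;> rfl
  tail_link := by
    rintro (b | ⟨⟨⟩, i⟩ | ⟨⟨⟩, _⟩ | ⟨⟨⟩⟩)
    · cases b <;> cases left <;> cases f <;> rfl
    · fin_cases i <;> cases left <;> cases f <;> rfl

/-- Two parallel vertical strands.  The boundary points are `0` (south-east), `1` (north-east),
`2` (north-west), `3` (south-west); the strands join `0` with `1` and `3` with `2`, and run upwards
if `f = true`, respectively `g = true`. -/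
def parallel (f g : Bool) : Diagram (Fin 4) where
  Crossing := Empty
  Joint := Empty
  Vertex := Empty
  Leg := Empty
  finite_crossing := inferInstance
  finite_joint := inferInstance
  finite_vertex := inferInstance
  finite_leg := inferInstance
  vtx := id
  next := 1
  vtx_eq_iff l := l.elim
  isOver c := c.elim
  isOver_succ c := c.elim
  tail
    | .bd b => ![f, !f, !g, g] b
  tail_cr c := c.elim
  tail_jt j := j.elim
  link
    | .bd b => .bd (![1, 0, 3, 2] b)
  link_link := by
    rintro (b | ⟨⟨⟩, _⟩ | ⟨⟨⟩, _⟩ | ⟨⟨⟩⟩)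
    fin_cases b <;> rfl
  tail_link := by
    rintro (b | ⟨⟨⟩, _⟩ | ⟨⟨⟩, _⟩ | ⟨⟨⟩⟩)
    fin_cases b <;> simp

/-- The two strands of `parallel f g` after the right one was pushed over (`o = true`) or under
(`o = false`) the left one.  There are a lower crossing `false` and an upper crossing `true`; at both,
the darts point to the south-east, north-east, north-west and south-west, in this order. -/
def bigon (f g o : Bool) : Diagram (Fin 4) where
  Crossing := Bool
  Joint := Empty
  Vertex := Empty
  Leg := Empty
  finite_crossing := inferInstance
  finite_joint := inferInstance
  finite_vertex := inferInstance
  finite_leg := inferInstance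
  vtx := id
  next := 1
  vtx_eq_iff l := l.elim
  isOver
    | false, i => ![o, !o, o, !o] i
    | true, i => ![!o, o, !o, o] i
  isOver_succ c i := by cases c <;> fin_cases i <;> simp
  tail
    | .bd b => ![f, !f, !g, g] b
    | .cr false i => ![!f, g, f, !g] i
    | .cr true i => ![!g, f, g, !f] i
  tail_cr c i := by cases c <;> fin_cases i <;> simp
  tail_jt j := j.elim
  link
    | .bd 0 => .cr false 0
    | .bd 1 => .cr true 1
    | .bd 2 => .cr true 2
    | .bd 3 => .cr false 3
    | .cr false 0 => .bd 0
    | .cr false 1 => .cr true 0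
    | .cr false 2 => .cr true 3
    | .cr false 3 => .bd 3
    | .cr true 0 => .cr false 1
    | .cr true 1 => .bd 1
    | .cr true 2 => .bd 2
    | .cr true 3 => .cr false 2
  link_link := by
    rintro (b | ⟨c, i⟩ | ⟨⟨⟩, _⟩ | ⟨⟨⟩⟩)
    · fin_cases b <;> rfl
    · cases c <;> fin_cases i <;> rfl
  tail_link := by
    rintro (b | ⟨c, i⟩ | ⟨⟨⟩, _⟩ | ⟨⟨⟩⟩)
    · fin_cases b <;> simp
    · cases c <;> fin_cases i <;> simp

/-- Three strands that cross pairwise.  The boundary points `0, …, 5` are the corners of a hexagon; for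
`p = 0, 1, 2` the strand `p` joins `p` with `p + 3`, and runs from `p` to `p + 3` if `f p = true`.  The
strand `p` has the height `h p`.  The crossing `p` is the one of the two strands other than `p`; its
darts point to the four boundary points of these, in increasing order.  Coming from the points
`0, 1, 2`, the strands `0, 1, 2` first meet the strands `1, 0, 0` if `side = false`, and the strands
`2, 2, 1` if `side = true`. -/
def triangle (f : Fin 3 → Bool) (h : Equiv.Perm (Fin 3)) (side : Bool) : Diagram (Fin 6) where
  Crossing := Fin 3
  Joint := Empty
  Vertex := Empty
  Leg := Empty
  finite_crossing := inferInstance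
  finite_joint := inferInstance
  finite_vertex := inferInstance
  finite_leg := inferInstance
  vtx := id
  next := 1
  vtx_eq_iff l := l.elim
  isOver
    | 2, i => ![decide (h 1 < h 0), decide (h 0 < h 1), decide (h 1 < h 0), decide (h 0 < h 1)] i
    | 1, i => ![decide (h 2 < h 0), decide (h 0 < h 2), decide (h 2 < h 0), decide (h 0 < h 2)] i
    | 0, i => ![decide (h 2 < h 1), decide (h 1 < h 2), decide (h 2 < h 1), decide (h 1 < h 2)] i
  isOver_succ c i := by
    have key : ∀ p q : Fin 3, p ≠ q → decide (h p < h q) = !decide (h q < h p) := by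
      intro p q hpq
      have hne : h p ≠ h q := fun e => hpq (h.injective e)
      rcases lt_or_gt_of_ne hne with hl | hl <;> simp [hl, hl.le]
    have h01 := key 0 1 (by decide)
    have h02 := key 0 2 (by decide)
    have h12 := key 1 2 (by decide)
    fin_cases c <;> fin_cases i <;> simp [h01, h02, h12]
  tail
    | .bd b => ![f 0, f 1, f 2, !f 0, !f 1, !f 2] b
    | .cr 2 i => ![!f 0, !f 1, f 0, f 1] i
    | .cr 1 i => ![!f 0, !f 2, f 0, f 2] i
    | .cr 0 i => ![!f 1, !f 2, f 1, f 2] i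
  tail_cr c i := by fin_cases c <;> fin_cases i <;> simp
  tail_jt j := j.elim
  link := match side with
    | false => fun
      | .bd 0 => .cr 2 0
      | .cr 2 0 => .bd 0
      | .cr 2 2 => .cr 1 0
      | .cr 1 0 => .cr 2 2
      | .cr 1 2 => .bd 3
      | .bd 3 => .cr 1 2
      | .bd 1 => .cr 2 1
      | .cr 2 1 => .bd 1
      | .cr 2 3 => .cr 0 0
      | .cr 0 0 => .cr 2 3
      | .cr 0 2 => .bd 4
      | .bd 4 => .cr 0 2
      | .bd 2 => .cr 1 1
      | .cr 1 1 => .bd 2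
      | .cr 1 3 => .cr 0 1
      | .cr 0 1 => .cr 1 3
      | .cr 0 3 => .bd 5
      | .bd 5 => .cr 0 3
    | true => fun
      | .bd 0 => .cr 1 0
      | .cr 1 0 => .bd 0
      | .cr 1 2 => .cr 2 0
      | .cr 2 0 => .cr 1 2
      | .cr 2 2 => .bd 3
      | .bd 3 => .cr 2 2
      | .bd 1 => .cr 0 0
      | .cr 0 0 => .bd 1
      | .cr 0 2 => .cr 2 1
      | .cr 2 1 => .cr 0 2
      | .cr 2 3 => .bd 4
      | .bd 4 => .cr 2 3
      | .bd 2 => .cr 0 1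
      | .cr 0 1 => .bd 2
      | .cr 0 3 => .cr 1 1
      | .cr 1 1 => .cr 0 3
      | .cr 1 3 => .bd 5
      | .bd 5 => .cr 1 3
  link_link := by
    rintro (b | ⟨c, i⟩ | ⟨⟨⟩, _⟩ | ⟨⟨⟩⟩)
    · cases side <;> fin_cases b <;> rfl
    · cases side <;> fin_cases c <;> fin_cases i <;> rfl
  tail_link := by
    rintro (b | ⟨c, i⟩ | ⟨⟨⟩, _⟩ | ⟨⟨⟩⟩)
    · cases side <;> fin_cases b <;> simp
    · cases side <;> fin_cases c <;> fin_cases i <;> simp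

theorem sameCycle_finRotate (n : ℕ) (i j : Fin n) : (finRotate n).SameCycle i j := by
  match n with
  | 0 => exact i.elim0
  | 1 => rw [Subsingleton.elim i j]
  | n + 2 =>
    refine isCycle_finRotate.sameCycle ?_ ?_ <;>
      rw [← Equiv.Perm.mem_support, support_finRotate] <;> exact Finset.mem_univ _

/-- A vertex with the legs `0, …, n - 1` in counterclockwise order, the leg `i` going straight to the
boundary point `i`.  The leg `i` points away from the vertex if `t i = true`. -/
def star {n : ℕ} (t : Fin n → Bool) : Diagram (Fin n) where
  Crossing := Empty
  Joint := Empty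
  Vertex := Unit
  Leg := Fin n
  finite_crossing := inferInstance
  finite_joint := inferInstance
  finite_vertex := inferInstance
  finite_leg := inferInstance
  vtx _ := ()
  next := finRotate n
  vtx_eq_iff l l' := by simp [sameCycle_finRotate]
  isOver c := c.elim
  isOver_succ c := c.elim
  tail
    | .bd i => !t i
    | .leg i => t i
  tail_cr c := c.elim
  tail_jt j := j.elim
  link
    | .bd i => .leg i
    | .leg i => .bd i
  link_link := by rintro (b | ⟨⟨⟩, _⟩ | ⟨⟨⟩, _⟩ | l) <;> rfl
  tail_link := by rintro (b | ⟨⟨⟩, _⟩ | ⟨⟨⟩, _⟩ | l) <;> simp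

/-- The vertex of `star t` after its neighbouring edges at the boundary points `0` and `1` were twisted
around each other: they now start from the legs `1` and `0`, and cross once.  At the crossing the darts
`0, 1, 2, 3` point to the boundary points `0`, `1` and to the legs `1`, `0`.  The edge at the boundary
point `0` is the over-arc if `o = true`. -/
def twistedStar {n : ℕ} (t : Fin (n + 2) → Bool) (o : Bool) : Diagram (Fin (n + 2)) where
  Crossing := Unit
  Joint := Empty
  Vertex := Unit
  Leg := Fin (n + 2)
  finite_crossing := inferInstance
  finite_joint := inferInstance
  finite_vertex := inferInstance
  finite_leg := inferInstance
  vtx _ := ()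
  next := finRotate (n + 2)
  vtx_eq_iff l l' := by simp [sameCycle_finRotate]
  isOver _ i := ![o, !o, o, !o] i
  isOver_succ _ i := by fin_cases i <;> simp
  tail
    | .bd i => !t i
    | .cr _ i => ![t 0, t 1, !t 0, !t 1] i
    | .leg i => t (Equiv.swap 0 1 i)
  tail_cr _ i := by fin_cases i <;> simp
  tail_jt j := j.elim
  link
    | .bd i => if i = 0 then .cr () 0 else if i = 1 then .cr () 1 else .leg i
    | .leg i => if i = 0 then .cr () 3 else if i = 1 then .cr () 2 else .bd i
    | .cr _ 0 => .bd 0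
    | .cr _ 1 => .bd 1
    | .cr _ 2 => .leg 1
    | .cr _ 3 => .leg 0
  link_link := by
    rintro (i | ⟨⟨⟩, i⟩ | ⟨⟨⟩, _⟩ | i)
    · by_cases h0 : i = 0
      · subst h0; rfl
      · by_cases h1 : i = 1
        · subst h1; rfl
        · simp [h0, h1]
    · fin_cases i <;> simp
    · by_cases h0 : i = 0
      · subst h0; rfl
      · by_cases h1 : i = 1
        · subst h1; rfl
        · simp [h0, h1]
  tail_link := by
    rintro (i | ⟨⟨⟩, i⟩ | ⟨⟨⟩, _⟩ | i)
    · by_cases h0 : i = 0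
      · subst h0; simp
      · by_cases h1 : i = 1
        · subst h1; simp
        · simp [h0, h1, Equiv.swap_apply_of_ne_of_ne]
    · fin_cases i <;> simp
    · by_cases h0 : i = 0
      · subst h0; simp
      · by_cases h1 : i = 1
        · subst h1; simp
        · simp [h0, h1, Equiv.swap_apply_of_ne_of_ne]

theorem sameCycle_permCongr {α β : Type} (e : α ≃ β) (p : Equiv.Perm α) (hp : ∀ i j, p.SameCycle i j)
    (x y : β) : (e.permCongr p).SameCycle x y := by
  obtain ⟨n, hn⟩ := hp (e.symm x) (e.symm y)
  refine ⟨n, ?_⟩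
  have h : (e.permCongr p) ^ n = e.permCongr (p ^ n) := (map_zpow e.permCongrHom p n).symm
  rw [h, Equiv.permCongr_apply, hn, Equiv.apply_symm_apply]

/-- A strand that passes `a` crossings is cut into `a + 1` segments; this is the right end of the segment
`s`, where `z` is the right end of the strand and the dart `2` at a crossing points to the left. -/
def rightEnd {B J L : Type} {a : ℕ} (z : B) : Fin (a + 1) → Dart B (Fin a) J L :=
  Fin.cases (.bd z) fun i => .cr i 2

/-- The left end of the segment `s`, where `w` is the left end of the strand and the dart `0` at
a crossing points to the right. -/
def leftEnd {B J L : Type} {a : ℕ} (w : B) : Fin (a + 1) → Dart B (Fin a) J L :=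
  Fin.lastCases (.bd w) fun i => .cr i 0

/-- The segments in the picture of a strand above a vertex. -/
def pastLink {J : Type} {a b : ℕ} : Dart ((Fin a ⊕ Fin b) ⊕ Bool) (Fin a) J (Fin a ⊕ Fin b) →
    Dart ((Fin a ⊕ Fin b) ⊕ Bool) (Fin a) J (Fin a ⊕ Fin b)
  | .bd (.inl (.inl i)) => .cr i 1
  | .bd (.inl (.inr j)) => .leg (.inr j)
  | .bd (.inr false) => leftEnd (.inr true) 0
  | .bd (.inr true) => rightEnd (.inr false) (Fin.last a)
  | .cr i 0 => rightEnd (.inr false) i.castSucc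
  | .cr i 1 => .bd (.inl (.inl i))
  | .cr i 2 => leftEnd (.inr true) i.succ
  | .cr i 3 => .leg (.inl i)
  | .jt j e => .jt j e
  | .leg (.inl i) => .cr i 3
  | .leg (.inr j) => .bd (.inl (.inr j))

/-- The orientations in the picture of a strand above a vertex. -/
def pastTail {a b : ℕ} (t : Fin a ⊕ Fin b → Bool) (f : Bool) :
    Dart ((Fin a ⊕ Fin b) ⊕ Bool) (Fin a) Empty (Fin a ⊕ Fin b) → Bool
  | .bd (.inl l) => !t l
  | .bd (.inr e) => f ^^ e
  | .cr i k => ![!f, t (.inl i), f, !t (.inl i)] k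
  | .leg l => t l

theorem pastTail_rightEnd {a b : ℕ} (t : Fin a ⊕ Fin b → Bool) (f : Bool) (s : Fin (a + 1)) :
    pastTail t f (rightEnd (.inr false) s) = f := by
  refine Fin.cases ?_ (fun i => ?_) s <;> simp [rightEnd, pastTail]

theorem pastTail_leftEnd {a b : ℕ} (t : Fin a ⊕ Fin b → Bool) (f : Bool) (s : Fin (a + 1)) :
    pastTail t f (leftEnd (.inr true) s) = !f := by
  refine Fin.lastCases ?_ (fun i => ?_) s <;> simp [leftEnd, pastTail]

theorem pastLink_rightEnd {J : Type} {a b : ℕ} (s : Fin (a + 1)) :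
    pastLink (J := J) (b := b) (rightEnd (.inr false) s) = leftEnd (.inr true) s := by
  refine Fin.cases ?_ (fun i => ?_) s <;> rfl

theorem pastLink_leftEnd {J : Type} {a b : ℕ} (s : Fin (a + 1)) :
    pastLink (J := J) (b := b) (leftEnd (.inr true) s) = rightEnd (.inr false) s := by
  refine Fin.lastCases ?_ (fun i => ?_) s <;> simp [leftEnd, pastLink]

/-- A strand that passes a vertex with `a + b` legs.  In counterclockwise order the boundary points are
the right end `inr false` of the strand, the points of the `a` upper legs, the left end `inr true` of
the strand, and the points of the `b` lower legs.  The strand passes above the vertex, and crosses there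
the `a` upper legs.  Its crossing with the upper leg `i` has the darts `0` (to the right, along the
strand), `1` (to the boundary), `2` (to the left, along the strand), `3` (to the vertex).  The strand runs
from right to left if `f = true`, and is the over-arc at all crossings if `o = true`, the under-arc at all
crossings if `o = false`.  The leg `l` points away from the vertex if `t l = true`. -/
def strandPastVertex (a b : ℕ) (t : Fin a ⊕ Fin b → Bool) (f o : Bool) :
    Diagram ((Fin a ⊕ Fin b) ⊕ Bool) where
  Crossing := Fin a
  Joint := Empty
  Vertex := Unit
  Leg := Fin a ⊕ Fin b
  finite_crossing := inferInstance
  finite_joint := inferInstance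
  finite_vertex := inferInstance
  finite_leg := inferInstance
  vtx _ := ()
  next := finSumFinEquiv.symm.permCongr (finRotate (a + b))
  vtx_eq_iff l l' := by
    simp only [true_iff]
    exact sameCycle_permCongr _ _ (sameCycle_finRotate _) l l'
  isOver _ i := ![o, !o, o, !o] i
  isOver_succ _ i := by fin_cases i <;> simp
  tail := pastTail t f
  tail_cr _ i := by fin_cases i <;> simp [pastTail]
  tail_jt j := j.elim
  link := pastLink
  link_link := by
    rintro (((i | j) | (_ | _)) | ⟨i, k⟩ | ⟨⟨⟩, _⟩ | (i | j))
    · rfl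
    · rfl
    · exact pastLink_leftEnd 0
    · exact (pastLink_rightEnd (Fin.last a)).trans (by simp [leftEnd])
    · fin_cases k
      · exact (pastLink_rightEnd i.castSucc).trans (by simp [leftEnd])
      · rfl
      · exact pastLink_leftEnd i.succ
      · rfl
    · rfl
    · rfl
  tail_link := by
    rintro (((i | j) | (_ | _)) | ⟨i, k⟩ | ⟨⟨⟩, _⟩ | (i | j))
    · simp [pastLink, pastTail]
    · simp [pastLink, pastTail]
    · exact (pastTail_leftEnd t f 0).trans (by simp [pastTail])
    · exact (pastTail_rightEnd t f (Fin.last a)).trans (by simp [pastTail])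
    · fin_cases k
      · exact (pastTail_rightEnd t f i.castSucc).trans (by simp [pastTail])
      · simp [pastLink, pastTail]
      · exact (pastTail_leftEnd t f i.succ).trans (by simp [pastTail])
      · simp [pastLink, pastTail]
    · simp [pastLink, pastTail]
    · simp [pastLink, pastTail]

/-- Rename the boundary point of a dart. -/
def renameBd {B B' C J L : Type} (e : B → B') : Dart B C J L → Dart B' C J L
  | .bd b => .bd (e b)
  | .cr c i => .cr c i
  | .jt j i => .jt j i
  | .leg l => .leg l

/-- The same diagram with renamed boundary points. -/
def rename {B B' : Type} (e : B ≃ B') (D : Diagram B) : Diagram B' where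
  Crossing := D.Crossing
  Joint := D.Joint
  Vertex := D.Vertex
  Leg := D.Leg
  finite_crossing := D.finite_crossing
  finite_joint := D.finite_joint
  finite_vertex := D.finite_vertex
  finite_leg := D.finite_leg
  vtx := D.vtx
  next := D.next
  vtx_eq_iff := D.vtx_eq_iff
  isOver := D.isOver
  isOver_succ := D.isOver_succ
  tail d := D.tail (renameBd e.symm d)
  tail_cr c i := D.tail_cr c i
  tail_jt j := D.tail_jt j
  link d := renameBd e (D.link (renameBd e.symm d))
  link_link d := by
    have h1 : ∀ x : D.Darts, renameBd e.symm (renameBd e x) = x := by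
      rintro (_ | _ | _ | _) <;> simp [renameBd]
    have h2 : ∀ x : Dart B' D.Crossing D.Joint D.Leg, renameBd e (renameBd e.symm x) = x := by
      rintro (_ | _ | _ | _) <;> simp [renameBd]
    rw [h1, D.link_link, h2]
  tail_link d := by
    have h1 : ∀ x : D.Darts, renameBd e.symm (renameBd e x) = x := by
      rintro (_ | _ | _ | _) <;> simp [renameBd]
    rw [h1, D.tail_link]

/-! ### The moves -/

/-- The graphical Reidemeister moves, as pairs of pictures in a disc with the same boundary points:
`r1` adds a curl, `r2` pushes a strand over another one, `r3` pushes a strand past a crossing of two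
others, `r4` twists two neighbouring edges at a vertex, `r5` moves a strand over or under a vertex.
All orientations, all over/under choices and all vertex degrees are allowed.  For `r5`, the second
picture has the strand below the vertex; it is drawn as the half-turn of a picture with the strand above
the vertex. -/
inductive LocalMove : ∀ {K : Type}, Diagram K → Diagram K → Prop
  | r1 (f left o : Bool) : LocalMove (strand f) (curl f left o)
  | r2 (f g o : Bool) : LocalMove (parallel f g) (bigon f g o)
  | r3 (f : Fin 3 → Bool) (h : Equiv.Perm (Fin 3)) :
      LocalMove (triangle f h false) (triangle f h true)
  | r4 {n : ℕ} (t : Fin (n + 2) → Bool) (o : Bool) : LocalMove (star t) (twistedStar t o)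
  | r5 (a b : ℕ) (t : Fin a ⊕ Fin b → Bool) (f o : Bool) :
      LocalMove (strandPastVertex a b t f o)
        ((strandPastVertex b a (fun l => t l.swap) (!f) o).rename
          (Equiv.sumCongr (Equiv.sumComm (Fin b) (Fin a)) Equiv.boolNot))

/-- One step between diagrams: renaming the nodes, cutting a segment into two by a joint, or replacing
the picture in a disc according to one of the moves `r1`, …, `r5`. -/
inductive Step {B : Type} : Diagram B → Diagram B → Prop
  | iso {D D' : Diagram B} (e : Iso D D') : Step D D'
  | subdivide (D : Diagram B) (d : D.Darts) : Step D (D.subdivide d)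
  | replace {K : Type} [Finite K] (O : Diagram (B ⊕ K)) {I I' : Diagram K} (hI : LocalMove I I')
      (h : ∀ k, O.tail (.bd (.inr k)) = !I.tail (.bd k))
      (h' : ∀ k, O.tail (.bd (.inr k)) = !I'.tail (.bd k)) : Step (O.glue I h) (O.glue I' h')

end Diagram

/-- Two diagrams in the box are related by a finite sequence of graphical Reidemeister moves R1–R5 and
planar isotopies, with fixed boundary points. -/
def ReidemeisterEquivalent {m : ℕ} : GraphTangleDiagram m → GraphTangleDiagram m → Prop :=
  Relation.EqvGen fun D D' => Diagram.Step D.toDiagram D'.toDiagram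

/-! ### Quandle colorings

Mathlib's quandles act from the left: the product `a * b` of the right-distributive convention is
`b ◃ a`, and its inverse operation is `b ◃⁻¹ a`. -/

/-- `φ(x, y) φ(x * y, z) = φ(x, z) φ(x * z, y * z)` and `φ(x, x) = 1`. -/
def IsQuandleTwoCocycle {X H : Type*} [Quandle X] [Group H] (φ : X → X → H) : Prop :=
  (∀ x y z, φ x y * φ (y ◃ x) z = φ x z * φ (z ◃ x) (z ◃ y)) ∧ ∀ x, φ x x = 1

namespace Diagram

section Coloring

variable {B : Type} {X : Type*} [Quandle X]

/-- The operator of the strand at a leg `l` in the vertex relation: `x ↦ x * a` if the strand points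
to the vertex, and its inverse otherwise, where `a` is the color of the strand. -/
def legAct (D : Diagram B) (col : D.Darts → X) (x : X) (l : D.Leg) : X :=
  if D.tail (.leg l) then col (.leg l) ◃⁻¹ x else col (.leg l) ◃ x

/-- The legs at the vertex of `l` in clockwise order, starting with `l`. -/
noncomputable def clockwiseLegs (D : Diagram B) (l : D.Leg) : List D.Leg :=
  (List.range (Function.minimalPeriod D.next l)).map fun k => (D.next⁻¹ ^ k) l

/-- Quandle colorings: assignments of colors to the arcs (that is, to the darts, such that the color is
constant along segments, through joints, and along over-arcs) that satisfy the crossing relations and the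
vertex relations `x ^ (a₁ ^ ε₁ ⋯ aₖ ^ εₖ) = x`, for all vertices and all arc colors `x`.  As the
darts are numbered counterclockwise, the normal of the over-arc which leaves the crossing at the dart `i`
points from the under-arc at `i + 3` to the under-arc at `i + 1`. -/
structure IsColoring (D : Diagram B) (col : D.Darts → X) : Prop where
  segment : ∀ d, col (D.link d) = col d
  joint : ∀ j, col (.jt j true) = col (.jt j false)
  overArc : ∀ c i, D.isOver c i = true → col (.cr c (i + 2)) = col (.cr c i)
  crossing : ∀ c i, D.isOver c i = true → D.tail (.cr c i) = true →
    col (.cr c (i + 1)) = col (.cr c i) ◃ col (.cr c (i + 3))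
  vertex : ∀ l d, (D.clockwiseLegs l).foldl (D.legAct col) (col d) = col d

/-- All arcs incident to the same vertex have the same color. -/
def VertexConstant (D : Diagram B) (col : D.Darts → X) : Prop :=
  ∀ l l', D.vtx l = D.vtx l' → col (.leg l) = col (.leg l')

/-- Vertex-constant quandle colorings. -/
def VColoring (D : Diagram B) (X : Type*) [Quandle X] : Type _ :=
  {col : D.Darts → X // D.IsColoring col ∧ D.VertexConstant col}

end Coloring

/-! ### Extended walks -/

section Walks

variable {B : Type}

/-- Arriving at a node along the dart `a`, a walk may leave it along the dart `d`: it goes straight on at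
crossings and joints, and leaves a vertex along any leg. -/
inductive Passes (D : Diagram B) : D.Darts → D.Darts → Prop
  | crossing (c : D.Crossing) (i : Fin 4) : Passes D (.cr c i) (.cr c (i + 2))
  | joint (j : D.Joint) (i : Bool) : Passes D (.jt j i) (.jt j (!i))
  | vertex (l l' : D.Leg) (h : D.vtx l = D.vtx l') : Passes D (.leg l) (.leg l')

/-- Walks that start along the dart `d` (leaving its node) and end at the boundary point `b`. -/
inductive Walk (D : Diagram B) (b : B) : D.Darts → Type
  | finish (d : D.Darts) (h : D.link d = .bd b) : Walk D b d
  | go (d d' : D.Darts) (h : D.Passes (D.link d) d') (w : Walk D b d') : Walk D b d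

/-- Extended walks from the boundary point `b` to the boundary point `b'`. -/
abbrev ExtendedWalk (D : Diagram B) (b b' : B) : Type := D.Walk b' (.bd b)

/-- `1` for a leg at a vertex, and `0` for all other darts. -/
def legCount {C J L : Type} : Dart B C J L → ℕ
  | .leg _ => 1
  | _ => 0

/-- The number of times that a walk visits vertices. -/
def Walk.visits {D : Diagram B} {b : B} {d : D.Darts} : D.Walk b d → ℕ
  | .finish _ _ => 0
  | .go d _ _ w => legCount (D.link d) + w.visits

/-- The length of an extended walk: the number of whole edges in it, that is, of its parts between
consecutive visits of vertices. -/
def Walk.length {D : Diagram B} {b : B} {d : D.Darts} (w : D.Walk b d) : ℕ := w.visits - 1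

end Walks

/-! ### Boltzmann weights and the invariants -/

section Invariant

variable {B : Type} {X H : Type*} [Group H]

/-- The dart at which the over-arc leaves a crossing. -/
def overOut (D : Diagram B) (c : D.Crossing) : Fin 4 :=
  if D.isOver c 0 then (if D.tail (.cr c 0) then 0 else 2)
  else (if D.tail (.cr c 1) then 1 else 3)

/-- The sign of a crossing: `+1` if the under-arc crosses the over-arc in the direction of the normal of
the over-arc (from the right to the left), and `-1` otherwise. -/
def sign (D : Diagram B) (c : D.Crossing) : ℤ :=
  if D.tail (.cr c (D.overOut c + 3)) then -1 else 1

/-- The Boltzmann weight `φ(x, y) ^ ε` of a crossing, where `y` is the color of the over-arc, `x` is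
the color of the under-arc from which the normal of the over-arc points, and `ε` is the sign. -/
def boltzmann (D : Diagram B) (φ : X → X → H) (col : D.Darts → X) (c : D.Crossing) : H :=
  φ (col (.cr c (D.overOut c + 3))) (col (.cr c (D.overOut c))) ^ D.sign c

/-- The factor contributed by a walk that arrives along the dart `a`.  It is trivial unless the walk
arrives along the under-arc of a crossing.  Then it is the Boltzmann weight of the crossing, where the
followed under-arc is directed as the walk: reversing the under-arc changes the sign of the crossing, and
therefore the weight is inverted if the walk runs against the original orientation of the under-arc. -/
def arrivalWeight (D : Diagram B) (φ : X → X → H) (col : D.Darts → X) : D.Darts → H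
  | .cr c i => if D.isOver c i then 1
      else if D.tail (.cr c i) then (D.boltzmann φ col c)⁻¹ else D.boltzmann φ col c
  | _ => 1

/-- The product of the weights along a walk, in the order in which they are met. -/
def Walk.weight {D : Diagram B} {b : B} (φ : X → X → H) (col : D.Darts → X) {d : D.Darts} :
    D.Walk b d → H
  | .finish _ _ => 1
  | .go d _ _ w => D.arrivalWeight φ col (D.link d) * w.weight φ col

variable [Quandle X]

/-- The multiset `Ψ_q`, as its multiplicity function: `psi φ b b' n q h` is the number of pairs of an
extended walk from `b` to `b'` of length at most `n` and a vertex-constant coloring with color `q` at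
`b`, whose product of weights is `h`. -/
noncomputable def psi (D : Diagram B) (φ : X → X → H) (b b' : B) (n : ℕ) (q : X) : H → ℕ∞ := fun h =>
  ENat.card {p : D.ExtendedWalk b b' × D.VColoring X //
    p.1.length ≤ n ∧ p.2.1 (.bd b) = q ∧ p.1.weight φ p.2.1 = h}

/-- The multiset `Ψ` of the multisets `Ψ_q`, for all elements `q` of the finite quandle. -/
noncomputable def psiTotal [Fintype X] (D : Diagram B) (φ : X → X → H) (b b' : B) (n : ℕ) :
    Multiset (H → ℕ∞) :=
  (Finset.univ : Finset X).val.map (D.psi φ b b' n)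

end Invariant

end Diagram

end GraphTangle

namespace GraphTangle

/-! ### Signed translations and subquandles -/

section QuandleAction

variable {X : Type*} [Quandle X]

/-- Passing under a strand of color `y`, along its normal if `e = true`, and against it otherwise. -/
def signedAct (e : Bool) (y x : X) : X := if e then y ◃ x else y ◃⁻¹ x

@[simp] theorem signedAct_true (y x : X) : signedAct true y x = y ◃ x := rfl

@[simp] theorem signedAct_false (y x : X) : signedAct false y x = y ◃⁻¹ x := rfl

@[simp] theorem signedAct_not_signedAct (e : Bool) (y x : X) :
    signedAct (!e) y (signedAct e y x) = x := by
  cases e <;> simp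

@[simp] theorem signedAct_signedAct_not (e : Bool) (y x : X) :
    signedAct e y (signedAct (!e) y x) = x := by
  cases e <;> simp

@[simp] theorem signedAct_self (e : Bool) (y : X) : signedAct e y y = y := by
  cases e <;> simp

/-- Translations are automorphisms, and so are their inverses. The mixed-sign cases come from
self-distributivity by cancelling one translation. -/
theorem signedAct_distrib (e e' : Bool) (z y x : X) :
    signedAct e z (signedAct e' y x) = signedAct e' (signedAct e z y) (signedAct e z x) := by
  have key : ∀ a b c : X, a ◃ (b ◃⁻¹ c) = (a ◃ b) ◃⁻¹ (a ◃ c) := fun a b c => by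
    rw [← Rack.left_cancel (a ◃ b), ← Shelf.self_distrib]; simp
  have key₂ : ∀ a b c : X, a ◃⁻¹ (b ◃ c) = (a ◃⁻¹ b) ◃ (a ◃⁻¹ c) := fun a b c => by
    rw [← Rack.left_cancel a, Shelf.self_distrib]; simp
  cases e <;> cases e'
  · exact Rack.self_distrib_inv
  · exact key₂ _ _ _
  · exact key _ _ _
  · exact Shelf.self_distrib

/-- The exponent of a strand of sign `e`. -/
def signExp (e : Bool) : ℤ := if e then 1 else -1

@[simp] theorem signExp_not (e : Bool) : signExp (!e) = -signExp e := by cases e <;> rfl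

theorem signedAct_eq_zpow (e : Bool) (y x : X) :
    signedAct e y x = (Rack.act' y ^ signExp e) x := by
  cases e <;> simp [signExp]

/-- Subsets that are closed under the quandle operation and its inverse. -/
def IsSubquandle (C : Set X) : Prop := ∀ e, ∀ y ∈ C, ∀ x ∈ C, signedAct e y x ∈ C

theorem IsSubquandle.zpow_mem {C : Set X} (hC : IsSubquandle C) {y x : X} (hy : y ∈ C) (hx : x ∈ C)
    (n : ℤ) : (Rack.act' y ^ n) x ∈ C := by
  induction n using Int.induction_on with
  | zero => simpa
  | succ n ih =>
    rw [add_comm, zpow_add, zpow_one]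
    exact hC true y hy _ ih
  | pred n ih =>
    rw [sub_eq_add_neg, add_comm, zpow_add, zpow_neg_one]
    exact hC false y hy _ ih

/-- Powers of automorphisms are automorphisms. This is what makes fixed sets of vertex operators
closed under the quandle operations. -/
theorem zpow_act'_signedAct (e : Bool) (z y x : X) (n : ℤ) :
    (Rack.act' z ^ n) (signedAct e y x) =
      signedAct e ((Rack.act' z ^ n) y) ((Rack.act' z ^ n) x) := by
  induction n using Int.induction_on with
  | zero => simp
  | succ n ih =>
    rw [add_comm, zpow_add, zpow_one]
    simp only [Equiv.Perm.mul_apply, ih]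
    exact signedAct_distrib true e z _ _
  | pred n ih =>
    rw [sub_eq_add_neg, add_comm, zpow_add, zpow_neg_one]
    simp only [Equiv.Perm.mul_apply, ih]
    exact signedAct_distrib false e z _ _

/-- The elements fixed by a power of a translation form a subquandle. -/
theorem isSubquandle_fixed {ι : Sort*} (a : ι → X) (n : ι → ℤ) :
    IsSubquandle {x : X | ∀ i, (Rack.act' (a i) ^ n i) x = x} := by
  intro e y hy x hx i
  rw [zpow_act'_signedAct, hy i, hx i]

/-- If the `n`-th power of the translation by `y` fixes a subquandle containing `y` and `z` pointwise,
then so does that of the translation by the image of `y` under the translation by `z`. -/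
theorem zpow_act'_signedAct_fixed {C : Set X} (hC : IsSubquandle C) {y z : X} (hz : z ∈ C) (e : Bool)
    (n : ℤ) (h : ∀ x ∈ C, (Rack.act' y ^ n) x = x) :
    ∀ x ∈ C, (Rack.act' (signedAct e z y) ^ n) x = x := by
  intro x hx
  -- An automorphism conjugates the translation by `y` into the translation by the image of `y`.
  have h1 : Rack.act' (signedAct e z y) =
      Rack.act' z ^ signExp e * Rack.act' y * (Rack.act' z ^ signExp e)⁻¹ := by
    ext w
    have h2 : (Rack.act' z ^ signExp e)⁻¹ w = signedAct (!e) z w := by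
      rw [signedAct_eq_zpow, signExp_not, zpow_neg]
    rw [Equiv.Perm.mul_apply, Equiv.Perm.mul_apply, h2, ← signedAct_eq_zpow]
    have := signedAct_distrib e true z y (signedAct (!e) z w)
    simp only [signedAct_signedAct_not, signedAct_true] at this
    exact this.symm
  -- Since `z ∈ C`, the conjugating translation keeps `x` in `C`, where the power for `y` acts
  -- trivially.
  rw [h1, conj_zpow, Equiv.Perm.mul_apply, Equiv.Perm.mul_apply, ← zpow_neg, h _ (hC.zpow_mem hz hx _),
    ← Equiv.Perm.mul_apply, ← zpow_add]
  simp

end QuandleAction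

/-! ### Signed weights and the signed cocycle condition -/

section Weight

variable {X H : Type*} [Quandle X] [Group H]

/-- The factor collected by a strand of color `x` when it passes under a strand of color `y`, along the
normal of the latter if `e = true`, and against it otherwise. -/
def signedWeight (φ : X → X → H) (e : Bool) (y x : X) : H :=
  if e then φ x y else (φ (y ◃⁻¹ x) y)⁻¹

/-- Passing back under the same strand undoes the color change and inverts the factor. -/
theorem signedWeight_not (φ : X → X → H) (e : Bool) (y x : X) :
    signedWeight φ (!e) y (signedAct e y x) = (signedWeight φ e y x)⁻¹ := by
  cases e <;> simp [signedWeight]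

theorem IsQuandleTwoCocycle.signedWeight_self {φ : X → X → H} (hφ : IsQuandleTwoCocycle φ) (e : Bool)
    (x : X) : signedWeight φ e x x = 1 := by
  cases e <;> simp [signedWeight, hφ.2]

/-- The cocycle condition for arbitrary orientations: a bottom strand of color `x` collects the same
product whether it meets the two strands above it before or after these have crossed. Negative signs
reduce to positive ones by starting from the color on the other side of the strand. -/
theorem IsQuandleTwoCocycle.signedWeight_mul {φ : X → X → H} (hφ : IsQuandleTwoCocycle φ)
    (e e' : Bool) (z y x : X) :
    signedWeight φ e' y x * signedWeight φ e z (signedAct e' y x) =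
      signedWeight φ e z x * signedWeight φ e' (signedAct e z y) (signedAct e z x) := by
  have plus : ∀ e' y x, signedWeight φ e' y x * signedWeight φ true z (signedAct e' y x) =
      signedWeight φ true z x * signedWeight φ e' (signedAct true z y) (signedAct true z x) := by
    intro e' y x
    cases e'
    -- With `x` written as an image under `y`, the inverse operation disappears and the cocycle
    -- condition applies at the preimage.
    · obtain ⟨x, rfl⟩ : ∃ x', x = y ◃ x' := ⟨y ◃⁻¹ x, by simp⟩
      have := hφ.1 x y z
      have h2 : (z ◃ y) ◃⁻¹ (z ◃ (y ◃ x)) = z ◃ x := by rw [Shelf.self_distrib]; simp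
      simp only [signedWeight, signedAct_false, signedAct_true, Rack.invAct_act_eq, h2, if_true,
        Bool.false_eq_true, if_false]
      rw [inv_mul_eq_iff_eq_mul, ← mul_assoc, this]; group
    · exact hφ.1 x y z
  cases e
  -- Pulling both `x` and `y` back through `z` turns the negative case into the positive one, with
  -- the factors of `z` inverted and on the other sides.
  · obtain ⟨x, rfl⟩ : ∃ x', x = z ◃ x' := ⟨z ◃⁻¹ x, by simp⟩
    obtain ⟨y, rfl⟩ : ∃ y', y = z ◃ y' := ⟨z ◃⁻¹ y, by simp⟩
    have := plus e' y x
    have h2 := signedAct_distrib true e' z y x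
    simp only [signedAct_true] at this h2
    have h3 : signedWeight φ false z (z ◃ x) = (signedWeight φ true z x)⁻¹ :=
      signedWeight_not φ true z x
    have h4 : signedWeight φ false z (z ◃ signedAct e' y x) =
        (signedWeight φ true z (signedAct e' y x))⁻¹ := signedWeight_not φ true z _
    rw [← h2, h3, h4]
    simp only [signedAct_false, Rack.invAct_act_eq]
    rw [eq_inv_mul_iff_mul_eq, ← mul_assoc, ← this]; group
  · exact plus e' y x

/-- The invariance hypothesis says that `φ · y` is constant on the orbits of the translation by `y`.
A strand that runs under several strands of the one color `y` therefore only collects powers of a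
single element. -/
theorem signedWeight_zpow {φ : X → X → H} (hφ : ∀ y z : X, φ (z ◃ y) z = φ y z)
    (e : Bool) (y x : X) (n : ℤ) :
    signedWeight φ e y ((Rack.act' y ^ n) x) = φ x y ^ signExp e := by
  have h : ∀ x, φ (y ◃⁻¹ x) y = φ x y := fun x => by rw [← hφ (y ◃⁻¹ x) y]; simp
  have h0 : ∀ x, signedWeight φ e y x = φ x y ^ signExp e := by
    intro x; cases e <;> simp [signedWeight, h, signExp]
  rw [h0]
  congr 1
  induction n using Int.induction_on with
  | zero => simp
  | succ n ih => rw [add_comm, zpow_add, zpow_one, Equiv.Perm.mul_apply, Rack.act'_apply, hφ, ih]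
  | pred n ih =>
    rw [sub_eq_add_neg, add_comm, zpow_add, zpow_neg_one, Equiv.Perm.mul_apply, Rack.invAct_apply,
      h, ih]

end Weight

/-! ### Colors and weights in terms of the direction of travel -/

namespace Diagram

variable {B : Type} {X H : Type*} [Group H]

theorem arrivalWeight_over (D : Diagram B) (φ : X → X → H) (col : D.Darts → X) (c : D.Crossing)
    (i : Fin 4) (hi : D.isOver c i = true) : D.arrivalWeight φ col (.cr c i) = 1 := by
  simp [arrivalWeight, hi]

variable [Quandle X]

/-- The number of incoming minus the number of outgoing edge ends at a vertex. -/
noncomputable def excess (D : Diagram B) (v : D.Vertex) : ℤ := (D.inDegree v : ℤ) - D.outDegree v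

open Classical in
theorem excess_eq_sum (D : Diagram B) [Fintype D.Leg] (v : D.Vertex) :
    D.excess v = ∑ l, if D.vtx l = v then -signExp (D.tail (.leg l)) else 0 := by
  have h : ∀ t, Nat.card {l : D.Leg // D.vtx l = v ∧ D.tail (.leg l) = t} =
      ∑ l, if D.vtx l = v ∧ D.tail (.leg l) = t then 1 else 0 := by
    intro t
    rw [Nat.card_eq_fintype_card, Fintype.card_subtype, Finset.card_filter]
  rw [excess, inDegree, outDegree, h, h]
  push_cast
  rw [← Finset.sum_sub_distrib]
  refine Finset.sum_congr rfl fun l _ => ?_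
  by_cases hv : D.vtx l = v <;> cases ht : D.tail (.leg l) <;> simp [hv, signExp]

/-- Colorings that satisfy all conditions but the vertex relations. -/
structure LocalColoring (D : Diagram B) (col : D.Darts → X) : Prop where
  segment : ∀ d, col (D.link d) = col d
  joint : ∀ j i, col (.jt j (!i)) = col (.jt j i)
  overArc : ∀ c i, D.isOver c i = true → col (.cr c (i + 2)) = col (.cr c i)
  underArc : ∀ c i, D.isOver c i = false → col (.cr c (i + 2)) =
    signedAct (D.tail (.cr c (i + 1))) (col (.cr c (i + 1))) (col (.cr c i))
  vertexConstant : D.VertexConstant col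

/-- All colors lie in `C`, and the vertex relations hold for all elements of `C`. -/
structure FixesColors (D : Diagram B) (C : Set X) (col : D.Darts → X) : Prop where
  mem : ∀ d, col d ∈ C
  fix : ∀ l, ∀ x ∈ C, (Rack.act' (col (.leg l)) ^ D.excess (D.vtx l)) x = x

theorem isOver_add_two (D : Diagram B) (c : D.Crossing) (i : Fin 4) :
    D.isOver c (i + 2) = D.isOver c i := by
  have : i + 2 = i + 1 + 1 := by rw [add_assoc]; rfl
  rw [this, D.isOver_succ, D.isOver_succ, Bool.not_not]

/-- It suffices to check the conditions at the crossings for two neighbouring darts. -/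
theorem LocalColoring.mk_of_zero {D : Diagram B} {col : D.Darts → X}
    (segment : ∀ d, col (D.link d) = col d)
    (joint : ∀ j, col (.jt j true) = col (.jt j false))
    (overArc : ∀ c, D.isOver c 0 = true → col (.cr c 2) = col (.cr c 0) ∧
      col (.cr c 3) = signedAct (D.tail (.cr c 2)) (col (.cr c 2)) (col (.cr c 1)))
    (underArc : ∀ c, D.isOver c 0 = false → col (.cr c 3) = col (.cr c 1) ∧
      col (.cr c 2) = signedAct (D.tail (.cr c 1)) (col (.cr c 1)) (col (.cr c 0)))
    (vertexConstant : D.VertexConstant col) : D.LocalColoring col := by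
  refine ⟨segment, fun j i => by cases i <;> simp [joint], fun c i hi => ?_, fun c i hi => ?_,
    vertexConstant⟩
  · have h0 := D.isOver_succ c 0
    have h2 := D.isOver_add_two c 0
    have h3 := D.isOver_add_two c 1
    fin_cases i
    · exact (overArc c hi).1
    · refine (underArc c ?_).1
      have : D.isOver c 1 = true := hi
      simpa [this] using h0
    · exact (overArc c (h2.symm.trans hi)).1.symm
    · refine (underArc c ?_).1.symm
      have : D.isOver c 1 = true := h3.symm.trans hi
      simpa [this] using h0
  · have h0 := D.isOver_succ c 0
    have h2 := D.isOver_add_two c 0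
    have h3 := D.isOver_add_two c 1
    have t0 : D.tail (.cr c 2) = !D.tail (.cr c 0) := D.tail_cr c 0
    have t1 : D.tail (.cr c 3) = !D.tail (.cr c 1) := D.tail_cr c 1
    fin_cases i
    · exact (underArc c hi).2
    · refine (overArc c ?_).2
      have : D.isOver c 1 = false := hi
      simpa [this] using h0
    -- Seen from the opposite dart the over-strand has the other orientation, so that the relation
    -- is the inverse of the given one.
    · obtain ⟨h, h'⟩ := underArc c (h2.symm.trans hi)
      show col (.cr c 0) = signedAct (D.tail (.cr c 3)) (col (.cr c 3)) (col (.cr c 2))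
      rw [h', h, t1, signedAct_not_signedAct]
    · obtain ⟨h, h'⟩ := overArc c (by
        have : D.isOver c 1 = false := h3.symm.trans hi
        simpa [this] using h0)
      show col (.cr c 1) = signedAct (D.tail (.cr c 0)) (col (.cr c 0)) (col (.cr c 3))
      rw [h', h, t0, signedAct_signedAct_not]

theorem fin4_cases {p : Fin 4 → Prop} (i : Fin 4) (h0 : p i) (h1 : p (i + 1)) (h2 : p (i + 2))
    (h3 : p (i + 3)) (j : Fin 4) : p j := by
  have : ∀ i j : Fin 4, j = i ∨ j = i + 1 ∨ j = i + 2 ∨ j = i + 3 := by decide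
  rcases this i j with rfl | rfl | rfl | rfl <;> assumption

/-- At a crossing, two neighbouring colors determine the other two. -/
theorem LocalColoring.eq_at_crossing {D : Diagram B} {col col' : D.Darts → X}
    (h : D.LocalColoring col) (h' : D.LocalColoring col') (c : D.Crossing) (i : Fin 4)
    (h0 : col (.cr c i) = col' (.cr c i)) (h1 : col (.cr c (i + 1)) = col' (.cr c (i + 1)))
    (j : Fin 4) : col (.cr c j) = col' (.cr c j) := by
  have e3 : i + 3 = i + 1 + 2 := by rw [add_assoc]; rfl
  have e2 : i + 2 = i + 1 + 1 := by rw [add_assoc]; rfl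
  have hs := D.isOver_succ c i
  cases ho : D.isOver c i
  · rw [ho] at hs
    have h2 : col (.cr c (i + 2)) = col' (.cr c (i + 2)) := by
      rw [h.underArc c i ho, h'.underArc c i ho, h0, h1]
    exact fin4_cases (p := fun j => col (.cr c j) = col' (.cr c j)) i h0 h1 h2
      (by rw [e3, h.overArc c _ hs, h'.overArc c _ hs, h1]) j
  · rw [ho] at hs
    have h2 : col (.cr c (i + 2)) = col' (.cr c (i + 2)) := by
      rw [h.overArc c i ho, h'.overArc c i ho, h0]
    refine fin4_cases (p := fun j => col (.cr c j) = col' (.cr c j)) i h0 h1 h2 ?_ j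
    rw [e3, h.underArc c _ hs, h'.underArc c _ hs, ← e2, h1, h2]

/-- The definition refers to the absolute numbering of the darts; relative to an under-dart `i` the
same choice no longer depends on where the numbering starts. -/
theorem overOut_eq (D : Diagram B) (c : D.Crossing) (i : Fin 4) (hi : D.isOver c i = false) :
    D.overOut c = if D.tail (.cr c (i + 1)) then i + 1 else i + 3 := by
  have h0 : D.isOver c 1 = !D.isOver c 0 := D.isOver_succ c 0
  have h2 : D.isOver c 2 = D.isOver c 0 := D.isOver_add_two c 0
  have h3 : D.isOver c 3 = D.isOver c 1 := D.isOver_add_two c 1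
  have t0 : D.tail (.cr c 2) = !D.tail (.cr c 0) := D.tail_cr c 0
  have t1 : D.tail (.cr c 3) = !D.tail (.cr c 1) := D.tail_cr c 1
  fin_cases i
  · have hi : D.isOver c 0 = false := hi
    simp [overOut, hi]
  · have hi : D.isOver c 1 = false := hi
    have : D.isOver c 0 = true := by simpa [hi] using h0
    simp only [overOut, this, if_true]
    show _ = if D.tail (.cr c 2) then 2 else 0
    rw [t0]; cases D.tail (.cr c 0) <;> rfl
  · have hi : D.isOver c 0 = false := h2.symm.trans hi
    simp only [overOut, hi, Bool.false_eq_true, if_false]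
    show _ = if D.tail (.cr c 3) then 3 else 1
    rw [t1]; cases D.tail (.cr c 1) <;> rfl
  · have hi : D.isOver c 1 = false := h3.symm.trans hi
    have : D.isOver c 0 = true := by simpa [hi] using h0
    simp only [overOut, this, if_true]
    show _ = if D.tail (.cr c 0) then 0 else 2
    rfl

/-- The orientation of the under-arc enters twice, through the sign of the crossing and through the
inversion for walks against the orientation, and cancels. What remains depends on the over-strand:
if it leaves at `i + 1`, its normal points along the walk. All later weight computations use this
form. -/
theorem LocalColoring.arrivalWeight_under {D : Diagram B} {col : D.Darts → X}
    (h : D.LocalColoring col) (φ : X → X → H) (c : D.Crossing) (i : Fin 4)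
    (hi : D.isOver c i = false) : D.arrivalWeight φ col (.cr c i) =
      signedWeight φ (D.tail (.cr c (i + 1))) (col (.cr c (i + 1))) (col (.cr c i)) := by
  have e4 : i + 1 + 3 = i := (add_assoc i 1 3).trans (add_zero i)
  have e5 : i + 3 + 3 = i + 2 := add_assoc i 3 3
  have e3 : i + 3 = i + 1 + 2 := by rw [add_assoc]; rfl
  have h2 := h.underArc c i hi
  have h3 := h.overArc c (i + 1) (by rw [D.isOver_succ, hi]; rfl)
  simp only [arrivalWeight, hi, Bool.false_eq_true, if_false, boltzmann, sign, D.overOut_eq c i hi,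
    signedWeight]
  cases ht : D.tail (.cr c (i + 1))
  · rw [← e3] at h3
    simp only [Bool.false_eq_true, if_false, e5, h3, D.tail_cr, h2, ht, signedAct_false]
    cases D.tail (.cr c i) <;> simp
  · simp only [if_true, e4]
    cases D.tail (.cr c i) <;> simp

/-- Opposite directions through a crossing give inverse weights; this lets a strand be evaluated
from one end only. -/
theorem LocalColoring.arrivalWeight_add_two {D : Diagram B} {col : D.Darts → X}
    (h : D.LocalColoring col) (φ : X → X → H) (c : D.Crossing) (i : Fin 4) :
    D.arrivalWeight φ col (.cr c (i + 2)) = (D.arrivalWeight φ col (.cr c i))⁻¹ := by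
  have e3 : i + 2 + 1 = i + 1 + 2 := by rw [add_assoc, add_assoc]; rfl
  cases hi : D.isOver c i
  · rw [h.arrivalWeight_under φ c i hi, h.arrivalWeight_under φ c (i + 2) (by
      rw [isOver_add_two, hi]), e3, h.overArc c (i + 1) (by rw [D.isOver_succ, hi]; rfl), D.tail_cr,
      h.underArc c i hi, signedWeight_not]
  · rw [D.arrivalWeight_over φ col c i hi, D.arrivalWeight_over φ col c (i + 2) (by
      rw [isOver_add_two, hi]), inv_one]

/-! ### The vertex relations of a vertex-constant coloring -/

theorem clockwiseLegs_nodup (D : Diagram B) (l : D.Leg) : (D.clockwiseLegs l).Nodup := by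
  refine (List.nodup_map_iff_inj_on List.nodup_range).2 fun j hj k hk hjk => ?_
  rw [List.mem_range] at hj hk
  have h1 : (D.next ^ k) l = (D.next ^ j) l := by
    have := congrArg (D.next ^ (j + k)) hjk
    rw [← Equiv.Perm.mul_apply, ← Equiv.Perm.mul_apply, inv_pow, inv_pow, pow_add,
      mul_inv_cancel_right, ← pow_add, add_comm, pow_add, mul_inv_cancel_right] at this
    exact this
  refine Function.iterate_injOn_Iio_minimalPeriod (f := D.next) (x := l) hj hk ?_
  simp only [Equiv.Perm.iterate_eq_pow]
  exact h1.symm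

/-- Together with `clockwiseLegs_nodup`, the list enumerates the legs of one vertex exactly once, so
that sums over it become sums over the vertex. -/
theorem mem_clockwiseLegs (D : Diagram B) (l l' : D.Leg) :
    l' ∈ D.clockwiseLegs l ↔ D.vtx l' = D.vtx l := by
  have := D.finite_leg
  rw [clockwiseLegs, List.mem_map]
  constructor
  · rintro ⟨k, -, rfl⟩
    rw [D.vtx_eq_iff]
    refine ⟨k, ?_⟩
    rw [zpow_natCast, ← Equiv.Perm.mul_apply, inv_pow, mul_inv_cancel, Equiv.Perm.one_apply]
  · intro h
    rw [eq_comm, D.vtx_eq_iff] at h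
    obtain ⟨n, hn⟩ := (Equiv.Perm.sameCycle_inv.2 h).exists_nat_pow_eq
    have hp : 0 < Function.minimalPeriod D.next l := by
      refine Function.minimalPeriod_pos_of_mem_periodicPts ?_
      refine ⟨orderOf D.next, orderOf_pos _, ?_⟩
      rw [Function.IsPeriodicPt, Function.IsFixedPt, Equiv.Perm.iterate_eq_pow, pow_orderOf_eq_one,
        Equiv.Perm.one_apply]
    refine ⟨n % Function.minimalPeriod D.next l, List.mem_range.2 (Nat.mod_lt _ hp), ?_⟩
    rw [← hn]
    have key : ∀ m, (D.next⁻¹ ^ (m * Function.minimalPeriod D.next l)) l = l := by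
      intro m
      rw [inv_pow, Equiv.Perm.inv_eq_iff_eq, ← Equiv.Perm.iterate_eq_pow]
      exact ((Function.isPeriodicPt_minimalPeriod D.next l).const_mul m).symm
    conv_rhs => rw [← Nat.mod_add_div' n (Function.minimalPeriod D.next l), pow_add,
      Equiv.Perm.mul_apply, key]

theorem foldl_legAct (D : Diagram B) {col : D.Darts → X} (y : X) (L : List D.Leg)
    (hL : ∀ l ∈ L, col (.leg l) = y) (x : X) :
    L.foldl (D.legAct col) x =
      (Rack.act' y ^ (L.map fun l => -signExp (D.tail (.leg l))).sum) x := by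
  induction L generalizing x with
  | nil => simp
  | cons l L ih =>
    rw [List.foldl_cons, ih fun l' h => hL l' (by simp [h]), List.map_cons, List.sum_cons, add_comm,
      zpow_add, Equiv.Perm.mul_apply]
    congr 1
    rw [legAct, hL l (by simp)]
    cases D.tail (.leg l) <;> simp [signExp]

/-- At a vertex of one color all operators are powers of the same translation. The cyclic order is
therefore irrelevant, and only the signed number of legs matters. -/
theorem foldl_clockwiseLegs (D : Diagram B) {col : D.Darts → X} (h : D.VertexConstant col) (l : D.Leg)
    (x : X) : (D.clockwiseLegs l).foldl (D.legAct col) x =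
      (Rack.act' (col (.leg l)) ^ D.excess (D.vtx l)) x := by
  classical
  have := D.finite_leg
  have := Fintype.ofFinite D.Leg
  rw [D.foldl_legAct (col (.leg l)) _ fun l' hl' => h _ _ ((D.mem_clockwiseLegs l l').1 hl'),
    D.excess_eq_sum]
  congr 2
  rw [← Finset.sum_filter, ← List.sum_toFinset _ (D.clockwiseLegs_nodup l)]
  congr 1
  ext l'
  simp [mem_clockwiseLegs]

/-- The vertex relations test every arc color of the whole diagram. Passing to a subquandle `C` that
is fixed by all vertex operators makes them local: both parts of a glued diagram can be tested
against the same `C`, and `C` absorbs the new colors that a move creates. -/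
theorem isColoring_and_vertexConstant_iff (D : Diagram B) (col : D.Darts → X) :
    D.IsColoring col ∧ D.VertexConstant col ↔
      D.LocalColoring col ∧ ∃ C, IsSubquandle C ∧ D.FixesColors C col := by
  constructor
  · rintro ⟨h, hv⟩
    -- For `C` the largest candidate is taken, the common fixed set of all vertex operators; the
    -- vertex relations say that all colors belong to it.
    refine ⟨LocalColoring.mk_of_zero h.segment h.joint (fun c hc => ?_) (fun c hc => ?_) hv,
      {x | ∀ l, (Rack.act' (col (.leg l)) ^ D.excess (D.vtx l)) x = x}, isSubquandle_fixed _ _,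
      fun d l => ?_, fun l x hx => hx l⟩
    · have h2 : D.isOver c 2 = true := (D.isOver_add_two c 0).trans hc
      have t0 : D.tail (.cr c 2) = !D.tail (.cr c 0) := D.tail_cr c 0
      have o0 : col (.cr c 2) = col (.cr c 0) := h.overArc c 0 hc
      refine ⟨o0, ?_⟩
      cases ht : D.tail (.cr c 0)
      · rw [ht] at t0
        rw [t0]
        exact h.crossing c 2 h2 t0
      · rw [ht] at t0
        have : col (.cr c 1) = col (.cr c 0) ◃ col (.cr c 3) := h.crossing c 0 hc ht
        rw [t0, o0, this]
        simp
    · have h1 : D.isOver c 1 = true := by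
        have := D.isOver_succ c 0; rw [hc] at this; exact this
      have h3 : D.isOver c 3 = true := (D.isOver_add_two c 1).trans h1
      have t1 : D.tail (.cr c 3) = !D.tail (.cr c 1) := D.tail_cr c 1
      have o1 : col (.cr c 3) = col (.cr c 1) := h.overArc c 1 h1
      refine ⟨o1, ?_⟩
      cases ht : D.tail (.cr c 1)
      · rw [ht] at t1
        have : col (.cr c 0) = col (.cr c 3) ◃ col (.cr c 2) := h.crossing c 3 h3 t1
        rw [this, o1]
        simp
      · exact h.crossing c 1 h1 ht
    · rw [← D.foldl_clockwiseLegs hv]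
      exact h.vertex l d
  · rintro ⟨h, C, -, hC⟩
    refine ⟨⟨h.segment, fun j => h.joint j false, h.overArc, fun c i hi ht => ?_, fun l d => ?_⟩,
      h.vertexConstant⟩
    · have e4 : i + 3 + 1 = i := (add_assoc i 3 1).trans (add_zero i)
      have e5 : i + 3 + 2 = i + 1 := add_assoc i 3 2
      have hu : D.isOver c (i + 3) = false := by
        have := D.isOver_succ c (i + 3)
        rw [e4, hi] at this
        simpa using this.symm
      have := h.underArc c _ hu
      rw [e4, e5, ht] at this
      exact this
    · rw [D.foldl_clockwiseLegs h.vertexConstant]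
      exact hC.fix l _ (hC.mem d)

end Diagram

end GraphTangle

/-! ### Comparing multisets by correspondences -/

namespace GraphTangle

theorem card_eq_of_biTotal_of_biUnique {α β : Type*} {R : α → β → Prop} (ht : Relator.BiTotal R)
    (hu : Relator.BiUnique R) : ENat.card α = ENat.card β := by
  choose f hf using ht.1
  refine ENat.card_congr (Equiv.ofBijective f ⟨fun a a' h => ?_, fun b => ?_⟩)
  · exact hu.1 (hf a) (h ▸ hf a')
  · obtain ⟨a, ha⟩ := ht.2 b
    exact ⟨a, hu.2 (hf a) ha⟩

namespace Diagram

variable {B : Type} {X H : Type*} [Group H]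

/-- The darts along which a walk leaves the nodes that it visits. -/
def Walk.darts {D : Diagram B} {b : B} : ∀ {d : D.Darts}, D.Walk b d → List D.Darts
  | _, .finish d _ => [d]
  | _, .go d _ _ w => d :: w.darts

variable [Quandle X]

/-- Correspondences of walks and of colorings that preserve lengths and weights yield equal
multisets. -/
theorem psi_eq_of_correspondence {D D' : Diagram B} {φ : X → X → H} {b b' : B}
    (Rw : D.ExtendedWalk b b' → D'.ExtendedWalk b b' → Prop)
    (Rc : D.VColoring X → D'.VColoring X → Prop)
    (hct : Relator.BiTotal Rc) (hcu : Relator.BiUnique Rc)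
    (hcb : ∀ c c', Rc c c' → c.1 (.bd b) = c'.1 (.bd b))
    (hw : ∀ c c', Rc c c' → Relator.BiUnique Rw ∧ Relator.BiTotal fun w w' => Rw w w' ∧
      w.visits = w'.visits ∧ w.weight φ c.1 = w'.weight φ c'.1) (n : ℕ) (q : X) :
    D.psi φ b b' n q = D'.psi φ b b' n q := by
  funext h
  -- The relation of walks does not depend on the colorings, but its totality with equal weights is
  -- only available for a corresponding pair of them. The coloring is therefore matched before the
  -- walk.
  refine card_eq_of_biTotal_of_biUnique (R := fun p p' => Rw p.1.1 p'.1.1 ∧ Rc p.1.2 p'.1.2)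
    ⟨?_, ?_⟩ ⟨?_, ?_⟩
  · rintro ⟨⟨w, c⟩, h1, h2, h3⟩
    obtain ⟨c', hc⟩ := hct.1 c
    obtain ⟨w', hR, hv, hwt⟩ := (hw c c' hc).2.1 w
    refine ⟨⟨⟨w', c'⟩, ?_, ?_, ?_⟩, hR, hc⟩
    · simpa only [Walk.length, ← hv] using h1
    · exact (hcb c c' hc).symm.trans h2
    · exact hwt.symm.trans h3
  · rintro ⟨⟨w', c'⟩, h1, h2, h3⟩
    obtain ⟨c, hc⟩ := hct.2 c'
    obtain ⟨w, hR, hv, hwt⟩ := (hw c c' hc).2.2 w'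
    refine ⟨⟨⟨w, c⟩, ?_, ?_, ?_⟩, hR, hc⟩
    · simpa only [Walk.length, hv] using h1
    · exact (hcb c c' hc).trans h2
    · exact hwt.trans h3
  · rintro ⟨⟨w, c⟩, _⟩ ⟨⟨w', c'⟩, _⟩ ⟨⟨w'', c''⟩, _⟩ ⟨h1, h2⟩ ⟨h3, h4⟩
    obtain rfl := hcu.1 h2 h4
    obtain rfl := (hw _ _ h2).1.1 h1 h3
    rfl
  · rintro ⟨⟨w, c⟩, _⟩ ⟨⟨w', c'⟩, _⟩ ⟨⟨w'', c''⟩, _⟩ ⟨h1, h2⟩ ⟨h3, h4⟩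
    obtain rfl := hcu.2 h2 h4
    obtain rfl := (hw _ _ h2).1.2 h1 h3
    rfl

/-! ### Refinements -/

/-- `D'` is `D` up to renaming of nodes and insertion of joints: the segment that starts at the dart `d`
of `D` corresponds to the segment of `D'` that starts at `dart d`, or to two segments of which the second
starts at `exit d`. -/
structure Refinement (D D' : Diagram B) where
  dart : D.Darts → D'.Darts
  exit : D.Darts → D'.Darts
  leg : D.Leg → D'.Leg
  dart_injective : Function.Injective dart
  dart_bd : ∀ b, dart (.bd b) = .bd b
  dart_leg : ∀ l, dart (.leg l) = .leg (leg l)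
  leg_surjective : Function.Surjective leg
  legCount_dart : ∀ d, legCount (dart d) = legCount d
  excess_leg : ∀ l, D'.excess (D'.vtx (leg l)) = D.excess (D.vtx l)
  passes_dart : ∀ x y', D'.Passes (dart x) y' ↔ ∃ y, y' = dart y ∧ D.Passes x y
  link_exit : ∀ d, D'.link (exit d) = dart (D.link d)
  exit_eq : ∀ d, exit d = dart d ∨
    ∃ j i, D'.link (dart d) = .jt j i ∧ exit d = .jt j (!i)
  exit_cases : ∀ e, (∃ d, e = dart d) ∨ ∃ d, e = D'.link (dart d)

namespace Refinement

variable {D D' : Diagram B} (ρ : Refinement D D')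

theorem passes_exit (d : D.Darts) (h : ρ.exit d ≠ ρ.dart d) :
    D'.Passes (D'.link (ρ.dart d)) (ρ.exit d) := by
  obtain h' | ⟨j, i, h1, h2⟩ := ρ.exit_eq d
  · exact absurd h' h
  · rw [h1, h2]
    exact .joint j i

open Classical in
/-- Prepend the first of the two segments that correspond to a cut segment. -/
noncomputable def enter {b : B} (d : D.Darts) (w : D'.Walk b (ρ.exit d)) : D'.Walk b (ρ.dart d) :=
  if h : ρ.exit d = ρ.dart d then h ▸ w else .go _ _ (ρ.passes_exit d h) w

theorem enter_visits {b : B} (d : D.Darts) (w : D'.Walk b (ρ.exit d)) :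
    (ρ.enter d w).visits = w.visits := by
  unfold enter
  split_ifs with h
  · revert w h
    generalize ρ.exit d = e
    rintro w rfl
    rfl
  · obtain h' | ⟨j, i, h1, -⟩ := ρ.exit_eq d
    · exact absurd h' h
    · simp [Walk.visits, h1, legCount]

omit [Quandle X] in
theorem enter_weight {b : B} (φ : X → X → H) (col : D'.Darts → X) (d : D.Darts)
    (w : D'.Walk b (ρ.exit d)) : (ρ.enter d w).weight φ col = w.weight φ col := by
  unfold enter
  split_ifs with h
  · revert w h
    generalize ρ.exit d = e
    rintro w rfl
    rfl
  · obtain h' | ⟨j, i, h1, -⟩ := ρ.exit_eq d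
    · exact absurd h' h
    · simp [Walk.weight, h1, arrivalWeight]

theorem enter_injective {b : B} (d : D.Darts) : Function.Injective (ρ.enter (b := b) d) := by
  intro w w' hw
  unfold enter at hw
  split_ifs at hw with h
  · revert w w' h
    generalize ρ.exit d = e
    rintro w w' rfl h
    exact h
  · simpa using hw

/-- A walk that arrives at an inserted joint has to go straight on, so the first part of a cut
segment can be stripped off. The bound on the number of darts serves the induction in
`walk_surjective`. -/
theorem enter_surjective {b : B} (d : D.Darts) (w : D'.Walk b (ρ.dart d)) :
    ∃ w₀, ρ.enter d w₀ = w ∧ w₀.darts.length ≤ w.darts.length := by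
  by_cases h : ρ.exit d = ρ.dart d
  · unfold enter
    simp only [h, dif_pos]
    revert h
    generalize ρ.exit d = e
    rintro rfl
    exact ⟨w, rfl, le_rfl⟩
  · obtain h' | ⟨j, i, h1, h2⟩ := ρ.exit_eq d
    · exact absurd h' h
    · cases w with
      | finish _ hf => rw [h1] at hf; cases hf
      | go _ d' hp w =>
        obtain rfl : d' = ρ.exit d := by
          rw [h1] at hp; rw [h2]; cases hp; rfl
        refine ⟨w, ?_, by simp [Walk.darts]⟩
        unfold enter
        simp [h]

/-- The walk in the refined diagram that follows a walk. -/
noncomputable def walk {b : B} : ∀ {d : D.Darts}, D.Walk b d → D'.Walk b (ρ.dart d)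
  | _, .finish d h => ρ.enter d (.finish _ (by rw [ρ.link_exit, h, ρ.dart_bd]))
  | _, .go d d' h w => ρ.enter d (.go _ (ρ.dart d')
      (by rw [ρ.link_exit, ρ.passes_dart]; exact ⟨d', rfl, h⟩) (walk w))

theorem walk_injective {b : B} {d : D.Darts} (w w' : D.Walk b d) (h : ρ.walk w = ρ.walk w') :
    w = w' := by
  induction w with
  | finish d hd =>
    cases w' with
    | finish => rfl
    | go _ d' hp w' =>
      have := ρ.enter_injective _ h
      cases this
  | go d d' hp w ih =>
    cases w' with
    | finish _ hd =>
      have := ρ.enter_injective _ h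
      cases this
    | go _ d'' hp' w' =>
      have h1 := ρ.enter_injective _ h
      simp only [Walk.go.injEq] at h1
      obtain rfl := ρ.dart_injective h1.1
      rw [ih w' (eq_of_heq h1.2)]

theorem walk_surjective {b : B} (d : D.Darts) (w' : D'.Walk b (ρ.dart d)) : ∃ w, ρ.walk w = w' := by
  -- Structural induction would stop at the inserted joints, where no walk of `D` starts; counting
  -- darts allows the joint and the following node to be passed together.
  induction hn : w'.darts.length using Nat.strong_induction_on generalizing d with
  | _ n ih =>
    subst hn
    obtain ⟨w₀, rfl, hl⟩ := ρ.enter_surjective d w'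
    cases hw₀ : w₀ with
    | finish _ h =>
      have hd : D.link d = .bd b := by
        rw [ρ.link_exit, ← ρ.dart_bd] at h
        exact ρ.dart_injective h
      exact ⟨.finish d hd, rfl⟩
    | go _ y h w₁ =>
      have h' := h
      rw [ρ.link_exit, ρ.passes_dart] at h'
      obtain ⟨y, rfl, hy⟩ := h'
      obtain ⟨w, rfl⟩ := ih _ (by rw [hw₀] at hl; simp only [Walk.darts, List.length_cons] at hl
                                  rw [hw₀]; omega) y w₁ rfl
      exact ⟨.go d y hy w, rfl⟩

theorem walk_visits {b : B} {d : D.Darts} (w : D.Walk b d) : (ρ.walk w).visits = w.visits := by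
  induction w with
  | finish d hd => rw [walk, enter_visits]; rfl
  | go d d' hp w ih =>
    rw [walk, enter_visits, Walk.visits, Walk.visits, ih, ρ.link_exit, ρ.legCount_dart]

omit [Quandle X] in
theorem walk_weight {b : B} (φ : X → X → H) (col : D'.Darts → X)
    (hcol : ∀ d, D'.arrivalWeight φ col (ρ.dart d) = D.arrivalWeight φ (col ∘ ρ.dart) d)
    {d : D.Darts} (w : D.Walk b d) : (ρ.walk w).weight φ col = w.weight φ (col ∘ ρ.dart) := by
  induction w with
  | finish d hd => rw [walk, enter_weight]; rfl
  | go d d' hp w ih =>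
    rw [walk, enter_weight, Walk.weight, Walk.weight, ih, ρ.link_exit, hcol]

/-- Colorings correspond by restriction along `dart`. This is injective, and preserves membership in
`C`, because by `exit_cases` every dart of `D'` is an old one or shares a segment with an old one.
-/
theorem psi_eq {φ : X → X → H}
    (restrict : ∀ col : D'.Darts → X, D'.LocalColoring col → D.LocalColoring (col ∘ ρ.dart))
    (extend : ∀ col : D.Darts → X, D.LocalColoring col →
      ∃ col', D'.LocalColoring col' ∧ col' ∘ ρ.dart = col)
    (weight : ∀ col : D'.Darts → X, D'.LocalColoring col →
      ∀ d, D'.arrivalWeight φ col (ρ.dart d) = D.arrivalWeight φ (col ∘ ρ.dart) d)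
    (b b' : B) (n : ℕ) (q : X) : D.psi φ b b' n q = D'.psi φ b b' n q := by
  have hmem : ∀ (C : Set X) (col : D'.Darts → X), D'.LocalColoring col →
      (D'.FixesColors C col ↔ D.FixesColors C (col ∘ ρ.dart)) := by
    intro C col hcol
    constructor
    · intro h
      refine ⟨fun d => h.mem _, fun l x hx => ?_⟩
      rw [Function.comp_apply, ρ.dart_leg, ← ρ.excess_leg]
      exact h.fix _ x hx
    · intro h
      refine ⟨fun e => ?_, fun l x hx => ?_⟩
      · obtain ⟨d, rfl⟩ | ⟨d, rfl⟩ := ρ.exit_cases e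
        · exact h.mem d
        · rw [hcol.segment]
          exact h.mem d
      · obtain ⟨l, rfl⟩ := ρ.leg_surjective l
        rw [ρ.excess_leg, ← ρ.dart_leg]
        exact h.fix l x hx
  refine psi_eq_of_correspondence
    (fun w w' => (ρ.dart_bd b ▸ ρ.walk w : D'.Walk b' (.bd b)) = w')
    (fun c c' => c.1 = c'.1 ∘ ρ.dart) ⟨fun c => ?_, fun c' => ?_⟩ ⟨?_, ?_⟩ ?_ ?_ n q
  · obtain ⟨hc, C, hC, hf⟩ := (D.isColoring_and_vertexConstant_iff c.1).1 c.2
    obtain ⟨col', hl, he⟩ := extend c.1 hc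
    exact ⟨⟨col', (D'.isColoring_and_vertexConstant_iff col').2
      ⟨hl, C, hC, (hmem C col' hl).2 (he ▸ hf)⟩⟩, he.symm⟩
  · obtain ⟨hc, C, hC, hf⟩ := (D'.isColoring_and_vertexConstant_iff c'.1).1 c'.2
    exact ⟨⟨_, (D.isColoring_and_vertexConstant_iff _).2
      ⟨restrict _ hc, C, hC, (hmem C c'.1 hc).1 hf⟩⟩, rfl⟩
  · intro c₁ c₂ c' h1 h2
    exact Subtype.ext (h1.trans h2.symm)
  · intro c c₁ c₂ h1 h2
    refine Subtype.ext (funext fun e => ?_)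
    obtain ⟨d, rfl⟩ | ⟨d, rfl⟩ := ρ.exit_cases e
    · exact congrFun (h1.symm.trans h2) d
    · rw [c₁.2.1.segment, c₂.2.1.segment]
      exact congrFun (h1.symm.trans h2) d
  · intro c c' h
    rw [h, Function.comp_apply, ρ.dart_bd]
  · intro c c' h
    have hl := ((D'.isColoring_and_vertexConstant_iff c'.1).1 c'.2).1
    -- The image of `.bd b` is only propositionally `.bd b`. Generalizing it to `e` removes the
    -- transport from all three properties at once.
    have hcast : ∀ e (he : ρ.dart (.bd b) = e),
        Function.Injective (fun w : D.Walk b' (.bd b) => (he ▸ ρ.walk w : D'.Walk b' e)) ∧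
        Function.Surjective (fun w : D.Walk b' (.bd b) => (he ▸ ρ.walk w : D'.Walk b' e)) ∧
        ∀ w : D.Walk b' (.bd b), w.visits = (he ▸ ρ.walk w : D'.Walk b' e).visits ∧
          w.weight φ c.1 = (he ▸ ρ.walk w : D'.Walk b' e).weight φ c'.1 := by
      rintro e rfl
      refine ⟨fun w w' hw => ρ.walk_injective w w' hw, fun w => ρ.walk_surjective _ w, fun w =>
        ⟨(ρ.walk_visits w).symm, ?_⟩⟩
      rw [h]
      exact (ρ.walk_weight φ c'.1 (weight _ hl) w).symm
    obtain ⟨hi, hs, hvw⟩ := hcast _ (ρ.dart_bd b)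
    refine ⟨⟨fun w w'' w' h1 h2 => hi (h1.trans h2.symm), fun w w' w'' h1 h2 => h1.symm.trans h2⟩,
      fun w => ⟨_, rfl, hvw w⟩, fun w' => ?_⟩
    obtain ⟨w, rfl⟩ := hs w'
    exact ⟨w, rfl, hvw w⟩

end Refinement

/-! ### Renaming the nodes -/

namespace Iso

variable {D D' : Diagram B} (e : Iso D D')

/-- The map of darts given by an isomorphism. -/
def dart : D.Darts → D'.Darts := mapDart e.crossing e.turn e.joint e.flip e.leg

theorem dart_bijective : Function.Bijective e.dart := by
  constructor
  · rintro (b | ⟨c, i⟩ | ⟨j, i⟩ | l) (b' | ⟨c', i'⟩ | ⟨j', i'⟩ | l') h <;>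
      simp only [dart, mapDart, reduceCtorEq, Dart.bd.injEq, Dart.cr.injEq, Dart.jt.injEq,
        Dart.leg.injEq, EmbeddingLike.apply_eq_iff_eq] at h
    · rw [h]
    · obtain ⟨rfl, h⟩ := h
      rw [add_right_cancel h]
    · obtain ⟨rfl, h⟩ := h
      rw [Bool.xor_left_inj.1 h]
    · rw [h]
  · rintro (b | ⟨c, i⟩ | ⟨j, i⟩ | l)
    · exact ⟨.bd b, rfl⟩
    · refine ⟨.cr (e.crossing.symm c) (i - e.turn (e.crossing.symm c)), ?_⟩
      simp [dart, mapDart]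
    · refine ⟨.jt (e.joint.symm j) (i ^^ e.flip (e.joint.symm j)), ?_⟩
      simp [dart, mapDart]
    · exact ⟨.leg (e.leg.symm l), by simp [dart, mapDart]⟩

theorem excess_eq (v : D.Vertex) : D'.excess (e.vertex v) = D.excess v := by
  have h : ∀ t, Nat.card {l : D'.Leg // D'.vtx l = e.vertex v ∧ D'.tail (.leg l) = t} =
      Nat.card {l : D.Leg // D.vtx l = v ∧ D.tail (.leg l) = t} := by
    intro t
    refine (Nat.card_congr (e.leg.subtypeEquiv fun l => ?_)).symm
    have : D'.tail (.leg (e.leg l)) = D.tail (.leg l) := e.tail_eq (.leg l)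
    rw [e.vtx_leg, this, EmbeddingLike.apply_eq_iff_eq]
  rw [excess, excess, inDegree, outDegree, h, h]
  rfl

theorem passes_dart (x : D.Darts) (y' : D'.Darts) :
    D'.Passes (e.dart x) y' ↔ ∃ y, y' = e.dart y ∧ D.Passes x y := by
  constructor
  · intro h
    rcases x with b | ⟨c, i⟩ | ⟨j, i⟩ | l
    · cases h
    · have h : D'.Passes (.cr (e.crossing c) (i + e.turn c)) y' := h
      cases h
      refine ⟨_, ?_, .crossing c i⟩
      simp only [dart, mapDart]
      rw [add_right_comm]
    · have h : D'.Passes (.jt (e.joint j) (i ^^ e.flip j)) y' := h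
      cases h
      refine ⟨_, ?_, .joint j i⟩
      simp [dart, mapDart]
    · have h : D'.Passes (.leg (e.leg l)) y' := h
      cases h with
      | vertex _ l' hl =>
        refine ⟨.leg (e.leg.symm l'), by simp [dart, mapDart], .vertex _ _ ?_⟩
        rw [← e.leg.apply_symm_apply l', e.vtx_leg, e.vtx_leg] at hl
        exact e.vertex.injective hl
  · rintro ⟨y, rfl, h⟩
    cases h with
    | crossing c i =>
      have : e.dart (.cr c (i + 2)) = .cr (e.crossing c) (i + e.turn c + 2) := by
        simp only [dart, mapDart]; rw [add_right_comm]
      rw [this]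
      exact .crossing _ _
    | joint j i =>
      have : e.dart (.jt j (!i)) = .jt (e.joint j) (!(i ^^ e.flip j)) := by
        simp [dart, mapDart]
      rw [this]
      exact .joint _ _
    | vertex l l' h => exact .vertex _ _ (by rw [e.vtx_leg, e.vtx_leg, h])

/-- An isomorphism is a refinement. -/
def refinement : Refinement D D' where
  dart := e.dart
  exit := e.dart
  leg := e.leg
  dart_injective := e.dart_bijective.1
  dart_bd _ := rfl
  dart_leg _ := rfl
  leg_surjective := e.leg.surjective
  legCount_dart := by rintro (_ | _ | _ | _) <;> rfl
  excess_leg l := by rw [e.vtx_leg, e.excess_eq]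
  passes_dart := e.passes_dart
  link_exit := e.link_eq
  exit_eq _ := .inl rfl
  exit_cases d := by
    obtain ⟨x, rfl⟩ := e.dart_bijective.2 d
    exact .inl ⟨x, rfl⟩

theorem localColoring_iff (col : D'.Darts → X) :
    D'.LocalColoring col ↔ D.LocalColoring (col ∘ e.dart) := by
  have h1 : ∀ c i k, e.dart (.cr c (i + k)) = .cr (e.crossing c) (i + e.turn c + k) := by
    intro c i k; simp only [dart, mapDart]; rw [add_right_comm]
  have h0 : ∀ c i, e.dart (.cr c i) = .cr (e.crossing c) (i + e.turn c) := fun _ _ => rfl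
  have ht : ∀ c i, D'.tail (.cr (e.crossing c) (i + e.turn c)) = D.tail (.cr c i) := fun c i =>
    e.tail_eq (.cr c i)
  have ht1 : ∀ c i k, D'.tail (.cr (e.crossing c) (i + e.turn c + k)) = D.tail (.cr c (i + k)) :=
    fun c i k => by rw [← ht, add_right_comm]
  have hj : ∀ j i, e.dart (.jt j (!i)) = .jt (e.joint j) (!(i ^^ e.flip j)) := by
    intro j i; simp [dart, mapDart]
  constructor
  · intro h
    refine ⟨fun d => ?_, fun j i => ?_, fun c i hi => ?_, fun c i hi => ?_, fun l l' hl => ?_⟩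
    · exact (congrArg col (e.link_eq d)).symm.trans (h.segment _)
    · rw [Function.comp_apply, hj]
      exact h.joint _ _
    · rw [Function.comp_apply, Function.comp_apply, h1, h0]
      exact h.overArc _ _ (by rw [e.isOver_eq, hi])
    · rw [Function.comp_apply, Function.comp_apply, Function.comp_apply, h1, h1, h0, ← ht1]
      exact h.underArc _ _ (by rw [e.isOver_eq, hi])
    · exact h.vertexConstant _ _ (by rw [e.vtx_leg, e.vtx_leg, hl])
  · intro h
    have hc : ∀ c i, ∃ c₀ i₀, c = e.crossing c₀ ∧ i = i₀ + e.turn c₀ := fun c i =>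
      ⟨e.crossing.symm c, i - e.turn (e.crossing.symm c), by simp, by simp⟩
    refine ⟨fun d => ?_, fun j i => ?_, fun c i hi => ?_, fun c i hi => ?_, fun l l' hl => ?_⟩
    · obtain ⟨x, rfl⟩ := e.dart_bijective.2 d
      exact (congrArg col (e.link_eq x)).trans (h.segment x)
    · obtain ⟨j, rfl⟩ := e.joint.surjective j
      have := h.joint j (i ^^ e.flip j)
      rw [Function.comp_apply, hj] at this
      simpa [dart, mapDart] using this
    · obtain ⟨c, i, rfl, rfl⟩ := hc c i
      have := h.overArc c i (by rw [← e.isOver_eq, hi])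
      rwa [Function.comp_apply, Function.comp_apply, h1, h0] at this
    · obtain ⟨c, i, rfl, rfl⟩ := hc c i
      have := h.underArc c i (by rw [← e.isOver_eq, hi])
      rwa [Function.comp_apply, Function.comp_apply, Function.comp_apply, h1, h1, h0, ← ht1] at this
    · obtain ⟨l, rfl⟩ := e.leg.surjective l
      obtain ⟨l', rfl⟩ := e.leg.surjective l'
      rw [e.vtx_leg, e.vtx_leg] at hl
      exact h.vertexConstant l l' (e.vertex.injective hl)

/-- A rotation of the numbering at a crossing may change the case taken in `overOut`. The comparison
therefore goes through `arrivalWeight_under`, which is relative to the arriving dart. -/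
theorem arrivalWeight_dart (φ : X → X → H) {col : D'.Darts → X} (h : D'.LocalColoring col)
    (d : D.Darts) : D'.arrivalWeight φ col (e.dart d) = D.arrivalWeight φ (col ∘ e.dart) d := by
  rcases d with b | ⟨c, i⟩ | ⟨j, i⟩ | l
  · rfl
  · have h0 : e.dart (.cr c i) = .cr (e.crossing c) (i + e.turn c) := rfl
    cases hi : D.isOver c i
    · have h1 : e.dart (.cr c (i + 1)) = .cr (e.crossing c) (i + e.turn c + 1) := by
        simp only [dart, mapDart]; rw [add_right_comm]
      have ht : D'.tail (e.dart (.cr c (i + 1))) = D.tail (.cr c (i + 1)) := e.tail_eq _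
      rw [((e.localColoring_iff col).1 h).arrivalWeight_under φ c i hi, h0,
        h.arrivalWeight_under φ _ _ (by rw [e.isOver_eq, hi]), ← ht, Function.comp_apply,
        Function.comp_apply, h1, h0]
    · rw [D.arrivalWeight_over _ _ _ _ hi, h0,
        D'.arrivalWeight_over _ _ _ _ (by rw [e.isOver_eq, hi])]
  · rfl
  · rfl

theorem psi_eq {D D' : Diagram B} (e : Iso D D') (φ : X → X → H) (b b' : B) (n : ℕ) (q : X) :
    D.psi φ b b' n q = D'.psi φ b b' n q := by
  refine e.refinement.psi_eq (fun col => (e.localColoring_iff col).1) (fun col hcol => ?_)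
    (fun col hcol => e.arrivalWeight_dart φ hcol) b b' n q
  let E := Equiv.ofBijective _ e.dart_bijective
  have h : (col ∘ E.symm) ∘ e.dart = col := by
    funext d
    exact congrArg col (E.symm_apply_apply d)
  exact ⟨col ∘ E.symm, (e.localColoring_iff _).2 (h.symm ▸ hcol), h⟩

end Iso

/-! ### Cutting a segment by a joint -/

section Subdivide

variable (D : Diagram B) (d₀ : D.Darts)

/-- The darts of `D` in the diagram with an additional joint. -/
def subOld (x : D.Darts) : (D.subdivide d₀).Darts := oldDart x

/-- The two new darts in the diagram with an additional joint. -/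
def subNew (i : Bool) : (D.subdivide d₀).Darts := Dart.jt (J := Option D.Joint) none i

/-- Extend a function on the darts of `D` to the new darts by a constant value. -/
def subExtend {Y : Type*} (col : D.Darts → Y) (y : Y) (e : (D.subdivide d₀).Darts) : Y :=
  Sum.elim col (fun _ => y) (oldOrNew (J := D.Joint) e)

theorem subExtend_subOld {Y : Type*} (col : D.Darts → Y) (y : Y) (x : D.Darts) :
    D.subExtend d₀ col y (D.subOld d₀ x) = col x :=
  congrArg (Sum.elim col fun _ => y) (oldOrNew_oldDart x)

theorem subExtend_subNew {Y : Type*} (col : D.Darts → Y) (y : Y) (i : Bool) :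
    D.subExtend d₀ col y (D.subNew d₀ i) = y := rfl

theorem subDart_cases (e : (D.subdivide d₀).Darts) :
    (∃ x, e = D.subOld d₀ x) ∨ ∃ i, e = D.subNew d₀ i :=
  oldOrNew_cases (J := D.Joint) e

theorem subOld_injective : Function.Injective (D.subOld d₀) := by
  intro x y h
  have := congrArg (D.subExtend d₀ id x) h
  rwa [subExtend_subOld, subExtend_subOld] at this

theorem subdivide_link_subOld (x : D.Darts) (h : x ≠ d₀) (h' : x ≠ D.link d₀) :
    (D.subdivide d₀).link (D.subOld d₀ x) = D.subOld d₀ (D.link x) := by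
  simp [subdivide, subOld, oldOrNew_oldDart, h, h']

theorem subdivide_link_left : (D.subdivide d₀).link (D.subOld d₀ d₀) = D.subNew d₀ false := by
  simp [subdivide, subOld, subNew, oldOrNew_oldDart]

theorem subdivide_link_right :
    (D.subdivide d₀).link (D.subOld d₀ (D.link d₀)) = D.subNew d₀ true := by
  simp [subdivide, subOld, subNew, oldOrNew_oldDart, D.link_ne]

theorem subdivide_link_false : (D.subdivide d₀).link (D.subNew d₀ false) = D.subOld d₀ d₀ := rfl

theorem subdivide_link_true :
    (D.subdivide d₀).link (D.subNew d₀ true) = D.subOld d₀ (D.link d₀) := rfl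

theorem subdivide_passes (x : D.Darts) (y' : (D.subdivide d₀).Darts) :
    (D.subdivide d₀).Passes (D.subOld d₀ x) y' ↔ ∃ y, y' = D.subOld d₀ y ∧ D.Passes x y := by
  constructor
  · intro h
    rcases x with b | ⟨c, i⟩ | ⟨j, i⟩ | l
    · have h : (D.subdivide d₀).Passes (.bd b) y' := h
      cases h
    · have h : (D.subdivide d₀).Passes (.cr c i) y' := h
      cases h
      exact ⟨.cr c (i + 2), rfl, .crossing c i⟩
    · have h : (D.subdivide d₀).Passes (.jt (some j) i) y' := h
      cases h
      exact ⟨.jt j (!i), rfl, .joint j i⟩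
    · have h : (D.subdivide d₀).Passes (.leg l) y' := h
      cases h with
      | vertex _ l' hl => exact ⟨.leg l', rfl, .vertex _ _ hl⟩
  · rintro ⟨y, rfl, h⟩
    cases h with
    | crossing c i => exact .crossing (D := D.subdivide d₀) c i
    | joint j i => exact .joint (D := D.subdivide d₀) (some j) i
    | vertex l l' h => exact .vertex (D := D.subdivide d₀) l l' h

open Classical in
/-- Cutting a segment by a joint is a refinement. -/
noncomputable def subdivideRefinement : Refinement D (D.subdivide d₀) where
  dart := D.subOld d₀
  exit d := if d = d₀ then D.subNew d₀ true else if d = D.link d₀ then D.subNew d₀ false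
    else D.subOld d₀ d
  leg := id
  dart_injective := D.subOld_injective d₀
  dart_bd _ := rfl
  dart_leg _ := rfl
  leg_surjective := Function.surjective_id
  legCount_dart := by rintro (_ | _ | _ | _) <;> rfl
  excess_leg _ := rfl
  passes_dart := D.subdivide_passes d₀
  link_exit d := by
    by_cases h : d = d₀
    · rw [if_pos h, subdivide_link_true, h]
    · by_cases h' : d = D.link d₀
      · rw [if_neg h, if_pos h', subdivide_link_false, h', D.link_link]
      · rw [if_neg h, if_neg h', D.subdivide_link_subOld d₀ d h h']
  exit_eq d := by
    by_cases h : d = d₀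
    · rw [if_pos h, h]
      exact .inr ⟨_, _, D.subdivide_link_left d₀, rfl⟩
    · by_cases h' : d = D.link d₀
      · rw [if_neg h, if_pos h', h']
        exact .inr ⟨_, _, D.subdivide_link_right d₀, rfl⟩
      · rw [if_neg h, if_neg h']
        exact .inl rfl
  exit_cases e := by
    obtain ⟨x, rfl⟩ | ⟨_ | _, rfl⟩ := D.subDart_cases d₀ e
    · exact .inl ⟨x, rfl⟩
    · exact .inr ⟨d₀, (D.subdivide_link_left d₀).symm⟩
    · exact .inr ⟨D.link d₀, (D.subdivide_link_right d₀).symm⟩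

theorem localColoring_of_subdivide (col : (D.subdivide d₀).Darts → X)
    (h : (D.subdivide d₀).LocalColoring col) : D.LocalColoring (col ∘ D.subOld d₀) := by
  refine ⟨fun d => ?_, fun j i => h.joint (some j) i, fun c i hi => h.overArc c i hi,
    fun c i hi => h.underArc c i hi, fun l l' hl => h.vertexConstant l l' hl⟩
  -- The two ends of the cut segment are no longer linked directly; their colors agree through the
  -- new joint.
  have h0 : col (D.subOld d₀ d₀) = col (D.subOld d₀ (D.link d₀)) := by
    rw [← h.segment (D.subOld d₀ d₀), subdivide_link_left,
      ← h.segment (D.subOld d₀ (D.link d₀)), subdivide_link_right]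
    exact h.joint none true
  rw [Function.comp_apply, Function.comp_apply]
  by_cases h1 : d = d₀
  · rw [h1, h0]
  · by_cases h2 : d = D.link d₀
    · rw [h2, D.link_link, h0]
    · rw [← D.subdivide_link_subOld d₀ d h1 h2]
      exact h.segment _

theorem localColoring_subdivide (col : D.Darts → X) (h : D.LocalColoring col) :
    (D.subdivide d₀).LocalColoring (D.subExtend d₀ col (col d₀)) := by
  refine ⟨fun d => ?_, ?_, fun c i hi => h.overArc c i hi, fun c i hi => h.underArc c i hi,
    fun l l' hl => h.vertexConstant l l' hl⟩
  · obtain ⟨x, rfl⟩ | ⟨_ | _, rfl⟩ := D.subDart_cases d₀ d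
    · by_cases h1 : x = d₀
      · rw [h1, subdivide_link_left, subExtend_subNew, subExtend_subOld]
      · by_cases h2 : x = D.link d₀
        · rw [h2, subdivide_link_right, subExtend_subNew, subExtend_subOld, h.segment]
        · rw [D.subdivide_link_subOld d₀ x h1 h2, subExtend_subOld, subExtend_subOld, h.segment]
    · rw [subdivide_link_false, subExtend_subNew, subExtend_subOld]
    · rw [subdivide_link_true, subExtend_subNew, subExtend_subOld, h.segment]
  · rintro (_ | j) i
    · rfl
    · exact h.joint j i

theorem subdivide_psi_eq (φ : X → X → H) (b b' : B) (n : ℕ) (q : X) :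
    D.psi φ b b' n q = (D.subdivide d₀).psi φ b b' n q := by
  refine (D.subdivideRefinement d₀).psi_eq (D.localColoring_of_subdivide d₀)
    (fun col hcol => ⟨_, D.localColoring_subdivide d₀ col hcol, funext fun d => ?_⟩)
    (fun col _ d => ?_) b b' n q
  · exact D.subExtend_subOld d₀ col _ d
  · rcases d with b | ⟨c, i⟩ | ⟨j, i⟩ | l <;> rfl

end Subdivide

end Diagram

end GraphTangle

namespace GraphTangle

namespace Diagram

variable {B K : Type} {X H : Type*} [Group H]

/-! ### Walks in a glued diagram -/

section GlueWalks

variable [Finite K] (O : Diagram (B ⊕ K)) (I : Diagram K)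
  (h : ∀ k, O.tail (.bd (.inr k)) = !I.tail (.bd k))

/-- The darts of the outer diagram in the glued diagram. -/
def glueOuter (x : O.Darts) : (O.glue I h).Darts := outerDart x

/-- The darts of the inner diagram in the glued diagram. -/
def glueInner (x : I.Darts) : (O.glue I h).Darts := innerDart x

/-- The function on the darts of the glued diagram given by functions on the darts of the pieces. -/
def glueElim {Y : Type*} (f : O.Darts → Y) (g : I.Darts → Y) (e : (O.glue I h).Darts) : Y :=
  Sum.elim f g (glueSide (J₁ := O.Joint) (J₂ := I.Joint) e)

theorem glueElim_outer {Y : Type*} (f : O.Darts → Y) (g : I.Darts → Y) (x : O.Darts) :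
    glueElim O I h f g (glueOuter O I h x) = f x :=
  congrArg (Sum.elim f g) (glueSide_outerDart x)

theorem glueElim_inner {Y : Type*} (f : O.Darts → Y) (g : I.Darts → Y) (x : I.Darts) :
    glueElim O I h f g (glueInner O I h x) = g x :=
  congrArg (Sum.elim f g) (glueSide_innerDart x)

theorem glueDart_cases (e : (O.glue I h).Darts) :
    (∃ x, e = glueOuter O I h x) ∨ ∃ x, e = glueInner O I h x :=
  glueSide_cases (J₁ := O.Joint) (J₂ := I.Joint) e

theorem glueOuter_injective : Function.Injective (glueOuter O I h) := by
  intro x y hxy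
  have := congrArg (glueElim O I h some fun _ => none) hxy
  rw [glueElim_outer, glueElim_outer] at this
  exact Option.some.inj this

theorem glueOuter_ne_glueInner (x : O.Darts) (y : I.Darts) :
    glueOuter O I h x ≠ glueInner O I h y := by
  intro hxy
  have := congrArg (glueElim O I h (fun _ => true) fun _ => false) hxy
  rw [glueElim_outer, glueElim_inner] at this
  cases this

theorem glue_link_outer (x : O.Darts) :
    (O.glue I h).link (glueOuter O I h x) = glueOuter O I h (O.link x) := by
  simp [glue, glueOuter, glueSide_outerDart]

theorem glue_link_inner (x : I.Darts) :
    (O.glue I h).link (glueInner O I h x) = glueInner O I h (I.link x) := by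
  simp [glue, glueInner, glueSide_innerDart]

theorem glue_passes_outer {x : O.Darts} {y' : (O.glue I h).Darts}
    (hp : (O.glue I h).Passes (glueOuter O I h x) y') :
    (∃ y, y' = glueOuter O I h y ∧ O.Passes x y) ∨
      ∃ k, x = .bd (.inr k) ∧ y' = glueInner O I h (.bd k) := by
  rcases x with (b | k) | ⟨c, i⟩ | ⟨j, i⟩ | l
  · have hp : (O.glue I h).Passes (.bd b) y' := hp
    cases hp
  · have hp : (O.glue I h).Passes (.jt (.inr k) false) y' := hp
    cases hp
    exact .inr ⟨k, rfl, rfl⟩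
  · have hp : (O.glue I h).Passes (.cr (.inl c) i) y' := hp
    cases hp
    exact .inl ⟨.cr c (i + 2), rfl, .crossing c i⟩
  · have hp : (O.glue I h).Passes (.jt (.inl (.inl j)) i) y' := hp
    cases hp
    exact .inl ⟨.jt j (!i), rfl, .joint j i⟩
  · have hp : (O.glue I h).Passes (.leg (.inl l)) y' := hp
    cases hp with
    | vertex _ l' hl =>
      rcases l' with l' | l'
      · exact .inl ⟨.leg l', rfl, .vertex _ _ (Sum.inl.inj hl)⟩
      · cases hl

theorem glue_passes_inner {x : I.Darts} {y' : (O.glue I h).Darts}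
    (hp : (O.glue I h).Passes (glueInner O I h x) y') :
    (∃ y, y' = glueInner O I h y ∧ I.Passes x y) ∨
      ∃ k, x = .bd k ∧ y' = glueOuter O I h (.bd (.inr k)) := by
  rcases x with k | ⟨c, i⟩ | ⟨j, i⟩ | l
  · have hp : (O.glue I h).Passes (.jt (.inr k) true) y' := hp
    cases hp
    exact .inr ⟨k, rfl, rfl⟩
  · have hp : (O.glue I h).Passes (.cr (.inr c) i) y' := hp
    cases hp
    exact .inl ⟨.cr c (i + 2), rfl, .crossing c i⟩
  · have hp : (O.glue I h).Passes (.jt (.inl (.inr j)) i) y' := hp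
    cases hp
    exact .inl ⟨.jt j (!i), rfl, .joint j i⟩
  · have hp : (O.glue I h).Passes (.leg (.inr l)) y' := hp
    cases hp with
    | vertex _ l' hl =>
      rcases l' with l' | l'
      · cases hl
      · exact .inl ⟨.leg l', rfl, .vertex _ _ (Sum.inr.inj hl)⟩

theorem passes_glueOuter {x y : O.Darts} (hp : O.Passes x y) :
    (O.glue I h).Passes (glueOuter O I h x) (glueOuter O I h y) := by
  cases hp with
  | crossing c i => exact .crossing (D := O.glue I h) (.inl c) i
  | joint j i => exact .joint (D := O.glue I h) (.inl (.inl j)) i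
  | vertex l l' hl => exact .vertex (D := O.glue I h) (.inl l) (.inl l') (congrArg Sum.inl hl)

theorem passes_glueInner {x y : I.Darts} (hp : I.Passes x y) :
    (O.glue I h).Passes (glueInner O I h x) (glueInner O I h y) := by
  cases hp with
  | crossing c i => exact .crossing (D := O.glue I h) (.inr c) i
  | joint j i => exact .joint (D := O.glue I h) (.inl (.inr j)) i
  | vertex l l' hl => exact .vertex (D := O.glue I h) (.inr l) (.inr l') (congrArg Sum.inr hl)

theorem passes_enter (k : K) : (O.glue I h).Passes (glueOuter O I h (.bd (.inr k)))
    (glueInner O I h (.bd k)) :=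
  .joint (D := O.glue I h) (.inr k) false

theorem passes_leave (k : K) : (O.glue I h).Passes (glueInner O I h (.bd k))
    (glueOuter O I h (.bd (.inr k))) :=
  .joint (D := O.glue I h) (.inr k) true

/-- Follow a walk in the inner diagram, and then a walk that leaves the inner diagram where the former
ended. -/
def appendInner {b : B} {k : K} (w : (O.glue I h).Walk b (glueOuter O I h (.bd (.inr k)))) :
    ∀ {x : I.Darts}, I.Walk k x → (O.glue I h).Walk b (glueInner O I h x)
  | _, .finish x hx => .go _ _ (by rw [glue_link_inner, hx]; exact passes_leave O I h k) w
  | _, .go x y hp u => .go _ (glueInner O I h y)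
      (by rw [glue_link_inner]; exact passes_glueInner O I h hp) (appendInner w u)

theorem appendInner_visits {b : B} {k : K}
    (w : (O.glue I h).Walk b (glueOuter O I h (.bd (.inr k)))) {x : I.Darts} (u : I.Walk k x) :
    (appendInner O I h w u).visits = u.visits + w.visits := by
  have hc : ∀ x, legCount (glueInner O I h x) = legCount x := by rintro (_ | _ | _ | _) <;> rfl
  induction u with
  | finish x hx => rw [appendInner, Walk.visits, Walk.visits, glue_link_inner, hx]; rfl
  | go x y hp u ih =>
    rw [appendInner, Walk.visits, Walk.visits, ih, glue_link_inner, hc, add_assoc]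

theorem arrivalWeight_glueOuter (φ : X → X → H) (col : (O.glue I h).Darts → X) (x : O.Darts) :
    (O.glue I h).arrivalWeight φ col (glueOuter O I h x) =
      O.arrivalWeight φ (col ∘ glueOuter O I h) x := by
  rcases x with (b | k) | ⟨c, i⟩ | ⟨j, i⟩ | l <;> rfl

theorem arrivalWeight_glueInner (φ : X → X → H) (col : (O.glue I h).Darts → X) (x : I.Darts) :
    (O.glue I h).arrivalWeight φ col (glueInner O I h x) =
      I.arrivalWeight φ (col ∘ glueInner O I h) x := by
  rcases x with k | ⟨c, i⟩ | ⟨j, i⟩ | l <;> rfl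

theorem appendInner_weight (φ : X → X → H) (col : (O.glue I h).Darts → X) {b : B} {k : K}
    (w : (O.glue I h).Walk b (glueOuter O I h (.bd (.inr k)))) {x : I.Darts} (u : I.Walk k x) :
    (appendInner O I h w u).weight φ col =
      u.weight φ (col ∘ glueInner O I h) * w.weight φ col := by
  induction u with
  | finish x hx =>
    rw [appendInner, Walk.weight, Walk.weight, glue_link_inner, hx, arrivalWeight_glueInner]; rfl
  | go x y hp u ih =>
    rw [appendInner, Walk.weight, Walk.weight, ih, glue_link_inner, arrivalWeight_glueInner,
      mul_assoc]

/-- The first steps of a walk that starts in the outer diagram: it finishes there, or makes a step there,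
or passes through the inner diagram. -/
theorem glueWalk_rec {b : B} {motive : ∀ x : O.Darts, (O.glue I h).Walk b (glueOuter O I h x) → Prop}
    (finish : ∀ x (_ : O.link x = .bd (.inl b)) hx, motive x (.finish _ hx))
    (step : ∀ x y (_ : O.Passes (O.link x) y) hp w, motive y w → motive x (.go _ _ hp w))
    (pass : ∀ x k k' (_ : O.link x = .bd (.inr k)) hp (u : I.Walk k' (.bd k)) w,
      motive (.bd (.inr k')) w → motive x (.go _ (glueInner O I h (.bd k)) hp
        (appendInner O I h w u)))
    (x : O.Darts) (w : (O.glue I h).Walk b (glueOuter O I h x)) : motive x w := by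
  -- Tails of the walk may start inside the disc, where `motive` says nothing. For these the
  -- induction carries a factorization instead: the walk ends outside, hence it first runs inside to
  -- some `k` and then continues outside with the motive already known.
  have key : ∀ e (w : (O.glue I h).Walk b e),
      (∀ x (hx : e = glueOuter O I h x), motive x (hx ▸ w)) ∧
      ∀ x (hx : e = glueInner O I h x), ∃ k, ∃ u : I.Walk k x,
        ∃ w' : (O.glue I h).Walk b (glueOuter O I h (.bd (.inr k))),
        (hx ▸ w : (O.glue I h).Walk b (glueInner O I h x)) = appendInner O I h w' u ∧
        motive _ w' := by
    intro e w
    induction w with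
    | finish e he =>
      constructor
      · rintro x rfl
        refine finish x ?_ he
        rw [glue_link_outer] at he
        exact glueOuter_injective O I h (he.trans rfl)
      · rintro x rfl
        rw [glue_link_inner] at he
        exact absurd he.symm (glueOuter_ne_glueInner O I h (.bd (.inl b)) _)
    | go e e' hp w ih =>
      constructor
      · rintro x rfl
        have hp' := hp
        rw [glue_link_outer] at hp'
        obtain ⟨y, rfl, hy⟩ | ⟨k, hk, rfl⟩ := glue_passes_outer O I h hp'
        · exact step x y hy hp w (ih.1 y rfl)
        · obtain ⟨k', u, w', hw, hm⟩ := ih.2 _ rfl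
          obtain rfl : w = appendInner O I h w' u := hw
          exact pass x k k' hk hp u w' hm
      · rintro x rfl
        have hp' := hp
        rw [glue_link_inner] at hp'
        obtain ⟨y, rfl, hy⟩ | ⟨k, hk, rfl⟩ := glue_passes_inner O I h hp'
        · obtain ⟨k', u, w', hw, hm⟩ := ih.2 _ rfl
          obtain rfl : w = appendInner O I h w' u := hw
          exact ⟨k', .go x y hy u, w', rfl, hm⟩
        · exact ⟨k, .finish x hk, w, rfl, ih.1 _ rfl⟩
  exact (key _ w).1 x rfl

/-- The darts of the outer diagram along which a walk leaves the nodes. -/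
def outerTrace {b : B} {e : (O.glue I h).Darts} (w : (O.glue I h).Walk b e) : List O.Darts :=
  w.darts.filterMap (glueElim O I h some fun _ => none)

theorem outerTrace_finish {b : B} (x : O.Darts)
    (hx : (O.glue I h).link (glueOuter O I h x) = .bd b) :
    outerTrace O I h (.finish _ hx) = [x] := by
  rw [outerTrace, Walk.darts, List.filterMap_cons, glueElim_outer]; rfl

theorem outerTrace_go {b : B} (x : O.Darts) (e : (O.glue I h).Darts)
    (hp : (O.glue I h).Passes ((O.glue I h).link (glueOuter O I h x)) e)
    (w : (O.glue I h).Walk b e) :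
    outerTrace O I h (.go _ _ hp w) = x :: outerTrace O I h w := by
  rw [outerTrace, Walk.darts, List.filterMap_cons, glueElim_outer]; rfl

theorem outerTrace_appendInner {b : B} {k : K}
    (w : (O.glue I h).Walk b (glueOuter O I h (.bd (.inr k)))) {x : I.Darts} (u : I.Walk k x) :
    outerTrace O I h (appendInner O I h w u) = outerTrace O I h w := by
  induction u with
  | finish x hx => rw [appendInner, outerTrace, Walk.darts, List.filterMap_cons, glueElim_inner]; rfl
  | go x y hp u ih =>
    rw [appendInner, outerTrace, Walk.darts, List.filterMap_cons, glueElim_inner]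
    exact ih

theorem outerTrace_eq_cons {b : B} {x : O.Darts} (w : (O.glue I h).Walk b (glueOuter O I h x)) :
    ∃ L, outerTrace O I h w = x :: L := by
  cases w with
  | finish _ hx => exact ⟨_, outerTrace_finish O I h x hx⟩
  | go _ e hp w => exact ⟨_, outerTrace_go O I h x e hp w⟩

/-- The trace shows where each passage through the disc begins and ends, and by `hI` these two
points determine the passage. Equality of traces is therefore a one-to-one correspondence of walks,
independent of the colorings. -/
theorem outerTrace_injective (hI : ∀ k k', Subsingleton (I.Walk k' (.bd k))) {b : B} (x : O.Darts)
    (w w' : (O.glue I h).Walk b (glueOuter O I h x))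
    (hw : outerTrace O I h w = outerTrace O I h w') : w = w' := by
  revert w'
  induction x, w using glueWalk_rec O I h with
  | finish x hx hx₁ =>
    intro w' hw
    cases w' with
    | finish => rfl
    | go _ e hp w' =>
      have hl : (O.glue I h).link (glueOuter O I h x) = .bd b := hx₁
      rw [hl] at hp
      cases hp
  | step x y hy hp w ih =>
    intro w' hw
    rw [outerTrace_go] at hw
    revert hw
    induction x, w' using glueWalk_rec O I h with
    | finish x hx hx₁ => rw [hx] at hy; cases hy
    | step x y' hy' hp' w' _ =>
      intro hw
      rw [outerTrace_go] at hw
      have hw := (List.cons.inj hw).2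
      -- The first entry of the remaining trace is the dart at which the remaining walk starts, so
      -- the next steps agree.
      obtain ⟨L, hL⟩ := outerTrace_eq_cons O I h w
      obtain ⟨L', hL'⟩ := outerTrace_eq_cons O I h w'
      obtain rfl : y = y' := by rw [hL, hL'] at hw; exact (List.cons.inj hw).1
      rw [ih w' hw]
    | pass x k k' hk hp' u w' _ => rw [hk] at hy; cases hy
  | pass x k k' hk hp u w ih =>
    intro w' hw
    rw [outerTrace_go, outerTrace_appendInner] at hw
    revert hw
    induction x, w' using glueWalk_rec O I h with
    | finish x hx hx₁ => rw [hx] at hk; cases hk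
    | step x y' hy' hp' w' _ => rw [hk] at hy'; cases hy'
    | pass x k₁ k₁' hk₁ hp' u₁ w' _ =>
      intro hw
      rw [outerTrace_go, outerTrace_appendInner] at hw
      have hw := (List.cons.inj hw).2
      obtain ⟨L, hL⟩ := outerTrace_eq_cons O I h w
      obtain ⟨L', hL'⟩ := outerTrace_eq_cons O I h w'
      have hk' : (Dart.bd (Sum.inr k') : O.Darts) = .bd (.inr k₁') := by
        rw [hL, hL'] at hw; exact (List.cons.inj hw).1
      obtain rfl : k' = k₁' := by simpa using hk'
      obtain rfl : k = k₁ := by rw [hk] at hk₁; simpa using hk₁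
      rw [ih w' hw, (hI k k').elim u u₁]

/-- Walks through `I` can be followed by walks through `I'`, with the same number of visits of vertices
and the same weights. -/
def Follows {I I' : Diagram K} (φ : X → X → H) (col : I.Darts → X) (col' : I'.Darts → X) : Prop :=
  ∀ k k' (u : I.Walk k' (.bd k)), ∃ u' : I'.Walk k' (.bd k),
    u.visits = u'.visits ∧ u.weight φ col = u'.weight φ col'

/-- Every passage through `I` is exchanged for one through `I'` with the same ends, visits and
weight. Since each local product is preserved at its own place in the walk, the global products
agree in a noncommutative group too. -/
theorem exists_glueWalk {I' : Diagram K} (h' : ∀ k, O.tail (.bd (.inr k)) = !I'.tail (.bd k))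
    {φ : X → X → H} {col : (O.glue I h).Darts → X} {col' : (O.glue I' h').Darts → X}
    (hO : col ∘ glueOuter O I h = col' ∘ glueOuter O I' h')
    (hI : Follows φ (col ∘ glueInner O I h) (col' ∘ glueInner O I' h')) {b : B} (x : O.Darts)
    (w : (O.glue I h).Walk b (glueOuter O I h x)) :
    ∃ w' : (O.glue I' h').Walk b (glueOuter O I' h' x),
      outerTrace O I h w = outerTrace O I' h' w' ∧ w.visits = w'.visits ∧
      w.weight φ col = w'.weight φ col' := by
  have hc : ∀ x, legCount (glueOuter O I h x) = legCount (glueOuter O I' h' x) := by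
    rintro ((_ | _) | _ | _ | _) <;> rfl
  induction x, w using glueWalk_rec O I h with
  | finish x hx hx₁ =>
    have hx' : (O.glue I' h').link (glueOuter O I' h' x) = .bd b := by
      rw [glue_link_outer, hx]; rfl
    exact ⟨.finish _ hx', by rw [outerTrace_finish, outerTrace_finish], rfl, rfl⟩
  | step x y hy hp w ih =>
    obtain ⟨w', h1, h2, h3⟩ := ih
    refine ⟨.go _ _ (by rw [glue_link_outer]; exact passes_glueOuter O I' h' hy) w', ?_, ?_, ?_⟩
    · rw [outerTrace_go, outerTrace_go, h1]
    · rw [Walk.visits, Walk.visits, h2, glue_link_outer, glue_link_outer, hc]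
    · rw [Walk.weight, Walk.weight, h3, glue_link_outer, glue_link_outer, arrivalWeight_glueOuter,
        arrivalWeight_glueOuter, hO]
  | pass x k k' hk hp u w ih =>
    obtain ⟨w', h1, h2, h3⟩ := ih
    obtain ⟨u', hu, hu'⟩ := hI k k' u
    refine ⟨.go _ _ (by rw [glue_link_outer, hk]; exact passes_enter O I' h' k)
      (appendInner O I' h' w' u'), ?_, ?_, ?_⟩
    · rw [outerTrace_go, outerTrace_go, outerTrace_appendInner, outerTrace_appendInner, h1]
    · rw [Walk.visits, Walk.visits, appendInner_visits, appendInner_visits, h2, hu,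
        glue_link_outer, glue_link_outer, hc]
    · rw [Walk.weight, Walk.weight, appendInner_weight, appendInner_weight, h3, hu',
        glue_link_outer, glue_link_outer, arrivalWeight_glueOuter, arrivalWeight_glueOuter, hO]

end GlueWalks

/-! ### Colorings of a glued diagram -/

section GlueColorings

variable [Quandle X] [Finite K] (O : Diagram (B ⊕ K)) (I : Diagram K)
  (h : ∀ k, O.tail (.bd (.inr k)) = !I.tail (.bd k))

theorem localColoring_glue_iff (col : (O.glue I h).Darts → X) :
    (O.glue I h).LocalColoring col ↔ O.LocalColoring (col ∘ glueOuter O I h) ∧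
      I.LocalColoring (col ∘ glueInner O I h) ∧
      ∀ k, col (glueOuter O I h (.bd (.inr k))) = col (glueInner O I h (.bd k)) := by
  constructor
  · intro hc
    refine ⟨⟨fun d => ?_, fun j i => hc.joint (.inl (.inl j)) i, fun c i => hc.overArc (.inl c) i,
      fun c i => hc.underArc (.inl c) i, fun l l' hl =>
        hc.vertexConstant (.inl l) (.inl l') (congrArg Sum.inl hl)⟩,
      ⟨fun d => ?_, fun j i => hc.joint (.inl (.inr j)) i, fun c i => hc.overArc (.inr c) i,
      fun c i => hc.underArc (.inr c) i, fun l l' hl =>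
        hc.vertexConstant (.inr l) (.inr l') (congrArg Sum.inr hl)⟩, fun k => ?_⟩
    · rw [Function.comp_apply, ← glue_link_outer]
      exact hc.segment _
    · rw [Function.comp_apply, ← glue_link_inner]
      exact hc.segment _
    · exact hc.joint (.inr k) true
  · rintro ⟨hO, hI, hk⟩
    refine ⟨fun d => ?_, ?_, ?_, ?_, ?_⟩
    · obtain ⟨x, rfl⟩ | ⟨x, rfl⟩ := glueDart_cases O I h d
      · rw [glue_link_outer]
        exact hO.segment x
      · rw [glue_link_inner]
        exact hI.segment x
    · rintro ((j | j) | k) i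
      · exact hO.joint j i
      · exact hI.joint j i
      · cases i
        · exact (hk k).symm
        · exact hk k
    · rintro (c | c) i hi
      · exact hO.overArc c i hi
      · exact hI.overArc c i hi
    · rintro (c | c) i hi
      · exact hO.underArc c i hi
      · exact hI.underArc c i hi
    · rintro (l | l) (l' | l') hl
      · exact hO.vertexConstant l l' (Sum.inl.inj hl)
      · cases hl
      · cases hl
      · exact hI.vertexConstant l l' (Sum.inr.inj hl)

theorem glue_excess_inl (v : O.Vertex) : (O.glue I h).excess (.inl v) = O.excess v := by
  have key : ∀ t, Nat.card {l : (O.glue I h).Leg // (O.glue I h).vtx l = .inl v ∧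
      (O.glue I h).tail (.leg l) = t} = Nat.card {l : O.Leg // O.vtx l = v ∧ O.tail (.leg l) = t} := by
    intro t
    refine (Nat.card_eq_of_bijective (fun l => ⟨.inl l.1, congrArg Sum.inl l.2.1, l.2.2⟩)
      ⟨fun l l' hl => ?_, ?_⟩).symm
    · exact Subtype.ext (Sum.inl.inj (congrArg Subtype.val hl))
    · rintro ⟨l | l, h1, h2⟩
      · exact ⟨⟨l, Sum.inl.inj h1, h2⟩, rfl⟩
      · cases h1
  simp only [excess, inDegree, outDegree]
  rw [key, key]

theorem glue_excess_inr (v : I.Vertex) : (O.glue I h).excess (.inr v) = I.excess v := by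
  have key : ∀ t, Nat.card {l : (O.glue I h).Leg // (O.glue I h).vtx l = .inr v ∧
      (O.glue I h).tail (.leg l) = t} = Nat.card {l : I.Leg // I.vtx l = v ∧ I.tail (.leg l) = t} := by
    intro t
    refine (Nat.card_eq_of_bijective (fun l => ⟨.inr l.1, congrArg Sum.inr l.2.1, l.2.2⟩)
      ⟨fun l l' hl => ?_, ?_⟩).symm
    · exact Subtype.ext (Sum.inr.inj (congrArg Subtype.val hl))
    · rintro ⟨l | l, h1, h2⟩
      · cases h1
      · exact ⟨⟨l, Sum.inr.inj h1, h2⟩, rfl⟩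
  simp only [excess, inDegree, outDegree]
  rw [key, key]

/-- The two pieces interact only through the common `C`; this is the purpose of replacing the vertex
relations. -/
theorem fixesColors_glue_iff (C : Set X) (col : (O.glue I h).Darts → X) :
    (O.glue I h).FixesColors C col ↔ O.FixesColors C (col ∘ glueOuter O I h) ∧
      I.FixesColors C (col ∘ glueInner O I h) := by
  constructor
  · intro hc
    refine ⟨⟨fun d => hc.mem _, fun l x hx => ?_⟩, ⟨fun d => hc.mem _, fun l x hx => ?_⟩⟩
    · rw [← O.glue_excess_inl I h]
      exact hc.fix (.inl l) x hx
    · rw [← O.glue_excess_inr I h]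
      exact hc.fix (.inr l) x hx
  · rintro ⟨hO, hI⟩
    refine ⟨fun d => ?_, ?_⟩
    · obtain ⟨x, rfl⟩ | ⟨x, rfl⟩ := glueDart_cases O I h d
      · exact hO.mem x
      · exact hI.mem x
    · rintro (l | l) x hx
      · exact (congrArg (fun n => (Rack.act' (col (.leg (.inl l))) ^ n) x)
          (O.glue_excess_inl I h _)).trans (hO.fix l x hx)
      · exact (congrArg (fun n => (Rack.act' (col (.leg (.inr l))) ^ n) x)
          (O.glue_excess_inr I h _)).trans (hI.fix l x hx)

end GlueColorings

/-! ### Pictures in a disc that may replace each other -/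

variable [Quandle X]

/-- `I` and `I'` have the same boundary colorings. -/
def SameBoundaryColorings (X : Type*) [Quandle X] (I I' : Diagram K) : Prop :=
  ∀ C : Set X, IsSubquandle C → ∀ col : I.Darts → X, I.LocalColoring col → I.FixesColors C col →
    ∃ col' : I'.Darts → X, I'.LocalColoring col' ∧ I'.FixesColors C col' ∧
      ∀ k, col (.bd k) = col' (.bd k)

/-- A coloring is determined by the colors of the boundary points. -/
def DeterminedByBoundary (X : Type*) [Quandle X] (I : Diagram K) : Prop :=
  ∀ col col' : I.Darts → X, I.LocalColoring col → I.LocalColoring col' →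
    (∀ k, col (.bd k) = col' (.bd k)) → col = col'

/-- Walks through `I` and `I'` are determined by the boundary points where they enter and leave, and
correspond to each other, with the same number of visits of vertices and the same weights. -/
structure WalksMatch {I I' : Diagram K} (φ : X → X → H) (col : I.Darts → X) (col' : I'.Darts → X) :
    Prop where
  left : ∀ k k', Subsingleton (I.Walk k' (.bd k))
  right : ∀ k k', Subsingleton (I'.Walk k' (.bd k))
  forward : Follows φ col col'
  backward : Follows φ col' col

/-- Diagrams in a disc that may replace each other. -/
structure Interchangeable (φ : X → X → H) (s : ℕ) (I I' : Diagram K) : Prop where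
  dvd_excess : (∀ v, (s : ℤ) ∣ I.excess v) ↔ ∀ v, (s : ℤ) ∣ I'.excess v
  forward : SameBoundaryColorings X I I'
  backward : SameBoundaryColorings X I' I
  left : DeterminedByBoundary X I
  right : DeterminedByBoundary X I'
  walks : (∀ v, (s : ℤ) ∣ I.excess v) → ∀ (col : I.Darts → X) (col' : I'.Darts → X),
    I.LocalColoring col → I'.LocalColoring col' → (∀ k, col (.bd k) = col' (.bd k)) →
    WalksMatch φ col col'

/-- The outer colors are kept and only the inside is recolored. The old `C` still works: it is
unchanged outside, and the new inner coloring was built within it. -/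
theorem exists_glueColoring [Finite K] {O : Diagram (B ⊕ K)} {I I' : Diagram K}
    (hs : SameBoundaryColorings X I I') (h : ∀ k, O.tail (.bd (.inr k)) = !I.tail (.bd k))
    (h' : ∀ k, O.tail (.bd (.inr k)) = !I'.tail (.bd k)) (c : (O.glue I h).VColoring X) :
    ∃ c' : (O.glue I' h').VColoring X, c.1 ∘ glueOuter O I h = c'.1 ∘ glueOuter O I' h' := by
  obtain ⟨hl, C, hC, hf⟩ := (isColoring_and_vertexConstant_iff _ c.1).1 c.2
  obtain ⟨hO, hI, hk⟩ := (localColoring_glue_iff O I h c.1).1 hl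
  obtain ⟨hOf, hIf⟩ := (fixesColors_glue_iff O I h C c.1).1 hf
  obtain ⟨col', hl', hf', hb⟩ := hs C hC _ hI hIf
  have e1 : glueElim O I' h' (c.1 ∘ glueOuter O I h) col' ∘ glueOuter O I' h' =
      c.1 ∘ glueOuter O I h := funext fun x => glueElim_outer _ _ _ _ _ _
  have e2 : glueElim O I' h' (c.1 ∘ glueOuter O I h) col' ∘ glueInner O I' h' = col' :=
    funext fun x => glueElim_inner _ _ _ _ _ _
  refine ⟨⟨glueElim O I' h' (c.1 ∘ glueOuter O I h) col',
    (isColoring_and_vertexConstant_iff _ _).2 ⟨(localColoring_glue_iff O I' h' _).2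
      ⟨e1.symm ▸ hO, e2.symm ▸ hl', fun k => ?_⟩, C, hC,
      (fixesColors_glue_iff O I' h' C _).2 ⟨e1.symm ▸ hOf, e2.symm ▸ hf'⟩⟩⟩, e1.symm⟩
  rw [glueElim_outer, glueElim_inner, ← hb]
  exact hk k

theorem glueColoring_ext [Finite K] {O : Diagram (B ⊕ K)} {I : Diagram K} (hd : DeterminedByBoundary X I)
    (h : ∀ k, O.tail (.bd (.inr k)) = !I.tail (.bd k)) (c c' : (O.glue I h).VColoring X)
    (hc : c.1 ∘ glueOuter O I h = c'.1 ∘ glueOuter O I h) : c = c' := by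
  obtain ⟨-, hI, hk⟩ := (localColoring_glue_iff O I h c.1).1
    ((isColoring_and_vertexConstant_iff _ c.1).1 c.2).1
  obtain ⟨-, hI', hk'⟩ := (localColoring_glue_iff O I h c'.1).1
    ((isColoring_and_vertexConstant_iff _ c'.1).1 c'.2).1
  have := hd _ _ hI hI' fun k =>
    (hk k).symm.trans ((congrFun hc (.bd (.inr k))).trans (hk' k))
  refine Subtype.ext (funext fun e => ?_)
  obtain ⟨x, rfl⟩ | ⟨x, rfl⟩ := glueDart_cases O I h e
  · exact congrFun hc x
  · exact congrFun this x

/-- Walks correspond if they have the same outer trace, colorings if they agree outside the disc.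
Boundary determination makes the second relation one-to-one, and the matching of inner walks gives
the weights. -/
theorem Interchangeable.psi_eq [Finite K] {φ : X → X → H} {s : ℕ} {O : Diagram (B ⊕ K)}
    {I I' : Diagram K} (hI : Interchangeable φ s I I')
    (h : ∀ k, O.tail (.bd (.inr k)) = !I.tail (.bd k))
    (h' : ∀ k, O.tail (.bd (.inr k)) = !I'.tail (.bd k))
    (hs : ∀ v, (s : ℤ) ∣ (O.glue I h).excess v) (b b' : B) (n : ℕ) (q : X) :
    (O.glue I h).psi φ b b' n q = (O.glue I' h').psi φ b b' n q := by
  refine psi_eq_of_correspondence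
    (fun w w' => outerTrace O I h w = outerTrace O I' h' w')
    (fun c c' => c.1 ∘ glueOuter O I h = c'.1 ∘ glueOuter O I' h')
    ⟨fun c => exists_glueColoring hI.forward h h' c, fun c' => ?_⟩ ⟨?_, ?_⟩ ?_ ?_ n q
  · obtain ⟨c, hc⟩ := exists_glueColoring hI.backward h' h c'
    exact ⟨c, hc.symm⟩
  · exact fun c₁ c₂ c' h1 h2 => glueColoring_ext hI.left h c₁ c₂ (h1.trans h2.symm)
  · exact fun c c₁ c₂ h1 h2 => glueColoring_ext hI.right h' c₁ c₂ (h1.symm.trans h2)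
  · exact fun c c' hc => congrFun hc (.bd (.inl b))
  · intro c c' hc
    obtain ⟨-, hIc, hk⟩ := (localColoring_glue_iff O I h c.1).1
      ((isColoring_and_vertexConstant_iff _ c.1).1 c.2).1
    obtain ⟨-, hIc', hk'⟩ := (localColoring_glue_iff O I' h' c'.1).1
      ((isColoring_and_vertexConstant_iff _ c'.1).1 c'.2).1
    -- The divisibility at the vertices inside the disc is available to the comparison of the local
    -- weights.
    have hm := hI.walks (fun v => O.glue_excess_inr I h v ▸ hs (.inr v)) _ _ hIc hIc'
      fun k => (hk k).symm.trans ((congrFun hc (.bd (.inr k))).trans (hk' k))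
    refine ⟨⟨fun w₁ w₂ w' h1 h2 => ?_, fun w w₁ w₂ h1 h2 => ?_⟩, fun w => ?_, fun w' => ?_⟩
    · exact outerTrace_injective O I h hm.left (.bd (.inl b)) w₁ w₂ (h1.trans h2.symm)
    · exact outerTrace_injective O I' h' hm.right (.bd (.inl b)) w₁ w₂ (h1.symm.trans h2)
    · exact exists_glueWalk O I h h' hc hm.forward (.bd (.inl b)) w
    · obtain ⟨w, h1, h2, h3⟩ := exists_glueWalk O I' h' h hc.symm hm.backward (.bd (.inl b)) w'
      exact ⟨w, h1.symm, h2.symm, h3.symm⟩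

/-- The divisibility must survive each move, since later moves in a sequence need it again. -/
theorem Interchangeable.dvd_excess_glue_iff [Finite K] {φ : X → X → H} {s : ℕ}
    {O : Diagram (B ⊕ K)} {I I' : Diagram K} (hI : Interchangeable φ s I I')
    (h : ∀ k, O.tail (.bd (.inr k)) = !I.tail (.bd k))
    (h' : ∀ k, O.tail (.bd (.inr k)) = !I'.tail (.bd k)) :
    (∀ v, (s : ℤ) ∣ (O.glue I h).excess v) ↔ ∀ v, (s : ℤ) ∣ (O.glue I' h').excess v := by
  have key : ∀ (I : Diagram K) (h : ∀ k, O.tail (.bd (.inr k)) = !I.tail (.bd k)),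
      (∀ v, (s : ℤ) ∣ (O.glue I h).excess v) ↔
        (∀ v, (s : ℤ) ∣ O.excess v) ∧ ∀ v, (s : ℤ) ∣ I.excess v := by
    intro I h
    constructor
    · intro hv
      exact ⟨fun v => O.glue_excess_inl I h v ▸ hv (.inl v),
        fun v => O.glue_excess_inr I h v ▸ hv (.inr v)⟩
    · rintro ⟨h1, h2⟩ (v | v)
      · exact (O.glue_excess_inl I h v).symm ▸ h1 v
      · exact (O.glue_excess_inr I h v).symm ▸ h2 v
  rw [key I h, key I' h', hI.dvd_excess]

end Diagram

end GraphTangle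

namespace GraphTangle

namespace Diagram

variable {K : Type} {X H : Type*} [Quandle X] [Group H]

/-! ### Strands in a picture -/

section Runs

variable {D : Diagram K}

/-- The strand that leaves a node along the dart `d` ends at the boundary point `k`, meeting only
crossings, and collects the weight `g`. -/
inductive Run (D : Diagram K) (φ : X → X → H) (col : D.Darts → X) : D.Darts → K → H → Prop
  | arrive {d k} (h : D.link d = .bd k) : Run D φ col d k 1
  | cross {d c i k g} (h : D.link d = .cr c i) (r : Run D φ col (.cr c (i + 2)) k g) :
      Run D φ col d k (D.arrivalWeight φ col (.cr c i) * g)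

/-- The strand that leaves a node along the dart `d` ends at the leg `l`, meeting only crossings, and
collects the weight `g`. -/
inductive RunLeg (D : Diagram K) (φ : X → X → H) (col : D.Darts → X) : D.Darts → D.Leg → H → Prop
  | arrive {d l} (h : D.link d = .leg l) : RunLeg D φ col d l 1
  | cross {d c i l g} (h : D.link d = .cr c i) (r : RunLeg D φ col (.cr c (i + 2)) l g) :
      RunLeg D φ col d l (D.arrivalWeight φ col (.cr c i) * g)

variable {φ : X → X → H} {col : D.Darts → X}

theorem Walk.exists_of_link_cr {d : D.Darts} {c : D.Crossing} {i : Fin 4} (h : D.link d = .cr c i)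
    {k : K} (w : D.Walk k d) : ∃ (hp : D.Passes (D.link d) (.cr c (i + 2)))
      (w' : D.Walk k (.cr c (i + 2))), w = .go d _ hp w' := by
  cases w with
  | finish _ hd => rw [h] at hd; cases hd
  | go _ d' hp w =>
    obtain rfl : d' = .cr c (i + 2) := by rw [h] at hp; cases hp; rfl
    exact ⟨hp, w, rfl⟩

theorem Walk.exists_of_link_leg {d : D.Darts} {l : D.Leg} (h : D.link d = .leg l) {k : K}
    (w : D.Walk k d) : ∃ (l' : D.Leg) (_ : D.vtx l = D.vtx l') (hp : D.Passes (D.link d) (.leg l'))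
      (w' : D.Walk k (.leg l')), w = .go d _ hp w' := by
  cases w with
  | finish _ hd => rw [h] at hd; cases hd
  | go _ d' hp w =>
    obtain ⟨l', hl, rfl⟩ : ∃ l', D.vtx l = D.vtx l' ∧ d' = .leg l' := by
      rw [h] at hp
      cases hp with
      | vertex _ l' hl => exact ⟨l', hl, rfl⟩
    exact ⟨l', hl, hp, w, rfl⟩

-- Between crossings a walk has no choice, so that a strand without vertices determines its
-- endpoint, its weight and the absence of vertex visits.
omit [Quandle X] in
theorem Run.walk_eq {d : D.Darts} {k : K} {g : H} (r : Run D φ col d k g) {k' : K}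
    (w : D.Walk k' d) : k' = k ∧ w.visits = 0 ∧ w.weight φ col = g := by
  induction r with
  | arrive h =>
    cases w with
    | finish _ hd => rw [h] at hd; cases hd; exact ⟨rfl, rfl, rfl⟩
    | go _ d' hp w => rw [h] at hp; cases hp
  | cross h r ih =>
    obtain ⟨hp, w', rfl⟩ := w.exists_of_link_cr h
    obtain ⟨h1, h2, h3⟩ := ih w'
    exact ⟨h1, by rw [Walk.visits, h2, h]; rfl, by rw [Walk.weight, h3, h]⟩

omit [Quandle X] in
theorem Run.exists_walk {d : D.Darts} {k : K} {g : H} (r : Run D φ col d k g) :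
    Nonempty (D.Walk k d) := by
  induction r with
  | arrive h => exact ⟨.finish _ h⟩
  | cross h r ih =>
    obtain ⟨w⟩ := ih
    exact ⟨.go _ _ (by rw [h]; exact .crossing _ _) w⟩

omit [Quandle X] in
theorem Run.subsingleton {d : D.Darts} {k : K} {g : H} (r : Run D φ col d k g) (k' : K) :
    Subsingleton (D.Walk k' d) := by
  induction r with
  | arrive h =>
    refine ⟨fun w w' => ?_⟩
    cases w with
    | go _ d' hp w => rw [h] at hp; cases hp
    | finish =>
      cases w' with
      | go _ d' hp w => rw [h] at hp; cases hp
      | finish => rfl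
  | cross h r ih =>
    refine ⟨fun w w' => ?_⟩
    obtain ⟨_, w, rfl⟩ := w.exists_of_link_cr h
    obtain ⟨_, w', rfl⟩ := w'.exists_of_link_cr h
    rw [ih.elim w w']

/-- List reversal with an accumulator: `r₀` is the part already traversed, read backwards from the
far end of the current segment, and each crossing of `r` is transferred to it with inverted weight.
-/
theorem Run.reverse_aux (hcol : D.LocalColoring col) {d : D.Darts} {k : K} {g : H}
    (r : Run D φ col d k g) {k₀ : K} {g₀ : H} (r₀ : Run D φ col (D.link d) k₀ g₀) :
    Run D φ col (.bd k) k₀ (g⁻¹ * g₀) := by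
  induction r generalizing g₀ with
  | arrive h => rw [h] at r₀; simpa using r₀
  | @cross d c i k g h r ih =>
    rw [h] at r₀
    have e4 : i + 2 + 2 = i := (add_assoc i 2 2).trans (add_zero i)
    -- Backwards the crossing is entered at `i + 2` and left at `i + 2 + 2 = i`.
    have r₁ := Run.cross (d := D.link (.cr c (i + 2))) (D.link_link _) (by rw [e4]; exact r₀)
    have := ih r₁
    rwa [hcol.arrivalWeight_add_two, ← mul_assoc, ← mul_inv_rev] at this

theorem Run.reverse (hcol : D.LocalColoring col) {k₀ k : K} {g : H}
    (r : Run D φ col (.bd k₀) k g) : Run D φ col (.bd k) k₀ g⁻¹ := by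
  simpa using r.reverse_aux hcol (.arrive (D.link_link _))

/-- The walks of `I` and `I'` from `k` to `k'` match. -/
structure MatchAt {I I' : Diagram K} (φ : X → X → H) (col : I.Darts → X) (col' : I'.Darts → X)
    (k k' : K) : Prop where
  left : Subsingleton (I.Walk k' (.bd k))
  right : Subsingleton (I'.Walk k' (.bd k))
  forward : ∀ w : I.Walk k' (.bd k), ∃ w' : I'.Walk k' (.bd k),
    w.visits = w'.visits ∧ w.weight φ col = w'.weight φ col'
  backward : ∀ w' : I'.Walk k' (.bd k), ∃ w : I.Walk k' (.bd k),
    w'.visits = w.visits ∧ w'.weight φ col' = w.weight φ col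

omit [Quandle X] in
theorem WalksMatch.of_matchAt {I I' : Diagram K} {φ : X → X → H} {col : I.Darts → X}
    {col' : I'.Darts → X} (h : ∀ k k', MatchAt φ col col' k k') : WalksMatch φ col col' :=
  ⟨fun k k' => (h k k').left, fun k k' => (h k k').right, fun k k' => (h k k').forward,
    fun k k' => (h k k').backward⟩

variable {I I' : Diagram K} {col : I.Darts → X} {col' : I'.Darts → X}

omit [Quandle X] in
theorem MatchAt.of_run {k κ : K} {g : H} (r : Run I φ col (.bd k) κ g)
    (r' : Run I' φ col' (.bd k) κ g) (k' : K) : MatchAt φ col col' k k' := by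
  refine ⟨r.subsingleton k', r'.subsingleton k', fun w => ?_, fun w' => ?_⟩
  · obtain ⟨rfl, h2, h3⟩ := r.walk_eq w
    obtain ⟨w'⟩ := r'.exists_walk
    obtain ⟨-, h2', h3'⟩ := r'.walk_eq w'
    exact ⟨w', h2.trans h2'.symm, h3.trans h3'.symm⟩
  · obtain ⟨rfl, h2, h3⟩ := r'.walk_eq w'
    obtain ⟨w⟩ := r.exists_walk
    obtain ⟨-, h2', h3'⟩ := r.walk_eq w
    exact ⟨w, h2.trans h2'.symm, h3.trans h3'.symm⟩

/-- All legs are at the same vertex, and are joined to the boundary points `e m`. -/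
structure Spokes (I : Diagram K) (φ : X → X → H) (col : I.Darts → X) {M : Type} (e : M → K)
    (leg : M → I.Leg) (g : M → H) : Prop where
  injective : Function.Injective e
  surjective : Function.Surjective leg
  vtx_eq : ∀ l l', I.vtx l = I.vtx l'
  run : ∀ m, Run I φ col (.leg (leg m)) (e m) (g m)

section Spokes

variable {M : Type} {e : M → K} {leg : M → I.Leg} {leg' : M → I'.Leg} {g g' : M → H}

-- Every leg leads by a spoke straight to the boundary. A walk that reaches the vertex therefore
-- visits it once, and its only freedom is the choice of the spoke.
omit [Quandle X] in
theorem RunLeg.walk_eq (hs : Spokes I φ col e leg g) {d : I.Darts} {l : I.Leg} {g₀ : H}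
    (r : RunLeg I φ col d l g₀) {k' : K} (w : I.Walk k' d) :
    ∃ m, k' = e m ∧ w.visits = 1 ∧ w.weight φ col = g₀ * g m := by
  induction r with
  | arrive h =>
    obtain ⟨l', hl, hp, w', rfl⟩ := w.exists_of_link_leg h
    obtain ⟨m, rfl⟩ := hs.surjective l'
    obtain ⟨h1, h2, h3⟩ := (hs.run m).walk_eq w'
    exact ⟨m, h1, by rw [Walk.visits, h2, h]; rfl, by rw [Walk.weight, h3, h]; rfl⟩
  | cross h r ih =>
    obtain ⟨hp, w', rfl⟩ := w.exists_of_link_cr h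
    obtain ⟨m, h1, h2, h3⟩ := ih w'
    exact ⟨m, h1, by rw [Walk.visits, h2, h]; rfl, by rw [Walk.weight, h3, h, mul_assoc]⟩

omit [Quandle X] in
theorem RunLeg.exists_walk (hs : Spokes I φ col e leg g) {d : I.Darts} {l : I.Leg} {g₀ : H}
    (r : RunLeg I φ col d l g₀) (m : M) : Nonempty (I.Walk (e m) d) := by
  induction r with
  | @arrive d l h =>
    obtain ⟨w⟩ := (hs.run m).exists_walk
    exact ⟨.go _ _ (by rw [h]; exact .vertex _ _ (hs.vtx_eq _ _)) w⟩
  | cross h r ih =>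
    obtain ⟨w⟩ := ih
    exact ⟨.go _ _ (by rw [h]; exact .crossing _ _) w⟩

omit [Quandle X] in
theorem RunLeg.subsingleton (hs : Spokes I φ col e leg g) {d : I.Darts} {l : I.Leg} {g₀ : H}
    (r : RunLeg I φ col d l g₀) (k' : K) : Subsingleton (I.Walk k' d) := by
  induction r with
  | arrive h =>
    refine ⟨fun w w' => ?_⟩
    obtain ⟨l₁, _, _, w, rfl⟩ := w.exists_of_link_leg h
    obtain ⟨l₂, _, _, w', rfl⟩ := w'.exists_of_link_leg h
    obtain ⟨m₁, rfl⟩ := hs.surjective l₁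
    obtain ⟨m₂, rfl⟩ := hs.surjective l₂
    obtain rfl := hs.injective
      (((hs.run m₁).walk_eq w).1.symm.trans ((hs.run m₂).walk_eq w').1)
    rw [((hs.run m₁).subsingleton k').elim w w']
  | cross h r ih =>
    refine ⟨fun w w' => ?_⟩
    obtain ⟨_, w, rfl⟩ := w.exists_of_link_cr h
    obtain ⟨_, w', rfl⟩ := w'.exists_of_link_cr h
    rw [ih.elim w w']

-- The factors for reaching the vertex and for leaving it may both differ between the pictures; only
-- their product has to agree, for every exit. This flexibility is needed when a strand is moved
-- over a vertex.
omit [Quandle X] in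
theorem MatchAt.of_runLeg (hs : Spokes I φ col e leg g) (hs' : Spokes I' φ col' e leg' g')
    {k : K} {l : I.Leg} {l' : I'.Leg} {g₀ g₀' : H} (r : RunLeg I φ col (.bd k) l g₀)
    (r' : RunLeg I' φ col' (.bd k) l' g₀') (hg : ∀ m, g₀ * g m = g₀' * g' m) (k' : K) :
    MatchAt φ col col' k k' := by
  refine ⟨r.subsingleton hs k', r'.subsingleton hs' k', fun w => ?_, fun w' => ?_⟩
  · obtain ⟨m, rfl, h2, h3⟩ := r.walk_eq hs w
    obtain ⟨w'⟩ := r'.exists_walk hs' m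
    obtain ⟨m', hm, h2', h3'⟩ := r'.walk_eq hs' w'
    obtain rfl := hs.injective hm
    exact ⟨w', h2.trans h2'.symm, h3.trans ((hg m).trans h3'.symm)⟩
  · obtain ⟨m, rfl, h2, h3⟩ := r'.walk_eq hs' w'
    obtain ⟨w⟩ := r.exists_walk hs m
    obtain ⟨m', hm, h2', h3'⟩ := r.walk_eq hs w
    obtain rfl := hs.injective hm
    exact ⟨w, h2.trans h2'.symm, h3.trans ((hg m).symm.trans h3'.symm)⟩

end Spokes

end Runs

/-! ### Constant colorings -/

theorem localColoring_const (D : Diagram K) (x : X) : D.LocalColoring fun _ => x :=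
  ⟨fun _ => rfl, fun _ _ => rfl, fun _ _ _ => rfl, fun _ _ _ => by simp, fun _ _ _ => rfl⟩

theorem IsQuandleTwoCocycle.arrivalWeight_const {φ : X → X → H} (hφ : IsQuandleTwoCocycle φ)
    (D : Diagram K) (x : X) (d : D.Darts) : D.arrivalWeight φ (fun _ => x) d = 1 := by
  rcases d with b | ⟨c, i⟩ | ⟨j, i⟩ | l
  · rfl
  · cases hi : D.isOver c i
    · rw [(D.localColoring_const x).arrivalWeight_under φ c i hi, hφ.signedWeight_self]
    · rw [D.arrivalWeight_over _ _ _ _ hi]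
  · rfl
  · rfl

theorem FixesColors.of_mem (D : Diagram K) [IsEmpty D.Leg] {C : Set X} {col : D.Darts → X}
    (h : ∀ d, col d ∈ C) : D.FixesColors C col :=
  ⟨h, fun l => isEmptyElim l⟩

/-! ### The first move -/

theorem strand_eq_const {f : Bool} {col : (strand f).Darts → X} (h : (strand f).LocalColoring col) :
    col = fun _ => col (.bd false) := by
  funext d
  rcases d with (_ | _) | ⟨⟨⟩, _⟩ | ⟨⟨⟩, _⟩ | ⟨⟨⟩⟩
  · rfl
  · exact h.segment (.bd false)

/-- The loop of the curl joins two neighbouring darts of the crossing. Two neighbouring colors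
determine all four, and the constant coloring is one solution by idempotence. -/
theorem curl_eq_const {f left o : Bool} {col : (curl f left o).Darts → X}
    (h : (curl f left o).LocalColoring col) : col = fun _ => col (.bd false) := by
  have h0 : col (.cr () 0) = col (.bd false) := h.segment (.bd false)
  have key : ∃ x, ∀ i, col (.cr () i) = x := by
    cases left
    · have h2 : col (.cr () 3) = col (.cr () 2) := h.segment (.cr () 2)
      exact ⟨_, fun i => h.eq_at_crossing (localColoring_const _ (col (.cr () 2))) () 2 rfl h2 i⟩
    · have h2 : col (.cr () 2) = col (.cr () 1) := h.segment (.cr () 1)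
      exact ⟨_, fun i => h.eq_at_crossing (localColoring_const _ (col (.cr () 1))) () 1 rfl h2 i⟩
  obtain ⟨x, hx⟩ := key
  have hx0 : x = col (.bd false) := (hx 0).symm.trans h0
  funext d
  rcases d with (_ | _) | ⟨⟨⟩, i⟩ | ⟨⟨⟩, _⟩ | ⟨⟨⟩⟩
  · rfl
  · rw [← hx0, ← h.segment (.bd true)]
    exact hx _
  · rw [hx, hx0]

theorem interchangeable_strand_curl {φ : X → X → H} (hφ : IsQuandleTwoCocycle φ) (s : ℕ)
    (f left o : Bool) : Interchangeable φ s (strand f) (curl f left o) := by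
  have : IsEmpty (strand f).Leg := inferInstanceAs (IsEmpty Empty)
  have : IsEmpty (curl f left o).Leg := inferInstanceAs (IsEmpty Empty)
  refine ⟨⟨fun _ v => v.elim, fun _ v => v.elim⟩, ?_, ?_, ?_, ?_, ?_⟩
  · intro C _ col h hf
    refine ⟨fun _ => col (.bd false), localColoring_const _ _, .of_mem _ fun d => hf.mem _,
      fun k => ?_⟩
    rw [strand_eq_const h]
  · intro C _ col h hf
    refine ⟨fun _ => col (.bd false), localColoring_const _ _, .of_mem _ fun d => hf.mem _,
      fun k => ?_⟩
    rw [curl_eq_const h]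
  · intro col col' h h' hb
    rw [strand_eq_const h, strand_eq_const h', hb]
  · intro col col' h h' hb
    rw [curl_eq_const h, curl_eq_const h', hb]
  · intro _ col col' h h' hb
    -- The color is constant, so the crossing weight is a power of `φ x x = 1`.
    have hw : ∀ d, (curl f left o).arrivalWeight φ col' d = 1 := by
      rw [curl_eq_const h']
      exact IsQuandleTwoCocycle.arrivalWeight_const hφ _ _
    have r : Run (strand f) φ col (.bd false) true 1 := .arrive rfl
    have r' : Run (curl f left o) φ col' (.bd false) true 1 := by
      cases left
      · have := Run.cross (D := curl f false o) (φ := φ) (col := col') (d := .bd false) (c := ())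
          (i := 0) rfl (.cross (c := ()) (i := 3) rfl (.arrive (k := true) rfl))
        simpa only [hw, mul_one] using this
      · have := Run.cross (D := curl f true o) (φ := φ) (col := col') (d := .bd false) (c := ())
          (i := 0) rfl (.cross (c := ()) (i := 1) rfl (.arrive (k := true) rfl))
        simpa only [hw, mul_one] using this
    refine .of_matchAt fun k => ?_
    cases k
    · exact .of_run r r'
    · exact .of_run (r.reverse h) (r'.reverse h')

/-! ### The second move -/

/-- The coloring of `bigon f g o` with colors `p` and `q` at the boundary points `0` and `3`. -/
def bigonColoring (f g o : Bool) (p q : X) : (bigon f g o).Darts → X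
  | .bd b => ![p, p, q, q] b
  | .cr false i => if o then ![p, signedAct (!f) p q, p, q] i else ![p, q, signedAct g q p, q] i
  | .cr true i => if o then ![signedAct (!f) p q, p, q, p] i else ![q, p, q, signedAct g q p] i

theorem localColoring_bigonColoring (f g o : Bool) (p q : X) :
    (bigon f g o).LocalColoring (bigonColoring f g o p q) := by
  refine .mk_of_zero ?_ (fun j => j.elim) ?_ ?_ (fun l => l.elim)
  · rintro (b | ⟨c, i⟩ | ⟨⟨⟩, _⟩ | ⟨⟨⟩⟩)
    · fin_cases b <;> cases o <;> rfl
    · cases c <;> fin_cases i <;> cases o <;> rfl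
  · rintro (_ | _) ho
    · obtain rfl : o = true := ho
      exact ⟨rfl, (signedAct_signedAct_not f p q).symm⟩
    · obtain rfl : o = false := by have : (!o) = true := ho; simpa using this
      exact ⟨rfl, rfl⟩
  · rintro (_ | _) ho
    · obtain rfl : o = false := ho
      exact ⟨rfl, rfl⟩
    · obtain rfl : o = true := by have : (!o) = false := ho; simpa using this
      exact ⟨rfl, (signedAct_signedAct_not f p q).symm⟩

/-- The two lower boundary points give the neighbouring darts `3` and `0` of the lower crossing, and
its upper darts give those of the upper one. -/
theorem bigon_eq_of_eq {f g o : Bool} {col col' : (bigon f g o).Darts → X}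
    (h : (bigon f g o).LocalColoring col) (h' : (bigon f g o).LocalColoring col')
    (h0 : col (.bd 0) = col' (.bd 0)) (h3 : col (.bd 3) = col' (.bd 3)) : col = col' := by
  have seg : ∀ d, col ((bigon f g o).link d) = col' ((bigon f g o).link d) → col d = col' d :=
    fun d hd => by rwa [h.segment, h'.segment] at hd
  have c1 := h.eq_at_crossing h' false 3 (seg (.cr false 3) h3) (seg (.cr false 0) h0)
  have c2 := h.eq_at_crossing h' true 3 (seg (.cr true 3) (c1 2)) (seg (.cr true 0) (c1 1))
  funext d
  rcases d with b | ⟨c, i⟩ | ⟨⟨⟩, _⟩ | ⟨⟨⟩⟩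
  · fin_cases b
    · exact h0
    · exact seg (.bd 1) (c2 1)
    · exact seg (.bd 2) (c2 2)
    · exact h3
  · cases c
    · exact c1 i
    · exact c2 i

theorem eq_bigonColoring {f g o : Bool} {col : (bigon f g o).Darts → X}
    (h : (bigon f g o).LocalColoring col) :
    col = bigonColoring f g o (col (.bd 0)) (col (.bd 3)) :=
  bigon_eq_of_eq h (localColoring_bigonColoring _ _ _ _ _) rfl rfl

theorem interchangeable_parallel_bigon (φ : X → X → H) (s : ℕ) (f g o : Bool) :
    Interchangeable φ s (parallel f g) (bigon f g o) := by
  have : IsEmpty (parallel f g).Leg := inferInstanceAs (IsEmpty Empty)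
  have : IsEmpty (bigon f g o).Leg := inferInstanceAs (IsEmpty Empty)
  refine ⟨⟨fun _ v => v.elim, fun _ v => v.elim⟩, ?_, ?_, ?_, ?_, ?_⟩
  · intro C hC col h hf
    have h0 := hf.mem (.bd 0)
    have h3 := hf.mem (.bd 3)
    refine ⟨bigonColoring f g o (col (.bd 0)) (col (.bd 3)), localColoring_bigonColoring _ _ _ _ _,
      .of_mem _ fun d => ?_, fun k => ?_⟩
    · have h1 := hC (!f) _ h0 _ h3
      have h2 := hC g _ h3 _ h0
      rcases d with b | ⟨c, i⟩ | ⟨⟨⟩, _⟩ | ⟨⟨⟩⟩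
      · fin_cases b <;> assumption
      · cases c <;> fin_cases i <;> cases o <;> assumption
    · fin_cases k
      · rfl
      · exact h.segment (.bd 0)
      · exact h.segment (.bd 3)
      · rfl
  · intro C _ col h hf
    refine ⟨fun | .bd b => col (.bd b), ⟨?_, fun j => j.elim, fun c => c.elim, fun c => c.elim,
      fun l => l.elim⟩, .of_mem _ ?_, fun k => rfl⟩
    · rintro (b | ⟨⟨⟩, _⟩ | ⟨⟨⟩, _⟩ | ⟨⟨⟩⟩)
      rw [eq_bigonColoring h]
      fin_cases b <;> rfl
    · rintro (b | ⟨⟨⟩, _⟩ | ⟨⟨⟩, _⟩ | ⟨⟨⟩⟩)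
      exact hf.mem _
  · intro col col' h h' hb
    funext d
    rcases d with b | ⟨⟨⟩, _⟩ | ⟨⟨⟩, _⟩ | ⟨⟨⟩⟩
    exact hb b
  · intro col col' h h' hb
    exact bigon_eq_of_eq h h' (hb 0) (hb 3)
  · intro _ col col' h h' hb
    have r0 : Run (parallel f g) φ col (.bd 0) 1 1 := .arrive rfl
    have r3 : Run (parallel f g) φ col (.bd 3) 2 1 := .arrive rfl
    -- A strand below the other one passes under it twice in opposite directions, so its two factors
    -- are inverse; a strand above collects nothing.
    have w0 : (bigon f g o).arrivalWeight φ col' (.cr false 0) *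
        ((bigon f g o).arrivalWeight φ col' (.cr true 3) * 1) = 1 := by
      cases o
      · rw [h'.arrivalWeight_under φ false 0 rfl, h'.arrivalWeight_under φ true 3 rfl,
          eq_bigonColoring h', mul_one]
        exact (congrArg _ (signedWeight_not φ g _ _)).trans (mul_inv_cancel _)
      · rw [arrivalWeight_over (bigon f g true) φ col' false 0 rfl,
          arrivalWeight_over (bigon f g true) φ col' true 3 rfl, mul_one, mul_one]
    have w3 : (bigon f g o).arrivalWeight φ col' (.cr false 3) *
        ((bigon f g o).arrivalWeight φ col' (.cr true 0) * 1) = 1 := by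
      cases o
      · rw [arrivalWeight_over (bigon f g false) φ col' false 3 rfl,
          arrivalWeight_over (bigon f g false) φ col' true 0 rfl, mul_one, mul_one]
      · rw [h'.arrivalWeight_under φ false 3 rfl, h'.arrivalWeight_under φ true 0 rfl,
          eq_bigonColoring h', mul_one]
        have := signedWeight_not φ (!f) (col' (.bd 0)) (col' (.bd 3))
        rw [Bool.not_not] at this
        exact (congrArg _ this).trans (mul_inv_cancel _)
    have r0' : Run (bigon f g o) φ col' (.bd 0) 1 1 := by
      have := Run.cross (D := bigon f g o) (φ := φ) (col := col') (d := .bd 0) (c := false)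
        (i := 0) rfl (.cross (c := true) (i := 3) rfl (.arrive (k := 1) rfl))
      rwa [w0] at this
    have r3' : Run (bigon f g o) φ col' (.bd 3) 2 1 := by
      have := Run.cross (D := bigon f g o) (φ := φ) (col := col') (d := .bd 3) (c := false)
        (i := 3) rfl (.cross (c := true) (i := 0) rfl (.arrive (k := 2) rfl))
      rwa [w3] at this
    refine .of_matchAt fun k => ?_
    fin_cases k
    · exact .of_run r0 r0'
    · exact .of_run (r0.reverse h) (r0'.reverse h')
    · exact .of_run (r3.reverse h) (r3'.reverse h')
    · exact .of_run r3 r3'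

end Diagram

end GraphTangle

namespace GraphTangle

namespace Diagram

variable {K : Type} {X H : Type*} [Quandle X] [Group H]

/-! ### The third move -/

/-- The colors at the darts `2` and `3` of a crossing with the colors `p` and `q` at the darts `0` and
`1`, where `o` tells whether the dart `0` belongs to the over-arc, and `t`, `t'` are the orientations of
the darts `2` and `1`. -/
def crossingColors (o t t' : Bool) (p q : X) : X × X :=
  if o then (p, signedAct t p q) else (signedAct t' q p, q)

/-- The weight collected by the strand from the dart `0` to the dart `2`. -/
def crossingWeight (φ : X → X → H) (o t' : Bool) (p q : X) : H :=
  if o then 1 else signedWeight φ t' q p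

/-- The weight collected by the strand from the dart `1` to the dart `3`. -/
def crossingWeight' (φ : X → X → H) (o t : Bool) (p q : X) : H :=
  if o then signedWeight φ t p q else 1

/-- The three comparisons encode an ordering of the strands by height, and `h` excludes the two
cyclic patterns. In the six others the bottom strand is acted on by the two upper ones before or
after these have crossed, and self-distributivity identifies the results. -/
theorem crossingColors_braid (o₁₀ o₂₀ o₂₁ : Bool) (h : ¬(o₁₀ = o₂₁ ∧ o₂₀ = !o₁₀))
    (t₀ t₁ t₂ : Bool) (x y z : X) :
    let a₂ := crossingColors o₁₀ t₀ (!t₁) x y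
    let a₁ := crossingColors o₂₀ t₀ (!t₂) a₂.1 z
    let a₀ := crossingColors o₂₁ t₁ (!t₂) a₂.2 a₁.2
    let b₀ := crossingColors o₂₁ t₁ (!t₂) y z
    let b₁ := crossingColors o₂₀ t₀ (!t₂) x b₀.2
    let b₂ := crossingColors o₁₀ t₀ (!t₁) b₁.1 b₀.1
    a₁.1 = b₂.1 ∧ a₀.1 = b₂.2 ∧ a₀.2 = b₁.2 := by
  cases o₁₀ <;> cases o₂₀ <;> cases o₂₁ <;> simp [crossingColors] at h ⊢
  · exact signedAct_distrib _ _ _ _ _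
  · rw [signedAct_distrib (!t₁) (!t₂)]; simp
  · rw [signedAct_distrib t₁ t₀]; simp
  · exact signedAct_distrib _ _ _ _ _
  · exact (signedAct_distrib _ _ _ _ _).symm
  · exact (signedAct_distrib _ _ _ _ _).symm

/-- The top strand collects nothing, the middle strand only meets the top one and has the same
factor on both sides, and the bottom strand is treated by the signed cocycle condition. -/
theorem crossingWeight_braid {φ : X → X → H} (hφ : IsQuandleTwoCocycle φ)
    (o₁₀ o₂₀ o₂₁ : Bool) (h : ¬(o₁₀ = o₂₁ ∧ o₂₀ = !o₁₀)) (t₀ t₁ t₂ : Bool) (x y z : X) :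
    let a₂ := crossingColors o₁₀ t₀ (!t₁) x y
    let a₁ := crossingColors o₂₀ t₀ (!t₂) a₂.1 z
    let b₀ := crossingColors o₂₁ t₁ (!t₂) y z
    let b₁ := crossingColors o₂₀ t₀ (!t₂) x b₀.2
    crossingWeight φ o₁₀ (!t₁) x y * crossingWeight φ o₂₀ (!t₂) a₂.1 z =
      crossingWeight φ o₂₀ (!t₂) x b₀.2 * crossingWeight φ o₁₀ (!t₁) b₁.1 b₀.1 ∧
    crossingWeight' φ o₁₀ t₀ x y * crossingWeight φ o₂₁ (!t₂) a₂.2 a₁.2 =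
      crossingWeight φ o₂₁ (!t₂) y z * crossingWeight' φ o₁₀ t₀ b₁.1 b₀.1 ∧
    crossingWeight' φ o₂₀ t₀ a₂.1 z * crossingWeight' φ o₂₁ t₁ a₂.2 a₁.2 =
      crossingWeight' φ o₂₁ t₁ y z * crossingWeight' φ o₂₀ t₀ x b₀.2 := by
  cases o₁₀ <;> cases o₂₀ <;> cases o₂₁ <;>
    simp [crossingColors, crossingWeight, crossingWeight'] at h ⊢
  · exact hφ.signedWeight_mul _ _ _ _ _
  · rw [hφ.signedWeight_mul (!t₁) (!t₂)]; simp
  · rw [hφ.signedWeight_mul t₁ t₀]; simp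
  · exact hφ.signedWeight_mul _ _ _ _ _
  · exact (hφ.signedWeight_mul _ _ _ _ _).symm
  · exact (hφ.signedWeight_mul _ _ _ _ _).symm

theorem crossingColors_over {o : Bool} (ho : o = true) (t t' : Bool) (p q : X) :
    (crossingColors o t t' p q).1 = p ∧
      (crossingColors o t t' p q).2 = signedAct t (crossingColors o t t' p q).1 q := by
  subst ho; exact ⟨rfl, rfl⟩

theorem crossingColors_under {o : Bool} (ho : o = false) (t t' : Bool) (p q : X) :
    (crossingColors o t t' p q).2 = q ∧ (crossingColors o t t' p q).1 = signedAct t' q p := by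
  subst ho; exact ⟨rfl, rfl⟩

theorem crossingColors_mem {C : Set X} (hC : IsSubquandle C) (o t t' : Bool) {p q : X} (hp : p ∈ C)
    (hq : q ∈ C) : (crossingColors o t t' p q).1 ∈ C ∧ (crossingColors o t t' p q).2 ∈ C := by
  cases o
  · exact ⟨hC _ _ hq _ hp, hq⟩
  · exact ⟨hp, hC _ _ hp _ hq⟩

theorem LocalColoring.arrivalWeight_zero {D : Diagram K} {col : D.Darts → X}
    (h : D.LocalColoring col) (φ : X → X → H) (c : D.Crossing) :
    D.arrivalWeight φ col (.cr c 0) = crossingWeight φ (D.isOver c 0) (D.tail (.cr c 1))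
      (col (.cr c 0)) (col (.cr c 1)) := by
  cases ho : D.isOver c 0
  · exact h.arrivalWeight_under φ c 0 ho
  · exact D.arrivalWeight_over φ col c 0 ho

theorem LocalColoring.arrivalWeight_one {D : Diagram K} {col : D.Darts → X}
    (h : D.LocalColoring col) (φ : X → X → H) (c : D.Crossing) :
    D.arrivalWeight φ col (.cr c 1) = crossingWeight' φ (D.isOver c 0) (D.tail (.cr c 2))
      (col (.cr c 0)) (col (.cr c 1)) := by
  have h1 : D.isOver c 1 = !D.isOver c 0 := D.isOver_succ c 0
  cases ho : D.isOver c 0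
  · exact D.arrivalWeight_over φ col c 1 (by rw [h1, ho]; rfl)
  · have h2 : col (.cr c 2) = col (.cr c 0) := h.overArc c 0 ho
    refine (h.arrivalWeight_under φ c 1 (by rw [h1, ho]; rfl)).trans ?_
    show signedWeight φ (D.tail (.cr c 2)) (col (.cr c 2)) (col (.cr c 1)) = _
    rw [h2]
    rfl

/-- The colors of the darts of `triangle f h false`, if `x`, `y`, `z` are the colors at the boundary
points `0`, `1`, `2`, and `o₁₀`, `o₂₀`, `o₂₁` are the values of `isOver` at the darts `0` of the
crossings `2`, `1`, `0`. -/
def triangleColors (o₁₀ o₂₀ o₂₁ : Bool) (f : Fin 3 → Bool) (x y z : X) :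
    Dart (Fin 6) (Fin 3) Empty Empty → X :=
  let a₂ := crossingColors o₁₀ (f 0) (!f 1) x y
  let a₁ := crossingColors o₂₀ (f 0) (!f 2) a₂.1 z
  let a₀ := crossingColors o₂₁ (f 1) (!f 2) a₂.2 a₁.2
  fun
    | .bd b => ![x, y, z, a₁.1, a₀.1, a₀.2] b
    | .cr 2 i => ![x, y, a₂.1, a₂.2] i
    | .cr 1 i => ![a₂.1, z, a₁.1, a₁.2] i
    | .cr 0 i => ![a₂.2, a₁.2, a₀.1, a₀.2] i

/-- The colors of the darts of `triangle f h true`, as in `triangleColors`. -/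
def triangleColors' (o₁₀ o₂₀ o₂₁ : Bool) (f : Fin 3 → Bool) (x y z : X) :
    Dart (Fin 6) (Fin 3) Empty Empty → X :=
  let b₀ := crossingColors o₂₁ (f 1) (!f 2) y z
  let b₁ := crossingColors o₂₀ (f 0) (!f 2) x b₀.2
  let b₂ := crossingColors o₁₀ (f 0) (!f 1) b₁.1 b₀.1
  fun
    | .bd b => ![x, y, z, b₂.1, b₂.2, b₁.2] b
    | .cr 2 i => ![b₁.1, b₀.1, b₂.1, b₂.2] i
    | .cr 1 i => ![x, b₀.2, b₁.1, b₁.2] i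
    | .cr 0 i => ![y, z, b₀.1, b₀.2] i

theorem triangleColors_bd (o₁₀ o₂₀ o₂₁ : Bool) (h : ¬(o₁₀ = o₂₁ ∧ o₂₀ = !o₁₀)) (f : Fin 3 → Bool)
    (x y z : X) (k : Fin 6) :
    triangleColors o₁₀ o₂₀ o₂₁ f x y z (.bd k) = triangleColors' o₁₀ o₂₀ o₂₁ f x y z (.bd k) := by
  obtain ⟨h1, h2, h3⟩ := crossingColors_braid o₁₀ o₂₀ o₂₁ h (f 0) (f 1) (f 2) x y z
  match k with
  | 0 => exact Eq.trans (b := x) rfl rfl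
  | 1 => exact Eq.trans (b := y) rfl rfl
  | 2 => exact Eq.trans (b := z) rfl rfl
  | 3 => exact h1
  | 4 => exact h2
  | 5 => exact h3

/-- The coloring of `triangle f h false` with colors `x`, `y`, `z` at the boundary points `0`, `1`, `2`. -/
abbrev triangleColoring (f : Fin 3 → Bool) (h : Equiv.Perm (Fin 3)) (x y z : X) :
    Dart (Fin 6) (Fin 3) Empty Empty → X :=
  triangleColors (decide (h 1 < h 0)) (decide (h 2 < h 0)) (decide (h 2 < h 1)) f x y z

/-- The coloring of `triangle f h true` with colors `x`, `y`, `z` at the boundary points `0`, `1`, `2`. -/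
abbrev triangleColoring' (f : Fin 3 → Bool) (h : Equiv.Perm (Fin 3)) (x y z : X) :
    Dart (Fin 6) (Fin 3) Empty Empty → X :=
  triangleColors' (decide (h 1 < h 0)) (decide (h 2 < h 0)) (decide (h 2 < h 1)) f x y z

theorem localColoring_triangleColoring (f : Fin 3 → Bool) (h : Equiv.Perm (Fin 3)) (x y z : X) :
    (triangle f h false).LocalColoring (triangleColoring f h x y z) := by
  refine .mk_of_zero ?_ (fun j => j.elim) ?_ ?_ (fun l => l.elim)
  · rintro (b | ⟨(c : Fin 3), i⟩ | ⟨⟨⟩, _⟩ | ⟨⟨⟩⟩)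
    · fin_cases b <;> rfl
    · fin_cases c <;> fin_cases i <;> rfl
  · intro (c : Fin 3) ho
    fin_cases c <;> exact crossingColors_over ho _ _ _ _
  · intro (c : Fin 3) ho
    fin_cases c <;> exact crossingColors_under ho _ _ _ _

theorem localColoring_triangleColoring' (f : Fin 3 → Bool) (h : Equiv.Perm (Fin 3)) (x y z : X) :
    (triangle f h true).LocalColoring (triangleColoring' f h x y z) := by
  refine .mk_of_zero ?_ (fun j => j.elim) ?_ ?_ (fun l => l.elim)
  · rintro (b | ⟨(c : Fin 3), i⟩ | ⟨⟨⟩, _⟩ | ⟨⟨⟩⟩)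
    · fin_cases b <;> rfl
    · fin_cases c <;> fin_cases i <;> rfl
  · intro (c : Fin 3) ho
    fin_cases c <;> exact crossingColors_over ho _ _ _ _
  · intro (c : Fin 3) ho
    fin_cases c <;> exact crossingColors_under ho _ _ _ _

theorem triangleColoring_mem {C : Set X} (hC : IsSubquandle C) (f : Fin 3 → Bool)
    (h : Equiv.Perm (Fin 3)) {x y z : X} (hx : x ∈ C) (hy : y ∈ C) (hz : z ∈ C)
    (d : (triangle f h false).Darts) : triangleColoring f h x y z d ∈ C := by
  have h2 := crossingColors_mem hC (decide (h 1 < h 0)) (f 0) (!f 1) hx hy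
  have h1 := crossingColors_mem hC (decide (h 2 < h 0)) (f 0) (!f 2) h2.1 hz
  have h0 := crossingColors_mem hC (decide (h 2 < h 1)) (f 1) (!f 2) h2.2 h1.2
  rcases d with b | ⟨(c : Fin 3), i⟩ | ⟨⟨⟩, _⟩ | ⟨⟨⟩⟩
  · fin_cases b
    exacts [hx, hy, hz, h1.1, h0.1, h0.2]
  · fin_cases c <;> fin_cases i
    exacts [h2.2, h1.2, h0.1, h0.2, h2.1, hz, h1.1, h1.2, hx, hy, h2.1, h2.2]

theorem triangleColoring'_mem {C : Set X} (hC : IsSubquandle C) (f : Fin 3 → Bool)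
    (h : Equiv.Perm (Fin 3)) {x y z : X} (hx : x ∈ C) (hy : y ∈ C) (hz : z ∈ C)
    (d : (triangle f h true).Darts) : triangleColoring' f h x y z d ∈ C := by
  have h0 := crossingColors_mem hC (decide (h 2 < h 1)) (f 1) (!f 2) hy hz
  have h1 := crossingColors_mem hC (decide (h 2 < h 0)) (f 0) (!f 2) hx h0.2
  have h2 := crossingColors_mem hC (decide (h 1 < h 0)) (f 0) (!f 1) h1.1 h0.1
  rcases d with b | ⟨(c : Fin 3), i⟩ | ⟨⟨⟩, _⟩ | ⟨⟨⟩⟩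
  · fin_cases b
    exacts [hx, hy, hz, h2.1, h2.2, h1.2]
  · fin_cases c <;> fin_cases i
    exacts [hy, hz, h0.1, h0.2, hx, h0.2, h1.1, h1.2, h1.1, h0.1, h2.1, h2.2]

/-- Heights are linearly ordered, so the strands cannot lie over each other cyclically. -/
theorem heights_ne (h : Equiv.Perm (Fin 3)) :
    ¬(decide (h 1 < h 0) = decide (h 2 < h 1) ∧ decide (h 2 < h 0) = !decide (h 1 < h 0)) := by
  have h01 : h 0 ≠ h 1 := h.injective.ne (by decide)
  have h02 : h 0 ≠ h 2 := h.injective.ne (by decide)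
  have h12 : h 1 ≠ h 2 := h.injective.ne (by decide)
  rintro ⟨h1, h2⟩
  by_cases h10 : h 1 < h 0 <;> by_cases h21 : h 2 < h 1 <;> by_cases h20 : h 2 < h 0 <;>
    simp [h10, h21, h20] at h1 h2 <;> omega

theorem triangleColoring_bd (f : Fin 3 → Bool) (h : Equiv.Perm (Fin 3)) (x y z : X) (k : Fin 6) :
    triangleColoring f h x y z (.bd k) = triangleColoring' f h x y z (.bd k) :=
  triangleColors_bd _ _ _ (heights_ne h) f x y z k

/-- The starting points of the three strands fix the darts `0` and `1` at the first crossing, and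
then at the others in the order in which the strands reach them: `2, 1, 0` on one side, `0, 1, 2` on
the other. -/
theorem triangle_eq_of_eq {f : Fin 3 → Bool} {h : Equiv.Perm (Fin 3)} {side : Bool}
    {col col' : (triangle f h side).Darts → X} (hc : (triangle f h side).LocalColoring col)
    (hc' : (triangle f h side).LocalColoring col') (h0 : col (.bd 0) = col' (.bd 0))
    (h1 : col (.bd 1) = col' (.bd 1)) (h2 : col (.bd 2) = col' (.bd 2)) : col = col' := by
  have seg : ∀ d, col ((triangle f h side).link d) = col' ((triangle f h side).link d) →
      col d = col' d := fun d hd => by rwa [hc.segment, hc'.segment] at hd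
  have key : ∀ c i, col (.cr c i) = col' (.cr c i) := by
    cases side
    · have c2 := hc.eq_at_crossing hc' (2 : Fin 3) 0 (seg (.cr (2 : Fin 3) 0) h0)
        (seg (.cr (2 : Fin 3) 1) h1)
      have c1 := hc.eq_at_crossing hc' (1 : Fin 3) 0 (seg (.cr (1 : Fin 3) 0) (c2 2))
        (seg (.cr (1 : Fin 3) 1) h2)
      have c0 := hc.eq_at_crossing hc' (0 : Fin 3) 0 (seg (.cr (0 : Fin 3) 0) (c2 3))
        (seg (.cr (0 : Fin 3) 1) (c1 3))
      intro (c : Fin 3) i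
      fin_cases c
      exacts [c0 i, c1 i, c2 i]
    · have c0 := hc.eq_at_crossing hc' (0 : Fin 3) 0 (seg (.cr (0 : Fin 3) 0) h1)
        (seg (.cr (0 : Fin 3) 1) h2)
      have c1 := hc.eq_at_crossing hc' (1 : Fin 3) 0 (seg (.cr (1 : Fin 3) 0) h0)
        (seg (.cr (1 : Fin 3) 1) (c0 3))
      have c2 := hc.eq_at_crossing hc' (2 : Fin 3) 0 (seg (.cr (2 : Fin 3) 0) (c1 2))
        (seg (.cr (2 : Fin 3) 1) (c0 2))
      intro (c : Fin 3) i
      fin_cases c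
      exacts [c0 i, c1 i, c2 i]
  funext d
  rcases d with b | ⟨(c : Fin 3), i⟩ | ⟨⟨⟩, _⟩ | ⟨⟨⟩⟩
  · cases side
    · fin_cases b
      exacts [h0, h1, h2, seg (.bd 3) (key _ _), seg (.bd 4) (key _ _), seg (.bd 5) (key _ _)]
    · fin_cases b
      exacts [h0, h1, h2, seg (.bd 3) (key _ _), seg (.bd 4) (key _ _), seg (.bd 5) (key _ _)]
  · exact key c i

theorem eq_triangleColoring {f : Fin 3 → Bool} {h : Equiv.Perm (Fin 3)}
    {col : (triangle f h false).Darts → X} (hc : (triangle f h false).LocalColoring col) :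
    col = triangleColoring f h (col (.bd 0)) (col (.bd 1)) (col (.bd 2)) :=
  triangle_eq_of_eq hc (localColoring_triangleColoring _ _ _ _ _) rfl rfl rfl

theorem eq_triangleColoring' {f : Fin 3 → Bool} {h : Equiv.Perm (Fin 3)}
    {col : (triangle f h true).Darts → X} (hc : (triangle f h true).LocalColoring col) :
    col = triangleColoring' f h (col (.bd 0)) (col (.bd 1)) (col (.bd 2)) :=
  triangle_eq_of_eq hc (localColoring_triangleColoring' _ _ _ _ _) rfl rfl rfl

/-- The strands of a triangle have the same weights on both sides. -/
theorem exists_run_triangle {φ : X → X → H} (hφ : IsQuandleTwoCocycle φ) (f : Fin 3 → Bool)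
    (h : Equiv.Perm (Fin 3)) (x y z : X) :
    (∃ g, Run (triangle f h false) φ (triangleColoring f h x y z) (.bd 0) 3 g ∧
      Run (triangle f h true) φ (triangleColoring' f h x y z) (.bd 0) 3 g) ∧
    (∃ g, Run (triangle f h false) φ (triangleColoring f h x y z) (.bd 1) 4 g ∧
      Run (triangle f h true) φ (triangleColoring' f h x y z) (.bd 1) 4 g) ∧
    ∃ g, Run (triangle f h false) φ (triangleColoring f h x y z) (.bd 2) 5 g ∧
      Run (triangle f h true) φ (triangleColoring' f h x y z) (.bd 2) 5 g := by
  have hc := localColoring_triangleColoring f h x y z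
  have hc' := localColoring_triangleColoring' f h x y z
  obtain ⟨e0, e1, e2⟩ := crossingWeight_braid hφ _ _ _ (heights_ne h) (f 0) (f 1) (f 2) x y z
  have r0 := Run.cross (D := triangle f h false) (φ := φ) (col := triangleColoring f h x y z)
    (d := .bd 0) (c := (2 : Fin 3)) (i := 0) rfl
    (.cross (c := (1 : Fin 3)) (i := 0) rfl (.arrive (k := 3) rfl))
  have r0' := Run.cross (D := triangle f h true) (φ := φ) (col := triangleColoring' f h x y z)
    (d := .bd 0) (c := (1 : Fin 3)) (i := 0) rfl
    (.cross (c := (2 : Fin 3)) (i := 0) rfl (.arrive (k := 3) rfl))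
  have r1 := Run.cross (D := triangle f h false) (φ := φ) (col := triangleColoring f h x y z)
    (d := .bd 1) (c := (2 : Fin 3)) (i := 1) rfl
    (.cross (c := (0 : Fin 3)) (i := 0) rfl (.arrive (k := 4) rfl))
  have r1' := Run.cross (D := triangle f h true) (φ := φ) (col := triangleColoring' f h x y z)
    (d := .bd 1) (c := (0 : Fin 3)) (i := 0) rfl
    (.cross (c := (2 : Fin 3)) (i := 1) rfl (.arrive (k := 4) rfl))
  have r2 := Run.cross (D := triangle f h false) (φ := φ) (col := triangleColoring f h x y z)
    (d := .bd 2) (c := (1 : Fin 3)) (i := 1) rfl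
    (.cross (c := (0 : Fin 3)) (i := 1) rfl (.arrive (k := 5) rfl))
  have r2' := Run.cross (D := triangle f h true) (φ := φ) (col := triangleColoring' f h x y z)
    (d := .bd 2) (c := (0 : Fin 3)) (i := 1) rfl
    (.cross (c := (1 : Fin 3)) (i := 1) rfl (.arrive (k := 5) rfl))
  rw [mul_one] at r0 r0' r1 r1' r2 r2'
  refine ⟨⟨_, r0, ?_⟩, ⟨_, r1, ?_⟩, ⟨_, r2, ?_⟩⟩
  -- Both runs are products of two crossing factors, met in opposite orders; the signed cocycle
  -- identities equate them.
  · convert r0' using 1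
    rw [hc.arrivalWeight_zero φ (2 : Fin 3), hc.arrivalWeight_zero φ (1 : Fin 3),
      hc'.arrivalWeight_zero φ (2 : Fin 3), hc'.arrivalWeight_zero φ (1 : Fin 3)]
    exact e0
  · convert r1' using 1
    rw [hc.arrivalWeight_one φ (2 : Fin 3), hc.arrivalWeight_zero φ (0 : Fin 3),
      hc'.arrivalWeight_one φ (2 : Fin 3), hc'.arrivalWeight_zero φ (0 : Fin 3)]
    exact e1
  · convert r2' using 1
    rw [hc.arrivalWeight_one φ (1 : Fin 3), hc.arrivalWeight_one φ (0 : Fin 3),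
      hc'.arrivalWeight_one φ (1 : Fin 3), hc'.arrivalWeight_one φ (0 : Fin 3)]
    exact e2

theorem interchangeable_triangle {φ : X → X → H} (hφ : IsQuandleTwoCocycle φ) (s : ℕ)
    (f : Fin 3 → Bool) (h : Equiv.Perm (Fin 3)) :
    Interchangeable φ s (triangle f h false) (triangle f h true) := by
  have : IsEmpty (triangle f h false).Leg := inferInstanceAs (IsEmpty Empty)
  have : IsEmpty (triangle f h true).Leg := inferInstanceAs (IsEmpty Empty)
  refine ⟨⟨fun _ v => v.elim, fun _ v => v.elim⟩, ?_, ?_, ?_, ?_, ?_⟩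
  · intro C hC col hc hf
    refine ⟨_, localColoring_triangleColoring' f h (col (.bd 0)) (col (.bd 1)) (col (.bd 2)),
      .of_mem _ (triangleColoring'_mem hC f h (hf.mem _) (hf.mem _) (hf.mem _)), fun k => ?_⟩
    exact (congrFun (eq_triangleColoring hc) (.bd k)).trans (triangleColoring_bd f h _ _ _ k)
  · intro C hC col hc hf
    refine ⟨_, localColoring_triangleColoring f h (col (.bd 0)) (col (.bd 1)) (col (.bd 2)),
      .of_mem _ (triangleColoring_mem hC f h (hf.mem _) (hf.mem _) (hf.mem _)), fun k => ?_⟩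
    exact (congrFun (eq_triangleColoring' hc) (.bd k)).trans (triangleColoring_bd f h _ _ _ k).symm
  · exact fun col col' hc hc' hb => triangle_eq_of_eq hc hc' (hb 0) (hb 1) (hb 2)
  · exact fun col col' hc hc' hb => triangle_eq_of_eq hc hc' (hb 0) (hb 1) (hb 2)
  · intro _ col col' hc hc' hb
    obtain ⟨⟨g0, r0, r0'⟩, ⟨g1, r1, r1'⟩, ⟨g2, r2, r2'⟩⟩ :=
      exists_run_triangle hφ f h (col (.bd 0)) (col (.bd 1)) (col (.bd 2))
    rw [← eq_triangleColoring hc] at r0 r1 r2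
    rw [hb 0, hb 1, hb 2, ← eq_triangleColoring' hc'] at r0' r1' r2'
    refine .of_matchAt fun k => ?_
    fin_cases k
    · exact .of_run r0 r0'
    · exact .of_run r1 r1'
    · exact .of_run r2 r2'
    · exact .of_run (r0.reverse hc) (r0'.reverse hc')
    · exact .of_run (r1.reverse hc) (r1'.reverse hc')
    · exact .of_run (r2.reverse hc) (r2'.reverse hc')

end Diagram

end GraphTangle

namespace GraphTangle

namespace Diagram

variable {K : Type} {X H : Type*} [Quandle X] [Group H]

theorem excess_eq_of_equiv {K' : Type} {D : Diagram K} {D' : Diagram K'} {v : D.Vertex} {v' : D'.Vertex}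
    (g : D.Leg ≃ D'.Leg) (hv : ∀ l, D.vtx l = v ↔ D'.vtx (g l) = v')
    (ht : ∀ l, D'.tail (.leg (g l)) = D.tail (.leg l)) : D'.excess v' = D.excess v := by
  have h : ∀ e, Nat.card {l // D.vtx l = v ∧ D.tail (.leg l) = e} =
      Nat.card {l // D'.vtx l = v' ∧ D'.tail (.leg l) = e} := fun e =>
    Nat.card_congr (g.subtypeEquiv fun l => by rw [hv, ht])
  rw [excess, excess, inDegree, inDegree, outDegree, outDegree, h, h]

/-! ### The fourth move -/

section Star

variable {n : ℕ} {t : Fin (n + 2) → Bool} {o : Bool}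

theorem star_eq_const {col : (star t).Darts → X} (h : (star t).LocalColoring col) :
    col = fun _ => col (.bd 0) := by
  have h0 : ∀ l, col (.leg l) = col (.bd 0) := fun l =>
    (h.vertexConstant l (0 : Fin (n + 2)) rfl).trans (h.segment (.bd 0))
  funext d
  rcases d with b | ⟨⟨⟩, _⟩ | ⟨⟨⟩, _⟩ | l
  · exact (h.segment (.bd b)).symm.trans (h0 b)
  · exact h0 l

theorem twistedStar_link_bd {i : Fin (n + 2)} (h0 : i ≠ 0) (h1 : i ≠ 1) :
    (twistedStar t o).link (.bd i) = .leg i := by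
  simp [twistedStar, h0, h1]

theorem twistedStar_link_leg {i : Fin (n + 2)} (h0 : i ≠ 0) (h1 : i ≠ 1) :
    (twistedStar t o).link (.leg i) = .bd i := by
  simp [twistedStar, h0, h1]

theorem twistedStar_link_zero : (twistedStar t o).link (.bd (0 : Fin (n + 2))) = .cr () 0 := rfl

theorem twistedStar_link_one : (twistedStar t o).link (.bd (1 : Fin (n + 2))) = .cr () 1 := rfl

theorem twistedStar_link_leg_zero :
    (twistedStar t o).link (.leg (0 : Fin (n + 2))) = .cr () 3 := rfl

theorem twistedStar_link_leg_one :
    (twistedStar t o).link (.leg (1 : Fin (n + 2))) = .cr () 2 := rfl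

/-- The darts `2` and `3` of the crossing lead to legs of the same vertex. Vertex-constancy gives
them equal colors, which then spread through the crossing by idempotence. -/
theorem twistedStar_eq_const {col : (twistedStar t o).Darts → X}
    (h : (twistedStar t o).LocalColoring col) : col = fun _ => col (.bd 0) := by
  have hl : ∀ l, col (.leg l) = col (.leg (0 : Fin (n + 2))) := fun l => h.vertexConstant l _ rfl
  have h3 : col (.cr () 3) = col (.leg (0 : Fin (n + 2))) := h.segment (.leg (0 : Fin (n + 2)))
  have h2 : col (.cr () 2) = col (.leg (0 : Fin (n + 2))) :=
    (h.segment (.leg (1 : Fin (n + 2)))).trans (hl _)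
  have hc : ∀ i, col (.cr () i) = col (.leg (0 : Fin (n + 2))) :=
    h.eq_at_crossing (localColoring_const _ (col (.leg (0 : Fin (n + 2))))) () 2 h2 h3
  have h0 : col (.bd 0) = col (.leg (0 : Fin (n + 2))) := (h.segment (.bd 0)).symm.trans (hc 0)
  funext d
  rcases d with b | ⟨⟨⟩, i⟩ | ⟨⟨⟩, _⟩ | l
  · by_cases hb0 : b = 0
    · rw [hb0]
    · by_cases hb1 : b = 1
      · rw [hb1, h0]
        exact (h.segment (.bd 1)).symm.trans (hc 1)
      · rw [h0, ← h.segment, twistedStar_link_bd hb0 hb1]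
        exact hl _
  · exact (hc i).trans h0.symm
  · exact (hl l).trans h0.symm

theorem excess_twistedStar (v : (twistedStar t o).Vertex) :
    (twistedStar t o).excess v = (star t).excess v :=
  excess_eq_of_equiv (D := star t) (D' := twistedStar t o)
    (id (Equiv.swap 0 1 : Fin (n + 2) ≃ Fin (n + 2)))
    (fun _ => Iff.rfl) fun (l : Fin (n + 2)) =>
      congrArg t ((Equiv.swap (0 : Fin (n + 2)) 1).symm_apply_apply l)

theorem interchangeable_star_twistedStar {φ : X → X → H} (hφ : IsQuandleTwoCocycle φ) (s : ℕ)
    (t : Fin (n + 2) → Bool) (o : Bool) : Interchangeable φ s (star t) (twistedStar t o) := by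
  refine ⟨⟨fun h v => excess_twistedStar (t := t) (o := o) v ▸ h v,
    fun h v => (excess_twistedStar (t := t) (o := o) v).symm ▸ h v⟩, ?_, ?_, ?_, ?_, ?_⟩
  · intro C _ col h hf
    rw [star_eq_const h] at hf ⊢
    refine ⟨fun _ => col (.bd 0), localColoring_const _ _, ⟨fun _ => hf.mem (.bd 0), fun l x hx => ?_⟩,
      fun _ => rfl⟩
    exact (congrArg (fun k => (Rack.act' (col (.bd 0)) ^ k) x)
      (excess_twistedStar (t := t) (o := o) ())).trans (hf.fix l x hx)
  · intro C _ col h hf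
    rw [twistedStar_eq_const h] at hf ⊢
    refine ⟨fun _ => col (.bd 0), localColoring_const _ _, ⟨fun _ => hf.mem (.bd 0), fun l x hx => ?_⟩,
      fun _ => rfl⟩
    exact (congrArg (fun k => (Rack.act' (col (.bd 0)) ^ k) x)
      (excess_twistedStar (t := t) (o := o) ())).symm.trans (hf.fix l x hx)
  · intro col col' h h' hb
    rw [star_eq_const h, star_eq_const h', hb]
  · intro col col' h h' hb
    rw [twistedStar_eq_const h, twistedStar_eq_const h', hb]
  · intro _ col col' h h' _
    have hw : ∀ d, (twistedStar t o).arrivalWeight φ col' d = 1 := by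
      rw [twistedStar_eq_const h']
      exact IsQuandleTwoCocycle.arrivalWeight_const hφ _ _
    have hs : Spokes (star t) φ col (M := Fin (n + 2)) id id fun _ => 1 :=
      ⟨Function.injective_id, Function.surjective_id, fun _ _ => rfl, fun m => .arrive rfl⟩
    -- After the half-turn the boundary points `0` and `1` belong to the legs `1` and `0`; all other
    -- legs are unchanged.
    have hs' : Spokes (twistedStar t o) φ col' (M := Fin (n + 2)) id (Equiv.swap 0 1)
        fun _ => 1 := by
      refine ⟨Function.injective_id, (Equiv.swap _ _).surjective, fun _ _ => rfl, fun m => ?_⟩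
      by_cases h0 : m = 0
      · rw [h0, Equiv.swap_apply_left]
        have := Run.cross (D := twistedStar t o) (φ := φ) (col := col') (c := ()) (i := 2)
          twistedStar_link_leg_one (.arrive (k := 0) rfl)
        rwa [hw, mul_one] at this
      · by_cases h1 : m = 1
        · rw [h1, Equiv.swap_apply_right]
          have := Run.cross (D := twistedStar t o) (φ := φ) (col := col') (c := ()) (i := 3)
            twistedStar_link_leg_zero (.arrive (k := 1) rfl)
          rwa [hw, mul_one] at this
        · rw [Equiv.swap_apply_of_ne_of_ne h0 h1]
          exact .arrive (twistedStar_link_leg h0 h1)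
    have r' : ∀ k, ∃ l, RunLeg (twistedStar t o) φ col' (.bd k) l 1 := by
      intro k
      by_cases h0 : k = 0
      · rw [h0]
        have := RunLeg.cross (D := twistedStar t o) (φ := φ) (col := col') (c := ()) (i := 0)
          twistedStar_link_zero (.arrive (l := (1 : Fin (n + 2))) rfl)
        rw [hw, mul_one] at this
        exact ⟨_, this⟩
      · by_cases h1 : k = 1
        · rw [h1]
          have := RunLeg.cross (D := twistedStar t o) (φ := φ) (col := col') (c := ()) (i := 1)
            twistedStar_link_one (.arrive (l := (0 : Fin (n + 2))) rfl)
          rw [hw, mul_one] at this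
          exact ⟨_, this⟩
        · exact ⟨_, .arrive (twistedStar_link_bd h0 h1)⟩
    refine .of_matchAt fun k => ?_
    obtain ⟨l, r'⟩ := r' k
    exact .of_runLeg hs hs' (RunLeg.arrive (l := k) rfl) r' fun _ => rfl

end Star

/-! ### Renaming the boundary points -/

section Rename

variable {K' : Type} (D : Diagram K) (e : K ≃ K')

/-- The darts of `D` as darts of the diagram with renamed boundary points. -/
def renameDart (d : D.Darts) : (D.rename e).Darts := renameBd e d

theorem renameDart_bijective : Function.Bijective (D.renameDart e) := by
  refine Function.bijective_iff_has_inverse.2 ⟨renameBd e.symm, ?_, ?_⟩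
  · rintro (_ | _ | _ | _) <;> simp [renameDart, renameBd] <;> rfl
  · rintro (_ | _ | _ | _) <;> simp [renameDart, renameBd]

theorem rename_link (d : D.Darts) :
    (D.rename e).link (D.renameDart e d) = D.renameDart e (D.link d) := by
  have : renameBd e.symm (renameBd e d) = d := by
    rcases d with _ | _ | _ | _ <;> simp [renameBd]
  exact congrArg (fun d => renameBd e (D.link d)) this

theorem localColoring_rename_iff (col : (D.rename e).Darts → X) :
    (D.rename e).LocalColoring col ↔ D.LocalColoring (col ∘ D.renameDart e) := by
  constructor
  · intro h
    refine ⟨fun d => ?_, fun j i => h.joint j i, fun c i => h.overArc c i,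
      fun c i => h.underArc c i, fun l l' => h.vertexConstant l l'⟩
    exact (congrArg col (D.rename_link e d)).symm.trans (h.segment _)
  · intro h
    refine ⟨fun d => ?_, fun j i => h.joint j i, fun c i => h.overArc c i,
      fun c i => h.underArc c i, fun l l' => h.vertexConstant l l'⟩
    obtain ⟨d, rfl⟩ := (D.renameDart_bijective e).2 d
    exact (congrArg col (D.rename_link e d)).trans (h.segment d)

theorem fixesColors_rename_iff (C : Set X) (col : (D.rename e).Darts → X) :
    (D.rename e).FixesColors C col ↔ D.FixesColors C (col ∘ D.renameDart e) := by
  constructor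
  · exact fun h => ⟨fun d => h.mem _, fun l x hx => h.fix l x hx⟩
  · refine fun h => ⟨fun d => ?_, fun l x hx => h.fix l x hx⟩
    obtain ⟨d, rfl⟩ := (D.renameDart_bijective e).2 d
    exact h.mem d

omit [Quandle X] in
theorem exists_comp_renameDart (col : D.Darts → X) :
    ∃ col' : (D.rename e).Darts → X, col' ∘ D.renameDart e = col :=
  ⟨col ∘ (Equiv.ofBijective _ (D.renameDart_bijective e)).symm, funext fun d =>
    congrArg col ((Equiv.ofBijective _ (D.renameDart_bijective e)).symm_apply_apply d)⟩

variable {D} {φ : X → X → H} {col : (D.rename e).Darts → X}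

omit [Quandle X] in
theorem Run.rename {d : D.Darts} {k : K} {g : H} (r : Run D φ (col ∘ D.renameDart e) d k g) :
    Run (D.rename e) φ col (D.renameDart e d) (e k) g := by
  induction r with
  | arrive h => exact .arrive (by rw [rename_link, h]; rfl)
  | @cross d c i k g h r ih =>
    exact Run.cross (D := D.rename e) (d := D.renameDart e d) (c := c) (i := i)
      (by rw [rename_link, h]; rfl) ih

omit [Quandle X] in
theorem RunLeg.rename {d : D.Darts} {l : D.Leg} {g : H}
    (r : RunLeg D φ (col ∘ D.renameDart e) d l g) :
    RunLeg (D.rename e) φ col (D.renameDart e d) l g := by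
  induction r with
  | arrive h => exact .arrive (by rw [rename_link, h]; rfl)
  | @cross d c i k g h r ih =>
    exact RunLeg.cross (D := D.rename e) (d := D.renameDart e d) (c := c) (i := i)
      (by rw [rename_link, h]; rfl) ih

theorem DeterminedByBoundary.rename (h : DeterminedByBoundary X D) :
    DeterminedByBoundary X (D.rename e) := by
  intro col col' hc hc' hb
  have := h _ _ ((D.localColoring_rename_iff e col).1 hc) ((D.localColoring_rename_iff e col').1 hc')
    fun k => hb (e k)
  funext d
  obtain ⟨d, rfl⟩ := (D.renameDart_bijective e).2 d
  exact congrFun this d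

end Rename

end Diagram

end GraphTangle

namespace GraphTangle

namespace Diagram

variable {K : Type} {X H : Type*} [Quandle X] [Group H]

/-! ### The fifth move -/

section Past

variable {a b : ℕ} {t : Fin a ⊕ Fin b → Bool} {f o : Bool}

/-- The color of the outer parts of the upper legs, if the legs at the vertex have color `y` and the
right end of the strand has color `z`. -/
def outerColor (f o : Bool) (y z : X) : X := if o then signedAct (!f) z y else y

/-- The sum of the signs of the first `i` upper legs. -/
def upperSum (t : Fin a ⊕ Fin b → Bool) (i : Fin (a + 1)) : ℤ :=
  Fin.partialSum (fun i => signExp (t (.inl i))) i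

/-- The color of the segment `i` of the strand, if the legs at the vertex have color `y` and the right
end of the strand has color `z`. -/
def segmentColor (t : Fin a ⊕ Fin b → Bool) (o : Bool) (y z : X) (i : Fin (a + 1)) : X :=
  if o then z else (Rack.act' y ^ upperSum t i) z

/-- The coloring with color `y` of the legs at the vertex, and `z` of the right end of the strand. -/
def pastColoring (a b : ℕ) (t : Fin a ⊕ Fin b → Bool) (f o : Bool) (y z : X) :
    Dart ((Fin a ⊕ Fin b) ⊕ Bool) (Fin a) Empty (Fin a ⊕ Fin b) → X
  | .bd (.inl (.inl _)) => outerColor f o y z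
  | .bd (.inl (.inr _)) => y
  | .bd (.inr false) => z
  | .bd (.inr true) => segmentColor t o y z (Fin.last a)
  | .cr i k => ![segmentColor t o y z i.castSucc, outerColor f o y z, segmentColor t o y z i.succ, y] k
  | .jt j _ => j.elim
  | .leg _ => y

theorem upperSum_zero : upperSum t 0 = 0 := Fin.partialSum_zero _

theorem upperSum_succ (i : Fin a) :
    upperSum t i.succ = upperSum t i.castSucc + signExp (t (.inl i)) := Fin.partialSum_succ _ _

theorem upperSum_last : upperSum t (Fin.last a) = ∑ i, signExp (t (.inl i)) := by
  rw [upperSum, Fin.partialSum, List.take_of_length_le (by simp), List.sum_ofFn]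

theorem segmentColor_zero (y z : X) : segmentColor t o y z 0 = z := by
  simp [segmentColor, upperSum_zero]

theorem pastColoring_rightEnd (y z : X) (i : Fin (a + 1)) :
    pastColoring a b t f o y z (rightEnd (.inr false) i) = segmentColor t o y z i := by
  refine Fin.cases ?_ (fun i => rfl) i
  exact (segmentColor_zero y z).symm

theorem pastColoring_leftEnd (y z : X) (i : Fin (a + 1)) :
    pastColoring a b t f o y z (leftEnd (.inr true) i) = segmentColor t o y z i := by
  refine Fin.lastCases ?_ (fun i => ?_) i <;> simp [leftEnd, pastColoring]

theorem localColoring_pastColoring (y z : X) :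
    (strandPastVertex a b t f o).LocalColoring (pastColoring a b t f o y z) := by
  refine .mk_of_zero ?_ (fun j => j.elim) ?_ ?_ (fun _ _ _ => rfl)
  · rintro (((i | j) | (_ | _)) | ⟨(i : Fin a), k⟩ | ⟨⟨⟩, _⟩ | (i | j))
    · rfl
    · rfl
    · exact (pastColoring_leftEnd y z 0).trans (segmentColor_zero y z)
    · exact pastColoring_rightEnd y z (Fin.last a)
    · fin_cases k
      · exact pastColoring_rightEnd y z i.castSucc
      · rfl
      · exact pastColoring_leftEnd y z i.succ
      · rfl
    · rfl
    · rfl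
  · intro (c : Fin a) ho
    obtain rfl : o = true := ho
    exact ⟨rfl, (signedAct_signedAct_not f z y).symm⟩
  · intro (c : Fin a) ho
    obtain rfl : o = false := ho
    refine ⟨rfl, ?_⟩
    show (Rack.act' y ^ upperSum t c.succ) z =
      signedAct (t (.inl c)) y ((Rack.act' y ^ upperSum t c.castSucc) z)
    rw [upperSum_succ, signedAct_eq_zpow, add_comm, zpow_add, Equiv.Perm.mul_apply]

theorem pastColoring_mem {C : Set X} (hC : IsSubquandle C) {y z : X} (hy : y ∈ C) (hz : z ∈ C)
    (d : (strandPastVertex a b t f o).Darts) : pastColoring a b t f o y z d ∈ C := by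
  have h1 : outerColor f o y z ∈ C := by
    cases o
    · exact hy
    · exact hC _ _ hz _ hy
  have h2 : ∀ i, segmentColor t o y z i ∈ C := by
    intro i
    cases o
    · exact hC.zpow_mem hy hz _
    · exact hz
  rcases d with ((i | j) | (_ | _)) | ⟨i, k⟩ | ⟨⟨⟩, _⟩ | l
  · exact h1
  · exact hy
  · exact hz
  · exact h2 _
  · fin_cases k
    · exact h2 _
    · exact h1
    · exact h2 _
    · exact hy
  · exact hy

/-- The colors of the strand are found by moving left from its right end, given one color on each
upper leg. The alternative in `hcr` serves two purposes: dart `1` is known when boundary colors are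
given, dart `3` when the vertex color is given. -/
theorem strandPastVertex_eq_of_eq {col col' : (strandPastVertex a b t f o).Darts → X}
    (h : (strandPastVertex a b t f o).LocalColoring col)
    (h' : (strandPastVertex a b t f o).LocalColoring col')
    (h0 : col (.bd (.inr false)) = col' (.bd (.inr false)))
    (hcr : ∀ i : Fin a, col (.cr i 1) = col' (.cr i 1) ∨ col (.cr i 3) = col' (.cr i 3))
    (hleg : ∀ j, col (.leg (.inr j)) = col' (.leg (.inr j))) : col = col' := by
  have seg : ∀ d, col ((strandPastVertex a b t f o).link d) =
      col' ((strandPastVertex a b t f o).link d) → col d = col' d :=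
    fun d hd => by rwa [h.segment, h'.segment] at hd
  have cr : ∀ i : Fin a, col (rightEnd (.inr false) i.castSucc) =
      col' (rightEnd (.inr false) i.castSucc) → ∀ k, col (.cr i k) = col' (.cr i k) := by
    intro i hi
    have hi0 : col (.cr i 0) = col' (.cr i 0) := seg (.cr i 0) hi
    rcases hcr i with h1 | h3
    · exact h.eq_at_crossing h' i 0 hi0 h1
    · exact h.eq_at_crossing h' i 3 h3 hi0
  -- At each upper leg, agreement on the segment to the right and on one end of the leg forces
  -- agreement at the whole crossing, in particular on the segment to the left.
  have key : ∀ s : Fin (a + 1), col (rightEnd (.inr false) s) = col' (rightEnd (.inr false) s) := by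
    refine Fin.induction h0 fun i hi => ?_
    exact cr i hi 2
  have cr' := fun i => cr i (key _)
  funext d
  rcases d with ((i | j) | (_ | _)) | ⟨i, k⟩ | ⟨⟨⟩, _⟩ | (i | j)
  · exact seg (.bd (.inl (.inl i))) (cr' i 1)
  · exact seg (.bd (.inl (.inr j))) (hleg j)
  · exact h0
  · exact seg (.bd (.inr true)) (key (Fin.last a))
  · exact cr' i k
  · exact seg (.leg (.inl i)) (cr' i 3)
  · exact hleg j

theorem determinedByBoundary_strandPastVertex :
    DeterminedByBoundary X (strandPastVertex a b t f o) := by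
  intro col col' h h' hb
  refine strandPastVertex_eq_of_eq h h' (hb _) (fun i => .inl ?_) fun j => ?_
  · exact (h.segment (.bd (.inl (.inl i)))).trans
      ((hb _).trans (h'.segment (.bd (.inl (.inl i)))).symm)
  · exact (h.segment (.bd (.inl (.inr j)))).trans
      ((hb _).trans (h'.segment (.bd (.inl (.inr j)))).symm)

theorem eq_pastColoring {col : (strandPastVertex a b t f o).Darts → X}
    (h : (strandPastVertex a b t f o).LocalColoring col) {y : X} (hy : ∀ l, col (.leg l) = y) :
    col = pastColoring a b t f o y (col (.bd (.inr false))) :=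
  strandPastVertex_eq_of_eq h (localColoring_pastColoring _ _) rfl
    (fun i => .inr ((h.segment (.cr i 3)).symm.trans (hy _))) fun _ => hy _

/-- For a vertex without legs any color would do. A color that occurs in the picture is chosen, so
that it lies in `C`. -/
theorem exists_leg_color {col : (strandPastVertex a b t f o).Darts → X}
    (h : (strandPastVertex a b t f o).LocalColoring col) : ∃ d, ∀ l, col (.leg l) = col d := by
  rcases isEmpty_or_nonempty (strandPastVertex a b t f o).Leg with he | ⟨⟨l⟩⟩
  · exact ⟨.bd (.inr false), fun l => he.elim l⟩
  · exact ⟨.leg l, fun l' => h.vertexConstant _ _ rfl⟩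

theorem excess_strandPastVertex (v : (strandPastVertex a b t f o).Vertex) :
    (strandPastVertex a b t f o).excess v = -∑ l, signExp (t l) := by
  let _ : Fintype (strandPastVertex a b t f o).Leg := inferInstanceAs (Fintype (Fin a ⊕ Fin b))
  refine (excess_eq_sum _ v).trans ?_
  rw [← Finset.sum_neg_distrib]
  exact Fintype.sum_equiv (Equiv.refl _) _ _ fun l => if_pos rfl

variable {t' : Fin b ⊕ Fin a → Bool} {f' : Bool}

theorem sum_signExp_swap (ht : ∀ l, t' l = t l.swap) :
    ∑ l, signExp (t' l) = ∑ l, signExp (t l) :=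
  Fintype.sum_equiv (Equiv.sumComm _ _) _ _ fun l => congrArg signExp (ht l)

/-- The upper legs of the second picture are the lower legs of the first, so the two partial counts
add up to minus the excess of the vertex. -/
theorem upperSum_last_add (ht : ∀ l, t' l = t l.swap) :
    upperSum t' (Fin.last b) + upperSum t (Fin.last a) = ∑ l, signExp (t l) := by
  rw [upperSum_last, upperSum_last, Fintype.sum_sum_type, add_comm]
  simp [ht]

theorem outerColor_outerColor (hf : f' = !f) (y z : X) :
    outerColor f' o (outerColor f o y z) (segmentColor t o y z (Fin.last a)) = y := by
  subst hf
  cases o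
  · rfl
  · exact (congrArg (fun e => signedAct e z _) (Bool.not_not f)).trans (signedAct_signedAct_not f z y)

/-- The boundary points of the two pictures of the fifth move. -/
abbrev pastEquiv (b a : ℕ) : (Fin b ⊕ Fin a) ⊕ Bool ≃ (Fin a ⊕ Fin b) ⊕ Bool :=
  Equiv.sumCongr (Equiv.sumComm (Fin b) (Fin a)) Equiv.boolNot

theorem FixesColors.zpow_act' {C : Set X} {col : (strandPastVertex a b t f o).Darts → X}
    (h : (strandPastVertex a b t f o).FixesColors C col) {y : X} (hy : ∀ l, col (.leg l) = y) :
    ∀ x ∈ C, (Rack.act' y ^ ∑ l, signExp (t l)) x = x := by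
  intro x hx
  rcases isEmpty_or_nonempty (Fin a ⊕ Fin b) with he | ⟨⟨l⟩⟩
  · simp
  · have h1 : (Rack.act' y ^ (-∑ l, signExp (t l))) x = x :=
      (congrArg₂ (fun y n => (Rack.act' y ^ n) x) (hy l).symm
        (excess_strandPastVertex (t := t) (f := f) (o := o) ()).symm).trans (h.fix l x hx)
    rw [zpow_neg, Equiv.Perm.inv_eq_iff_eq] at h1
    exact h1.symm

/-- The half-turn makes the left end of the strand the right end of the second picture, and the
former outer color of the upper legs the new vertex color. If the strand is below, the relation at
the vertex makes its two ends match; if it is above, that relation is transported to the new vertex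
color. -/
theorem exists_swapped_coloring (ht : ∀ l, t' l = t l.swap) (hf : f' = !f) {C : Set X}
    (hC : IsSubquandle C) {col : (strandPastVertex a b t f o).Darts → X}
    (h : (strandPastVertex a b t f o).LocalColoring col)
    (hfix : (strandPastVertex a b t f o).FixesColors C col) :
    ∃ col' : (strandPastVertex b a t' f' o).Darts → X,
      (strandPastVertex b a t' f' o).LocalColoring col' ∧
      (strandPastVertex b a t' f' o).FixesColors C col' ∧
      ∀ k, col (.bd (pastEquiv b a k)) = col' (.bd k) := by
  obtain ⟨d, hd⟩ := exists_leg_color h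
  have hy := hfix.mem d
  have hz := hfix.mem (.bd (.inr false))
  have hact := hfix.zpow_act' hd
  have hcol := eq_pastColoring h hd
  generalize col d = y at *
  generalize col (.bd (.inr false)) = z at *
  subst hcol
  have hy' := pastColoring_mem (t := t) (f := f) (o := o) hC hy hz
  have hy1 : outerColor f o y z ∈ C := by
    cases o
    · exact hy
    · exact hC _ _ hz _ hy
  refine ⟨pastColoring b a t' f' o (outerColor f o y z) (segmentColor t o y z (Fin.last a)),
    localColoring_pastColoring _ _, ⟨pastColoring_mem hC hy1 (hy' (.bd (.inr true))),
    fun l x hx => ?_⟩, ?_⟩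
  · refine (congrArg (fun n => (Rack.act' (outerColor f o y z) ^ n) x)
      ((excess_strandPastVertex (t := t') (f := f') (o := o) ()).trans
      (congrArg Neg.neg (sum_signExp_swap ht)))).trans ?_
    have h2 : ∀ x ∈ C, (Rack.act' y ^ (-∑ l, signExp (t l))) x = x := fun x hx => by
      rw [zpow_neg, Equiv.Perm.inv_eq_iff_eq, hact x hx]
    cases o
    · exact h2 x hx
    -- The new vertex color is the image of `y` under the strand's translation, so its power is a
    -- conjugate of one that fixes `C`.
    · exact zpow_act'_signedAct_fixed hC hz _ _ h2 x hx
  · rintro ((j | i) | (_ | _))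
    · exact (outerColor_outerColor hf y z).symm
    · rfl
    · rfl
    -- For a strand below, the two pictures together carry it once around the vertex: the
    -- translation by `y` acts with the full sum of signs, and this power fixes `z ∈ C`.
    · show z = segmentColor t' o (outerColor f o y z) (segmentColor t o y z (Fin.last a)) (Fin.last b)
      cases o
      · show z = (Rack.act' y ^ upperSum t' (Fin.last b)) ((Rack.act' y ^ upperSum t (Fin.last a)) z)
        rw [← Equiv.Perm.mul_apply, ← zpow_add, upperSum_last_add ht, hact z hz]
      · rfl

end Past

end Diagram

end GraphTangle

namespace GraphTangle

namespace Diagram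

variable {K : Type} {X H : Type*} [Quandle X] [Group H]

/-! ### Walks and weights in the fifth move -/

section PastWalks

variable {a b : ℕ} {t : Fin a ⊕ Fin b → Bool} {f o : Bool}

/-- The weight of the crossing with the strand for a walk that approaches the vertex. -/
def entryWeight (φ : X → X → H) (f o : Bool) (y z : X) : H :=
  if o then signedWeight φ f z (signedAct (!f) z y) else 1

/-- The weight of a crossing with an incoming leg for a walk along the strand to the left. -/
def strandWeight (φ : X → X → H) (o : Bool) (y z : X) : H := if o then 1 else φ z y

/-- The weight `w` for the upper legs, and `1` for the lower legs. -/
def legWeight (w : H) : Fin a ⊕ Fin b → H := Sum.elim (fun _ => w) fun _ => 1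

theorem arrivalWeight_pastColoring_one (φ : X → X → H) (y z : X) (i : Fin a) :
    (strandPastVertex a b t f o).arrivalWeight φ (pastColoring a b t f o y z) (.cr i 1) =
      entryWeight φ f o y z := by
  cases o
  · exact arrivalWeight_over _ _ _ _ _ rfl
  · exact (localColoring_pastColoring y z).arrivalWeight_under φ i 1 rfl

theorem arrivalWeight_pastColoring_three (φ : X → X → H) (y z : X) (i : Fin a) :
    (strandPastVertex a b t f o).arrivalWeight φ (pastColoring a b t f o y z) (.cr i 3) =
      (entryWeight φ f o y z)⁻¹ :=
  ((localColoring_pastColoring y z).arrivalWeight_add_two φ i 1).trans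
    (congrArg _ (arrivalWeight_pastColoring_one φ y z i))

/-- The color of a strand below the legs changes by powers of the translation by `y`, which `hφ`
makes invisible to the weight. The position `i` therefore affects only the exponent. -/
theorem arrivalWeight_pastColoring_zero {φ : X → X → H} (hφ : ∀ y z : X, φ (z ◃ y) z = φ y z)
    (y z : X) (i : Fin a) :
    (strandPastVertex a b t f o).arrivalWeight φ (pastColoring a b t f o y z) (.cr i 0) =
      strandWeight φ o y z ^ signExp (t (.inl i)) := by
  cases o
  · exact ((localColoring_pastColoring y z).arrivalWeight_under φ i 0 rfl).trans
      (signedWeight_zpow hφ _ _ _ _)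
  · exact (arrivalWeight_over _ _ _ _ _ rfl).trans (one_zpow _).symm

theorem run_leg_strandPastVertex (φ : X → X → H) (y z : X) (l : Fin a ⊕ Fin b) :
    Run (strandPastVertex a b t f o) φ (pastColoring a b t f o y z) (.leg l) (.inl l)
      (legWeight (entryWeight φ f o y z) l)⁻¹ := by
  rcases l with i | j
  · have := Run.cross (D := strandPastVertex a b t f o) (φ := φ) (col := pastColoring a b t f o y z)
      (d := .leg (.inl i)) (c := i) (i := 3) rfl (.arrive (k := .inl (.inl i)) rfl)
    rwa [arrivalWeight_pastColoring_three, mul_one] at this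
  · rw [legWeight, Sum.elim_inr, inv_one]
    exact .arrive rfl

theorem runLeg_strandPastVertex (φ : X → X → H) (y z : X) (l : Fin a ⊕ Fin b) :
    RunLeg (strandPastVertex a b t f o) φ (pastColoring a b t f o y z) (.bd (.inl l)) l
      (legWeight (entryWeight φ f o y z) l) := by
  rcases l with i | j
  · have := RunLeg.cross (D := strandPastVertex a b t f o) (φ := φ)
      (col := pastColoring a b t f o y z) (d := .bd (.inl (.inl i))) (c := i) (i := 1) rfl
      (.arrive (l := (Sum.inl i : Fin a ⊕ Fin b)) rfl)
    rwa [arrivalWeight_pastColoring_one, mul_one] at this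
  · exact .arrive rfl

theorem leftEnd_last {B J L : Type} {w : B} :
    leftEnd (J := J) (L := L) w (Fin.last a) = .bd w := Fin.lastCases_last

theorem leftEnd_castSucc {B J L : Type} {w : B} (i : Fin a) :
    leftEnd (J := J) (L := L) w i.castSucc = .cr i 0 := Fin.lastCases_castSucc _

/-- All factors are powers of the same element, so the product is determined by the signed number of
upper legs. -/
theorem run_strand_strandPastVertex {φ : X → X → H} (hφ : ∀ y z : X, φ (z ◃ y) z = φ y z) (y z : X) :
    Run (strandPastVertex a b t f o) φ (pastColoring a b t f o y z) (.bd (.inr false)) (.inr true)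
      (strandWeight φ o y z ^ upperSum t (Fin.last a)) := by
  have key : ∀ i : Fin (a + 1), Run (strandPastVertex a b t f o) φ (pastColoring a b t f o y z)
      (rightEnd (.inr false) i) (.inr true)
      (strandWeight φ o y z ^ (upperSum t (Fin.last a) - upperSum t i)) := by
    -- Runs are built from their end, hence the induction starts with the last segment, at the left
    -- end of the strand.
    refine Fin.reverseInduction ?_ fun i ih => ?_
    · rw [sub_self, zpow_zero]
      exact .arrive ((pastLink_rightEnd (Fin.last a)).trans leftEnd_last)
    · have := Run.cross (D := strandPastVertex a b t f o) (φ := φ)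
        (col := pastColoring a b t f o y z) (d := rightEnd (.inr false) i.castSucc) (c := i) (i := 0)
        ((pastLink_rightEnd i.castSucc).trans (leftEnd_castSucc _))  ih
      rw [arrivalWeight_pastColoring_zero hφ, ← zpow_add, upperSum_succ] at this
      convert this using 2
      ring
  have := key 0
  rwa [upperSum_zero, sub_zero] at this

variable {t' : Fin b ⊕ Fin a → Bool} {f' : Bool}

/-- In the second picture a walk towards the vertex passes under the strand in the other direction,
and starts from the former vertex color. -/
theorem entryWeight_swap (φ : X → X → H) (hf : f' = !f) (y z : X) :
    entryWeight φ f' o (outerColor f o y z) (segmentColor t o y z (Fin.last a)) =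
      (entryWeight φ f o y z)⁻¹ := by
  subst hf
  cases o
  · exact inv_one.symm
  · show signedWeight φ (!f) z (signedAct (!!f) z (signedAct (!f) z y)) = _
    rw [signedAct_not_signedAct]
    have := signedWeight_not φ f z (signedAct (!f) z y)
    rwa [signedAct_signedAct_not] at this

theorem strandWeight_swap {φ : X → X → H} (hφ : ∀ y z : X, φ (z ◃ y) z = φ y z) (y z : X) :
    strandWeight φ o (outerColor f o y z) (segmentColor t o y z (Fin.last a)) =
      strandWeight φ o y z := by
  cases o
  · have := signedWeight_zpow hφ true y z (upperSum t (Fin.last a))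
    exact this.trans (zpow_one _)
  · rfl

/-- The colors of the second picture, if both pictures have the same boundary colors. -/
theorem eq_swapped_coloring (hf : f' = !f) {y z : X}
    {col' : (strandPastVertex b a t' f' o).Darts → X}
    (h' : (strandPastVertex b a t' f' o).LocalColoring col')
    (hb : ∀ k, pastColoring a b t f o y z (.bd (pastEquiv b a k)) = col' (.bd k)) :
    col' = pastColoring b a t' f' o (outerColor f o y z) (segmentColor t o y z (Fin.last a)) := by
  have hz : col' (.bd (.inr false)) = segmentColor t o y z (Fin.last a) := (hb (.inr false)).symm
  rw [← hz]
  refine eq_pastColoring h' fun l => ?_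
  obtain ⟨d, hd⟩ := exists_leg_color h'
  have hcol := eq_pastColoring h' hd
  rw [hd l]
  rcases l with j | i
  · have h1 : y = outerColor f' o (col' d) (col' (.bd (.inr false))) :=
      (hb (.inl (.inl j))).trans (congrFun hcol _)
    rw [hz] at h1
    subst hf
    cases o
    · exact h1.symm
    · have h2 : y = signedAct (!!f) z (col' d) := h1
      show _ = signedAct (!f) z y
      rw [h2, signedAct_signedAct_not]
  · exact (hd _).symm.trans (((h'.segment (.leg (.inr i))).symm).trans (hb (.inl (.inr i))).symm)

/-- Walks along the strand are compared through the excess and `hH`. For walks through the vertex,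
vertex-constancy gives all upper legs the same factor `w`; the moved strand gives all lower legs
`w⁻¹` instead, and the product over entering and leaving stays the same. -/
theorem walksMatch_strandPastVertex {φ : X → X → H} (hφ : ∀ y z : X, φ (z ◃ y) z = φ y z) {s : ℕ}
    (hH : ∀ h : H, h ^ s = 1) (ht : ∀ l, t' l = t l.swap) (hf : f' = !f)
    (hs : (s : ℤ) ∣ (strandPastVertex a b t f o).excess ())
    {col : (strandPastVertex a b t f o).Darts → X}
    {col' : ((strandPastVertex b a t' f' o).rename (pastEquiv b a)).Darts → X}
    (h : (strandPastVertex a b t f o).LocalColoring col)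
    (h' : ((strandPastVertex b a t' f' o).rename (pastEquiv b a)).LocalColoring col')
    (hb : ∀ k, col (.bd k) = col' (.bd k)) : WalksMatch φ col col' := by
  obtain ⟨d, hd⟩ := exists_leg_color h
  have hcol := eq_pastColoring h hd
  generalize col d = y at *
  generalize col (.bd (.inr false)) = z at *
  subst hcol
  have hcol' := eq_swapped_coloring hf ((localColoring_rename_iff _ _ _).1 h')
    fun k => hb (pastEquiv b a k)
  have hs1 : Spokes (strandPastVertex a b t f o) φ (pastColoring a b t f o y z)
      (M := Fin a ⊕ Fin b) Sum.inl id fun m => (legWeight (entryWeight φ f o y z) m)⁻¹ :=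
    ⟨Sum.inl_injective, Function.surjective_id, fun _ _ => rfl, run_leg_strandPastVertex φ y z⟩
  have hs2 : Spokes ((strandPastVertex b a t' f' o).rename (pastEquiv b a)) φ col'
      (M := Fin a ⊕ Fin b) Sum.inl (id (Sum.swap : _ → Fin b ⊕ Fin a))
      fun m => (legWeight (entryWeight φ f o y z)⁻¹ m.swap)⁻¹ := by
    refine ⟨Sum.inl_injective, (Equiv.sumComm (Fin a) (Fin b)).surjective, fun _ _ => rfl,
      fun m => ?_⟩
    have r := run_leg_strandPastVertex (t := t') (f := f') (o := o) φ (outerColor f o y z)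
      (segmentColor t o y z (Fin.last a)) m.swap
    rw [entryWeight_swap φ hf, ← hcol'] at r
    have := r.rename
    rcases m with m | m <;> exact this
  refine .of_matchAt fun k k' => ?_
  have hstrand : ∃ g, Run (strandPastVertex a b t f o) φ (pastColoring a b t f o y z)
      (.bd (.inr false)) (.inr true) g ∧
      Run ((strandPastVertex b a t' f' o).rename (pastEquiv b a)) φ col'
      (.bd (.inr false)) (.inr true) g := by
    refine ⟨_, run_strand_strandPastVertex hφ y z, ?_⟩
    have r := run_strand_strandPastVertex (a := b) (b := a) (t := t') (f := f') (o := o) hφ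
      (outerColor f o y z) (segmentColor t o y z (Fin.last a))
    rw [strandWeight_swap hφ, ← hcol'] at r
    -- The half-turned picture follows the strand from its other end, so its run has to be reversed.
    have r1 := Run.reverse h' r.rename
    -- The two routes differ by the power with the full sum of signs, a multiple of `s`, which is
    -- trivial in `H`.
    have e : (strandWeight φ o y z ^ upperSum t' (Fin.last b))⁻¹ =
        strandWeight φ o y z ^ upperSum t (Fin.last a) := by
      rw [inv_eq_iff_mul_eq_one, ← zpow_add, upperSum_last_add ht]
      have hs' : (s : ℤ) ∣ ∑ l, signExp (t l) := by
        have := (excess_strandPastVertex (t := t) (f := f) (o := o) ()) ▸ hs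
        exact (dvd_neg).1 this
      obtain ⟨m, hm⟩ := hs'
      rw [hm, zpow_mul, zpow_natCast, hH, one_zpow]
    rw [e] at r1
    exact r1
  rcases k with l | _ | _
  · have r := (runLeg_strandPastVertex (t := t') (f := f') (o := o) φ (outerColor f o y z)
      (segmentColor t o y z (Fin.last a)) l.swap)
    rw [entryWeight_swap φ hf, ← hcol'] at r
    have r' : RunLeg ((strandPastVertex b a t' f' o).rename (pastEquiv b a)) φ col'
        (.bd (.inl l)) (id (Sum.swap : _ → Fin b ⊕ Fin a) l)
        (legWeight (entryWeight φ f o y z)⁻¹ l.swap) := by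
      have := r.rename
      rcases l with l | l <;> exact this
    refine .of_runLeg hs1 hs2 (runLeg_strandPastVertex φ y z l) r' (fun m => ?_) k'
    -- With `w` for upper legs before and `w⁻¹` for lower legs after the move, both products are `1`
    -- for two legs on the same side, `w` from upper to lower, and `w⁻¹` from lower to upper.
    rcases l with l | l <;> rcases m with m | m <;> simp [legWeight]
  · obtain ⟨g, r, r'⟩ := hstrand
    exact .of_run r r' k'
  · obtain ⟨g, r, r'⟩ := hstrand
    exact .of_run (r.reverse h) (r'.reverse h') k'

theorem excess_swapped (ht : ∀ l, t' l = t l.swap)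
    (v : ((strandPastVertex b a t' f' o).rename (pastEquiv b a)).Vertex) :
    ((strandPastVertex b a t' f' o).rename (pastEquiv b a)).excess v =
      (strandPastVertex a b t f o).excess () :=
  excess_eq_of_equiv (D := strandPastVertex a b t f o)
    (D' := (strandPastVertex b a t' f' o).rename (pastEquiv b a)) (Equiv.sumComm (Fin a) (Fin b))
    (fun _ => ⟨fun _ => rfl, fun _ => rfl⟩) fun (l : Fin a ⊕ Fin b) =>
      (ht l.swap).trans (congrArg t l.swap_swap)

theorem interchangeable_strandPastVertex {φ : X → X → H} (hφ : ∀ y z : X, φ (z ◃ y) z = φ y z)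
    {s : ℕ} (hH : ∀ h : H, h ^ s = 1) (a b : ℕ) (t : Fin a ⊕ Fin b → Bool) (f o : Bool) :
    Interchangeable φ s (strandPastVertex a b t f o)
      ((strandPastVertex b a (fun l => t l.swap) (!f) o).rename (pastEquiv b a)) := by
  refine ⟨⟨fun h v => ?_, fun h v => ?_⟩, ?_, ?_, determinedByBoundary_strandPastVertex,
    determinedByBoundary_strandPastVertex.rename _, fun hs col col' h h' hb =>
      walksMatch_strandPastVertex hφ hH (fun _ => rfl) rfl (hs ()) h h' hb⟩
  · exact (excess_swapped (t := t) (f := f) (o := o) (fun _ => rfl) v).symm ▸ h ()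
  · exact (excess_swapped (t := t) (f := f) (o := o) (f' := !f) (fun _ => rfl) ()) ▸ h ()
  · intro C hC col h hfix
    obtain ⟨col', h1, h2, h3⟩ := exists_swapped_coloring (t' := fun l => t l.swap) (fun _ => rfl) rfl
      hC h hfix
    obtain ⟨col'', rfl⟩ := exists_comp_renameDart _ (pastEquiv b a) col'
    refine ⟨col'', (localColoring_rename_iff _ _ _).2 h1, (fixesColors_rename_iff _ _ _ _).2 h2,
      fun k => ?_⟩
    obtain ⟨k, rfl⟩ := (pastEquiv b a).surjective k
    exact h3 k
  · intro C hC col h hfix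
    -- The move is its own inverse up to the half-turn: with `a` and `b` exchanged, swapping the
    -- legs and negating the direction a second time restores `t` and `f`.
    obtain ⟨col', h1, h2, h3⟩ := exists_swapped_coloring (t' := t) (f' := f)
      (fun l => (congrArg t l.swap_swap).symm) (Bool.not_not f).symm hC
      ((localColoring_rename_iff _ _ _).1 h) ((fixesColors_rename_iff _ _ _ _).1 hfix)
    refine ⟨col', h1, h2, fun k => Eq.trans ?_ (h3 k)⟩
    rcases k with (k | k) | _ | _ <;> rfl

end PastWalks

/-! ### Invariance -/

theorem LocalMove.interchangeable {φ : X → X → H} (hφ : IsQuandleTwoCocycle φ)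
    (hφ' : ∀ y z : X, φ (z ◃ y) z = φ y z) {s : ℕ} (hH : ∀ h : H, h ^ s = 1) {I I' : Diagram K}
    (h : LocalMove I I') : Interchangeable φ s I I' := by
  cases h with
  | r1 f left o => exact interchangeable_strand_curl hφ s f left o
  | r2 f g o => exact interchangeable_parallel_bigon φ s f g o
  | r3 f h => exact interchangeable_triangle hφ s f h
  | r4 t o => exact interchangeable_star_twistedStar hφ s t o
  | r5 a b t f o => exact interchangeable_strandPastVertex hφ' hH a b t f o

variable {B : Type} {D D' : Diagram B}

theorem Step.dvd_excess_iff {φ : X → X → H} (hφ : IsQuandleTwoCocycle φ)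
    (hφ' : ∀ y z : X, φ (z ◃ y) z = φ y z) {s : ℕ} (hH : ∀ h : H, h ^ s = 1) (h : Step D D') :
    (∀ v, (s : ℤ) ∣ D.excess v) ↔ ∀ v, (s : ℤ) ∣ D'.excess v := by
  cases h with
  | iso e =>
    rw [← e.vertex.forall_congr_right (q := fun v => (s : ℤ) ∣ D'.excess v)]
    simp only [e.excess_eq]
  | subdivide => exact Iff.rfl
  | replace O hI h h' => exact (hI.interchangeable hφ hφ' hH).dvd_excess_glue_iff h h'

theorem Step.psi_eq {φ : X → X → H} (hφ : IsQuandleTwoCocycle φ)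
    (hφ' : ∀ y z : X, φ (z ◃ y) z = φ y z) {s : ℕ} (hH : ∀ h : H, h ^ s = 1) (h : Step D D')
    (hs : ∀ v, (s : ℤ) ∣ D.excess v) (b b' : B) (n : ℕ) (q : X) :
    D.psi φ b b' n q = D'.psi φ b b' n q := by
  cases h with
  | iso e => exact e.psi_eq φ b b' n q
  | subdivide => exact subdivide_psi_eq D _ φ b b' n q
  | replace O hI h h' => exact (hI.interchangeable hφ hφ' hH).psi_eq h h' hs b b' n q

end Diagram

/-- The divisibility is assumed for one diagram but needed for every diagram in the sequence. Its
invariance is therefore proved in the same induction, as an equivalence so that steps can also be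
read backwards. -/
theorem ReidemeisterEquivalent.psi_eq {X H : Type*} [Quandle X] [Group H] {φ : X → X → H}
    (hφ : IsQuandleTwoCocycle φ) (hφ' : ∀ y z : X, φ (z ◃ y) z = φ y z) {s : ℕ}
    (hH : ∀ h : H, h ^ s = 1) {m : ℕ} {D D' : GraphTangleDiagram m} (h : ReidemeisterEquivalent D D') :
    ((∀ v, (s : ℤ) ∣ D.excess v) ↔ ∀ v, (s : ℤ) ∣ D'.excess v) ∧
      ((∀ v, (s : ℤ) ∣ D.excess v) → ∀ (b b' : Fin m) (n : ℕ) (q : X),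
        D.psi φ b b' n q = D'.psi φ b b' n q) := by
  induction h with
  | rel D D' h =>
    exact ⟨h.dvd_excess_iff hφ hφ' hH, fun hs b b' n q => h.psi_eq hφ hφ' hH hs b b' n q⟩
  | refl D => exact ⟨Iff.rfl, fun _ _ _ _ _ => rfl⟩
  | symm D D' _ ih => exact ⟨ih.1.symm, fun hs b b' n q => (ih.2 (ih.1.2 hs) b b' n q).symm⟩
  | trans D D' D'' _ _ ih ih' =>
    exact ⟨ih.1.trans ih'.1, fun hs b b' n q =>
      (ih.2 hs b b' n q).trans (ih'.2 (ih.1.1 hs) b b' n q)⟩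

end GraphTangle

theorem theorem3p8 {X H : Type*} [Quandle X] [Fintype X] [Group H] (φ : X → X → H)
    (hφ : GraphTangle.IsQuandleTwoCocycle φ) (hφ' : ∀ y z : X, φ (Shelf.act z y) z = φ y z)
    {m : ℕ} (D D' : GraphTangle.GraphTangleDiagram m)
    (s : ℕ) (hs : ∀ v, (s : ℤ) ∣ (D.inDegree v : ℤ) - (D.outDegree v : ℤ)) (hH : ∀ h : H, h ^ s = 1)
    (hDD' : GraphTangle.ReidemeisterEquivalent D D') (b b' : Fin m) (n : ℕ) :
    (∀ q : X, D.psi φ b b' n q = D'.psi φ b b' n q) ∧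
      D.psiTotal φ b b' n = D'.psiTotal φ b b' n := by
  have h := (hDD'.psi_eq hφ hφ' hH).2 hs b b' n
  exact ⟨h, Multiset.map_congr rfl fun q _ => h q⟩
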